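/- **Setting.** Let $\mathbf O$ be the real octonions with basis $e_0=1,e_1,\dots,e_7$, where $e_i^2=-1$ for $i\ge1$, $e_ie_j=-e_je_i$ for distinct $i,j\ge 1$, and $e_le_m=e_n$, $e_me_n=e_l$, $e_ne_l=e_m$ for $(l,m,n)\in\{(1,2,3),(3,5,6),(6,7,1),(1,4,5),(3,4,7),(6,4,2),(2,5,7)\}$. Let $x\mapsto\overline x$ be the octonion conjugation, extended $\mathbb C$-linearly to $\mathbf O^{\mathbb C}=\mathbf O\otimes_{\mathbb R}\mathbb C$. For $\xi_i\in\mathbb R$, $x_i\in\mathbf O$ put $$h^1(\xi_1,\xi_2,\xi_3;x_1,x_2,x_3)=\begin{pmatrix}\xi_1&\sqrt{-1}\,x_3&\sqrt{-1}\,\overline{x_2}\\ \sqrt{-1}\,\overline{x_3}&\xi_2&x_1\\ \sqrt{-1}\,x_2&\overline{x_1}&\xi_3\end{pmatrix}\in M(3,\mathbf O^{\mathbb C}),$$ and let $\mathcal J^1$ be the $27$-dimensional real space of all these matrices, with the Jordan product $X\circ Y=\frac12(XY+YX)$ and identity $E$. Put $\mathrm{tr}(X)=\xi_1+\xi_2+\xi_3$,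 $(X|Y)=\mathrm{tr}(X\circ Y)$, $$X\times Y=\tfrac12\bigl(2X\circ Y-\mathrm{tr}(X)Y-\mathrm{tr}(Y)X+(\mathrm{tr}(X)\mathrm{tr}(Y)-(X|Y))E\bigr),\qquad X^{\times2}=X\times X,$$ and $\det(X)=\frac13(X|X\times X)$. The characteristic roots of $X$ are the roots in $\mathbb C$, with multiplicities, of the cubic real polynomial $\Phi_X(\lambda)=\det(\lambda E-X)$. The group $\mathrm F_{4(-20)}$ is the group of all $\mathbb R$-linear bijections $g$ of $\mathcal J^1$ with $g(X\circ Y)=gX\circ gY$. Write $\mathrm{diag}(a,b,c)=h^1(a,b,c;0,0,0)$, $E_1=\mathrm{diag}(1,0,0)$, $F_3^1(x)=h^1(0,0,0;0,0,x)$, $P^+=h^1(1,-1,0;0,0,1)$, $P^-=h^1(-1,1,0;0,0,1)$, $Q^+(1)=h^1(0,0,0;1,1,0)$. For $X\in\mathcal J^1$, $\lambda\in\mathbb R$ put $V_X=\{aX^{\times2}+bX+cE: a,b,c\in\mathbb R\}$, $p(X)=X-\frac13\mathrm{tr}(X)E$ and, if $\mathrm{tr}((\lambda E-X)^{\times2})\ne0$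 (which holds when $\lambda$ is a simple characteristic root), $$E_{X,\lambda}=\frac{(\lambda E-X)^{\times2}}{\mathrm{tr}((\lambda E-X)^{\times2})},\qquad W_{X,\lambda}=X-\Bigl(\lambda E_{X,\lambda}+\tfrac12(\mathrm{tr}(X)-\lambda)(E-E_{X,\lambda})\Bigr).$$ Finally put $$\mathcal H(\mathbf O)=\{X: X^{\times2}=0,\ \mathrm{tr}X=1,\ (X|E_1)\ge1\},\qquad \mathcal H'(\mathbf O)=\{X: X^{\times2}=0,\ \mathrm{tr}X=1,\ (X|E_1)\le0\},$$ $$\mathcal N_1^{+}(\mathbf O)=\{X: X^{\times2}=0,\ \mathrm{tr}X=0,\ (X|E_1)>0\},\qquad \mathcal N_1^{-}(\mathbf O)=\{X: X^{\times2}=0,\ \mathrm{tr}X=0,\ (X|E_1)<0\},$$ $$\mathcal N_2(\mathbf O)=\{X: \mathrm{tr}X=\mathrm{tr}(X^{\times2})=\det X=0,\ X^{\times2}\ne0\}.$$ **Theorem.** The sets $\mathcal H(\mathbf O)$, $\mathcal H'(\mathbf O)$ are disjoint, the sets $\{0\}$, $\mathcal N_1^+(\mathbf O)$, $\mathcal N_1^-(\mathbf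 O)$, $\mathcal N_2(\mathbf O)$ are pairwise disjoint, and for $X\in\mathcal J^1$ the following holds; "$X\sim Y$" means that $X$ and $Y$ lie in the same $\mathrm F_{4(-20)}$-orbit. (1) Suppose that $X$ has the characteristic roots $\lambda_1>\lambda_2>\lambda_3$. Then there is a unique $i\in\{1,2,3\}$ such that, with indices modulo $3$, $\mathcal H(\mathbf O)\cap V_X=\{E_{X,\lambda_i}\}$, $\mathcal H'(\mathbf O)\cap V_X=\{E_{X,\lambda_{i+1}},E_{X,\lambda_{i+2}}\}$ and $E_{X,\lambda_{i+1}}\ne E_{X,\lambda_{i+2}}$. Moreover 1. $E_{X,\lambda_1}\in\mathcal H(\mathbf O)$ if and only if $X\sim\mathrm{diag}(\lambda_1,\lambda_2,\lambda_3)$; 2. $E_{X,\lambda_2}\in\mathcal H(\mathbf O)$ if and only if $X\sim\mathrm{diag}(\lambda_2,\lambda_3,\lambda_1)$; 3. $E_{X,\lambda_3}\in\mathcal H(\mathbf O)$ if and only if $X\sim\mathrm{diag}(\lambda_3,\lambda_1,\lambda_2)$. (2) Suppose that $X$ has the characteristic roots $\lambda_1\in\mathbb R$ and $p\pm\sqrt{-1}\,q$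 with $p\in\mathbb R$, $q>0$. Then 4. $X\sim\mathrm{diag}(p,p,\lambda_1)+F_3^1(q)$. (3) Suppose that $X$ has the characteristic roots $\lambda_1$ of multiplicity $1$ and $\lambda_2\neq\lambda_1$ of multiplicity $2$. Then (i) $E_{X,\lambda_1}\in\mathcal H(\mathbf O)\cup\mathcal H'(\mathbf O)$; (ii) $W_{X,\lambda_1}\in\{0\}\cup\mathcal N_1^+(\mathbf O)\cup\mathcal N_1^-(\mathbf O)$; (iii) if $E_{X,\lambda_1}\in\mathcal H(\mathbf O)$ then $W_{X,\lambda_1}=0$; (iv) if $W_{X,\lambda_1}\ne0$ then $E_{X,\lambda_1}\in\mathcal H'(\mathbf O)$. Moreover 5. $E_{X,\lambda_1}\in\mathcal H(\mathbf O)$ if and only if $X\sim\mathrm{diag}(\lambda_1,\lambda_2,\lambda_2)$; 6. $E_{X,\lambda_1}\in\mathcal H'(\mathbf O)$ and $W_{X,\lambda_1}=0$ if and only if $X\sim\mathrm{diag}(\lambda_2,\lambda_2,\lambda_1)$; 7. $W_{X,\lambda_1}\in\mathcal N_1^+(\mathbf O)$ if and only if $X\sim\mathrm{diag}(\lambda_2,\lambda_2,\lambda_1)+P^+$;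 8. $W_{X,\lambda_1}\in\mathcal N_1^-(\mathbf O)$ if and only if $X\sim\mathrm{diag}(\lambda_2,\lambda_2,\lambda_1)+P^-$. (4) Suppose that $X$ has a characteristic root of multiplicity $3$. Then $p(X)\in\{0\}\cup\mathcal N_1^+(\mathbf O)\cup\mathcal N_1^-(\mathbf O)\cup\mathcal N_2(\mathbf O)$. Moreover 9. $p(X)=0$ if and only if $X\sim\frac13\mathrm{tr}(X)E$; 10. $p(X)\in\mathcal N_1^+(\mathbf O)$ if and only if $X\sim\frac13\mathrm{tr}(X)E+P^+$; 11. $p(X)\in\mathcal N_1^-(\mathbf O)$ if and only if $X\sim\frac13\mathrm{tr}(X)E+P^-$; 12. $p(X)\in\mathcal N_2(\mathbf O)$ if and only if $X\sim\frac13\mathrm{tr}(X)E+Q^+(1)$. Every $X\in\mathcal J^1$ lies in the orbit of one of the canonical forms 1–12. (5) No two different ones among the canonical forms 1–12 (different in type, or of the same type with different parameters, where the parameters are real numbers $\lambda_1>\lambda_2>\lambda_3$ in 1–3; $\lambda_1,p,q$ with $q>0$ in 4; $\lambda_1\ne\lambda_2$ in 5–8; and $r=\frac13\mathrm{tr}(X)$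 in 9–12) lie in the same $\mathrm F_{4(-20)}$-orbit. -/

import Mathlib

noncomputable section

namespace ExcJordan

/-! ### Octonions over a commutative ring -/

/-- The octonions with coefficients in `R`: the element `x` stands for `∑ x.c k • e k`, where `e 0` is
the unit.  `Oct ℝ` is the algebra `𝐎` and `Oct ℂ` is its complexification `𝐎^ℂ`. -/
@[ext] structure Oct (R : Type*) where
  /-- The coordinates. -/
  c : Fin 8 → R

namespace Oct

instance (R : Type*) [CommRing R] : Zero (Oct R) := ⟨⟨0⟩⟩
instance (R : Type*) [CommRing R] : Add (Oct R) := ⟨fun x y => ⟨x.c + y.c⟩⟩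
instance (R : Type*) [CommRing R] : Neg (Oct R) := ⟨fun x => ⟨-x.c⟩⟩
instance (R : Type*) [CommRing R] : Sub (Oct R) := ⟨fun x y => ⟨x.c - y.c⟩⟩
instance (S R : Type*) [SMul S R] : SMul S (Oct R) := ⟨fun a x => ⟨a • x.c⟩⟩

theorem c_injective (R : Type*) : Function.Injective (c : Oct R → Fin 8 → R) := fun _ _ => Oct.ext

instance (R : Type*) [CommRing R] : AddCommGroup (Oct R) :=
  (c_injective R).addCommGroup c rfl (fun _ _ => rfl) (fun _ => rfl) (fun _ _ => rfl)
    (fun _ _ => rfl) (fun _ _ => rfl)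

/-- The coordinates as an additive map. -/
def cHom (R : Type*) [CommRing R] : Oct R →+ (Fin 8 → R) where
  toFun := c
  map_zero' := rfl
  map_add' _ _ := rfl

instance (S R : Type*) [Semiring S] [CommRing R] [Module S R] : Module S (Oct R) :=
  (c_injective R).module S (cHom R) (fun _ _ => rfl)

/-- The basis element `e k`. -/
def e (R : Type*) [CommRing R] (k : Fin 8) : Oct R := ⟨fun j => if j = k then 1 else 0⟩

/-- The octonion product with `e l * e m = e n`, `e m * e n = e l`, `e n * e l = e m` for
`(l, m, n)` among `(1,2,3), (3,5,6), (6,7,1), (1,4,5), (3,4,7), (6,4,2), (2,5,7)`,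
`e i * e i = - 1` and `e i * e j = - e j * e i` for distinct `i, j ≥ 1`
(this is checked in `mul_table` below). -/
protected def mul {R : Type*} [CommRing R] (x y : Oct R) : Oct R :=
  ⟨![x.c 0 * y.c 0 - x.c 1 * y.c 1 - x.c 2 * y.c 2 - x.c 3 * y.c 3 - x.c 4 * y.c 4
      - x.c 5 * y.c 5 - x.c 6 * y.c 6 - x.c 7 * y.c 7,
    x.c 0 * y.c 1 + x.c 1 * y.c 0 + x.c 2 * y.c 3 - x.c 3 * y.c 2 + x.c 4 * y.c 5
      - x.c 5 * y.c 4 + x.c 6 * y.c 7 - x.c 7 * y.c 6,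
    x.c 0 * y.c 2 - x.c 1 * y.c 3 + x.c 2 * y.c 0 + x.c 3 * y.c 1 - x.c 4 * y.c 6
      + x.c 5 * y.c 7 + x.c 6 * y.c 4 - x.c 7 * y.c 5,
    x.c 0 * y.c 3 + x.c 1 * y.c 2 - x.c 2 * y.c 1 + x.c 3 * y.c 0 + x.c 4 * y.c 7
      + x.c 5 * y.c 6 - x.c 6 * y.c 5 - x.c 7 * y.c 4,
    x.c 0 * y.c 4 - x.c 1 * y.c 5 + x.c 2 * y.c 6 - x.c 3 * y.c 7 + x.c 4 * y.c 0
      + x.c 5 * y.c 1 - x.c 6 * y.c 2 + x.c 7 * y.c 3,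
    x.c 0 * y.c 5 + x.c 1 * y.c 4 - x.c 2 * y.c 7 - x.c 3 * y.c 6 - x.c 4 * y.c 1
      + x.c 5 * y.c 0 + x.c 6 * y.c 3 + x.c 7 * y.c 2,
    x.c 0 * y.c 6 - x.c 1 * y.c 7 - x.c 2 * y.c 4 + x.c 3 * y.c 5 + x.c 4 * y.c 2
      - x.c 5 * y.c 3 + x.c 6 * y.c 0 + x.c 7 * y.c 1,
    x.c 0 * y.c 7 + x.c 1 * y.c 6 + x.c 2 * y.c 5 + x.c 3 * y.c 4 - x.c 4 * y.c 3
      - x.c 5 * y.c 2 - x.c 6 * y.c 1 + x.c 7 * y.c 0]⟩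

instance (R : Type*) [CommRing R] : Mul (Oct R) := ⟨Oct.mul⟩

instance (R : Type*) [CommRing R] : One (Oct R) := ⟨e R 0⟩

@[simp] theorem mul_apply_0 {R : Type*} [CommRing R] (x y : Oct R) : (x * y).c 0 =
    x.c 0 * y.c 0 - x.c 1 * y.c 1 - x.c 2 * y.c 2 - x.c 3 * y.c 3 - x.c 4 * y.c 4
      - x.c 5 * y.c 5 - x.c 6 * y.c 6 - x.c 7 * y.c 7 := rfl

@[simp] theorem mul_apply_1 {R : Type*} [CommRing R] (x y : Oct R) : (x * y).c 1 =
    x.c 0 * y.c 1 + x.c 1 * y.c 0 + x.c 2 * y.c 3 - x.c 3 * y.c 2 + x.c 4 * y.c 5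
      - x.c 5 * y.c 4 + x.c 6 * y.c 7 - x.c 7 * y.c 6 := rfl

@[simp] theorem mul_apply_2 {R : Type*} [CommRing R] (x y : Oct R) : (x * y).c 2 =
    x.c 0 * y.c 2 - x.c 1 * y.c 3 + x.c 2 * y.c 0 + x.c 3 * y.c 1 - x.c 4 * y.c 6
      + x.c 5 * y.c 7 + x.c 6 * y.c 4 - x.c 7 * y.c 5 := rfl

@[simp] theorem mul_apply_3 {R : Type*} [CommRing R] (x y : Oct R) : (x * y).c 3 =
    x.c 0 * y.c 3 + x.c 1 * y.c 2 - x.c 2 * y.c 1 + x.c 3 * y.c 0 + x.c 4 * y.c 7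
      + x.c 5 * y.c 6 - x.c 6 * y.c 5 - x.c 7 * y.c 4 := rfl

@[simp] theorem mul_apply_4 {R : Type*} [CommRing R] (x y : Oct R) : (x * y).c 4 =
    x.c 0 * y.c 4 - x.c 1 * y.c 5 + x.c 2 * y.c 6 - x.c 3 * y.c 7 + x.c 4 * y.c 0
      + x.c 5 * y.c 1 - x.c 6 * y.c 2 + x.c 7 * y.c 3 := rfl

@[simp] theorem mul_apply_5 {R : Type*} [CommRing R] (x y : Oct R) : (x * y).c 5 =
    x.c 0 * y.c 5 + x.c 1 * y.c 4 - x.c 2 * y.c 7 - x.c 3 * y.c 6 - x.c 4 * y.c 1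
      + x.c 5 * y.c 0 + x.c 6 * y.c 3 + x.c 7 * y.c 2 := rfl

@[simp] theorem mul_apply_6 {R : Type*} [CommRing R] (x y : Oct R) : (x * y).c 6 =
    x.c 0 * y.c 6 - x.c 1 * y.c 7 - x.c 2 * y.c 4 + x.c 3 * y.c 5 + x.c 4 * y.c 2
      - x.c 5 * y.c 3 + x.c 6 * y.c 0 + x.c 7 * y.c 1 := rfl

@[simp] theorem mul_apply_7 {R : Type*} [CommRing R] (x y : Oct R) : (x * y).c 7 =
    x.c 0 * y.c 7 + x.c 1 * y.c 6 + x.c 2 * y.c 5 + x.c 3 * y.c 4 - x.c 4 * y.c 3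
      - x.c 5 * y.c 2 - x.c 6 * y.c 1 + x.c 7 * y.c 0 := rfl

@[simp] theorem one_apply (R : Type*) [CommRing R] (k : Fin 8) :
    (1 : Oct R).c k = if k = 0 then 1 else 0 := rfl

@[simp] theorem e_apply (R : Type*) [CommRing R] (k j : Fin 8) :
    (e R k).c j = if j = k then 1 else 0 := rfl

@[simp] theorem add_apply {R : Type*} [CommRing R] (x y : Oct R) (k : Fin 8) :
    (x + y).c k = x.c k + y.c k := rfl

@[simp] theorem zero_apply {R : Type*} [CommRing R] (k : Fin 8) : (0 : Oct R).c k = 0 := rfl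

@[simp] theorem sub_apply {R : Type*} [CommRing R] (x y : Oct R) (k : Fin 8) :
    (x - y).c k = x.c k - y.c k := rfl

@[simp] theorem neg_apply {R : Type*} [CommRing R] (x : Oct R) (k : Fin 8) :
    (-x).c k = -x.c k := rfl

@[simp] theorem smul_apply {S R : Type*} [Semiring S] [CommRing R] [Module S R] (a : S) (x : Oct R)
    (k : Fin 8) : (a • x).c k = a • x.c k := rfl

instance (R : Type*) [CommRing R] : NonAssocRing (Oct R) where
  left_distrib x y z := by
    ext k : 2; fin_cases k <;> simp <;> ring
  right_distrib x y z := by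
    ext k : 2; fin_cases k <;> simp <;> ring
  zero_mul x := by ext k : 2; fin_cases k <;> simp
  mul_zero x := by ext k : 2; fin_cases k <;> simp
  one_mul x := by ext k : 2; fin_cases k <;> simp
  mul_one x := by ext k : 2; fin_cases k <;> simp

/-- `star` is the octonion conjugation `x ↦ x₀ - ∑_{k ≥ 1} x_k e_k`; it is `R`-linear. -/
instance (R : Type*) [CommRing R] : Star (Oct R) where
  star x := ⟨fun k => if k = 0 then x.c k else - x.c k⟩

@[simp] theorem star_apply {R : Type*} [CommRing R] (x : Oct R) (k : Fin 8) :
    (star x).c k = if k = 0 then x.c k else - x.c k := rfl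

instance (R : Type*) [CommRing R] : StarRing (Oct R) where
  star_involutive x := by ext k : 2; by_cases h : k = 0 <;> simp [h]
  star_mul x y := by
    ext k : 2; fin_cases k <;> simp <;> ring
  star_add x y := by
    ext k : 2; by_cases h : k = 0 <;> simp [h, add_comm]

/-- The multiplication table (over `ℤ`, which is enough as the formula is the same for every `R`). -/
theorem mul_table :
    (∀ t : Fin 8 × Fin 8 × Fin 8,
      t ∈ [((1 : Fin 8), (2 : Fin 8), (3 : Fin 8)), (3, 5, 6), (6, 7, 1), (1, 4, 5), (3, 4, 7),
        (6, 4, 2), (2, 5, 7)] → e ℤ t.1 * e ℤ t.2.1 = e ℤ t.2.2 ∧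
          e ℤ t.2.1 * e ℤ t.2.2 = e ℤ t.1 ∧ e ℤ t.2.2 * e ℤ t.1 = e ℤ t.2.1) ∧
    (∀ i : Fin 8, i ≠ 0 → e ℤ i * e ℤ i = -1) ∧
    (∀ i j : Fin 8, i ≠ 0 → j ≠ 0 → i ≠ j → e ℤ i * e ℤ j = -(e ℤ j * e ℤ i)) := by
  let : DecidableEq (Oct ℤ) := (c_injective ℤ).decidableEq
  refine ⟨?_, by decide, by decide⟩
  simp only [List.mem_cons, List.not_mem_nil, or_false]
  rintro _ (rfl | rfl | rfl | rfl | rfl | rfl | rfl) <;> decide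

/-- The inclusion `𝐎 ⊆ 𝐎^ℂ`. -/
def toC (x : Oct ℝ) : Oct ℂ := ⟨fun k => (x.c k : ℂ)⟩

/-- The complex conjugation `τ` of `𝐎^ℂ` with respect to `𝐎`. -/
def tau (x : Oct ℂ) : Oct ℂ := ⟨fun k => (starRingEnd ℂ) (x.c k)⟩

theorem tau_add (x y : Oct ℂ) : tau (x + y) = tau x + tau y := by
  ext k : 2; simp [tau]

theorem tau_mul (x y : Oct ℂ) : tau (x * y) = tau x * tau y := by
  ext k : 2; fin_cases k <;> simp [tau]

theorem tau_neg (x : Oct ℂ) : tau (-x) = -tau x := by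
  ext k : 2; simp [tau]

theorem tau_smul (c : ℂ) (x : Oct ℂ) : tau (c • x) = (starRingEnd ℂ) c • tau x := by
  ext k : 2; simp [tau]

theorem tau_one : tau 1 = 1 := by
  ext k : 2; by_cases h : k = 0 <;> simp [tau, h]

theorem tau_star (x : Oct ℂ) : tau (star x) = star (tau x) := by
  ext k : 2; by_cases h : k = 0 <;> simp [tau, h]

theorem tau_toC (x : Oct ℝ) : tau x.toC = x.toC := by
  ext k : 2; simp [tau, toC]

theorem star_smul (c : ℂ) (x : Oct ℂ) : star (c • x) = c • star x := by
  ext k : 2; by_cases h : k = 0 <;> simp [h]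

end Oct

/-! ### The Jordan algebra `J¹` -/

/-- `3 × 3` matrices over `𝐎^ℂ`; `Xᴴ` is the transpose of the octonion conjugate of `X`. -/
abbrev Mat := Matrix (Fin 3) (Fin 3) (Oct ℂ)

/-- The map `τσ` on matrices: `τ` is the complex conjugation, and `σ` changes the sign of the entries
`(1,2), (1,3), (2,1), (3,1)`. -/
def tauSigma (X : Mat) : Mat :=
  Matrix.of fun i j => if (i = 0 ↔ j = 0) then Oct.tau (X i j) else -Oct.tau (X i j)

theorem tauSigma_add (X Y : Mat) : tauSigma (X + Y) = tauSigma X + tauSigma Y := by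
  ext i j : 2
  by_cases h : (i = 0 ↔ j = 0) <;> simp [tauSigma, h, Oct.tau_add, add_comm]

theorem tauSigma_smul (a : ℝ) (X : Mat) : tauSigma (a • X) = a • tauSigma X := by
  ext i j k
  by_cases h : (i = 0 ↔ j = 0) <;> simp [tauSigma, h, Oct.tau]

theorem tauSigma_mul (X Y : Mat) : tauSigma (X * Y) = tauSigma X * tauSigma Y := by
  ext i j : 2
  fin_cases i <;> fin_cases j <;>
    simp [tauSigma, Matrix.mul_apply, Fin.sum_univ_three, Oct.tau_add, Oct.tau_mul] <;> abel_nf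

/-- The real exceptional Jordan algebra `J¹`: the real space of fixed points of `τσ` on the space
`J^ℂ` of hermitian matrices in `M(3, 𝐎^ℂ)`. -/
def J1 : Submodule ℝ Mat where
  carrier := {X | X.conjTranspose = X ∧ tauSigma X = X}
  zero_mem' := by
    refine ⟨by simp, ?_⟩
    ext i j k
    by_cases h : (i = 0 ↔ j = 0) <;> simp [tauSigma, h, Oct.tau]
  add_mem' := by
    rintro X Y ⟨h1, h2⟩ ⟨h3, h4⟩
    exact ⟨by rw [Matrix.conjTranspose_add, h1, h3], by rw [tauSigma_add, h2, h4]⟩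
  smul_mem' := by
    rintro a X ⟨h1, h2⟩
    refine ⟨?_, by rw [tauSigma_smul, h2]⟩
    ext i j k
    have h := congrFun (congrArg Oct.c (congrFun (congrFun h1 i) j)) k
    simp only [Matrix.conjTranspose_apply, Matrix.smul_apply, Oct.star_apply, Oct.smul_apply] at h ⊢
    rw [← h]
    split_ifs <;> simp

theorem jordan_mem {X Y : Mat} (hX : X ∈ J1) (hY : Y ∈ J1) :
    (2⁻¹ : ℝ) • (X * Y + Y * X) ∈ J1 := by
  refine J1.smul_mem _ ⟨?_, ?_⟩
  · rw [Matrix.conjTranspose_add, Matrix.conjTranspose_mul, Matrix.conjTranspose_mul, hX.1, hY.1,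
      add_comm]
  · rw [tauSigma_add, tauSigma_mul, tauSigma_mul, hX.2, hY.2]

/-- The Jordan product `X ∘ Y = 2⁻¹ (XY + YX)`. -/
def jordan (X Y : J1) : J1 := ⟨(2⁻¹ : ℝ) • ((X : Mat) * Y + (Y : Mat) * X), jordan_mem X.2 Y.2⟩

/-- The underlying matrix of `h¹(ξ; x)`. -/
def h1Mat (ξ₁ ξ₂ ξ₃ : ℝ) (x₁ x₂ x₃ : Oct ℝ) : Mat :=
  !![(ξ₁ : ℂ) • 1, Complex.I • x₃.toC, Complex.I • star x₂.toC;
     Complex.I • star x₃.toC, (ξ₂ : ℂ) • 1, x₁.toC;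
     Complex.I • x₂.toC, star x₁.toC, (ξ₃ : ℂ) • 1]

theorem h1Mat_mem (ξ₁ ξ₂ ξ₃ : ℝ) (x₁ x₂ x₃ : Oct ℝ) : h1Mat ξ₁ ξ₂ ξ₃ x₁ x₂ x₃ ∈ J1 := by
  constructor
  · ext i j : 2
    rw [Matrix.conjTranspose_apply]
    fin_cases i <;> fin_cases j <;> simp [h1Mat, Oct.star_smul, -Complex.coe_smul]
  · ext i j : 2
    rw [tauSigma, Matrix.of_apply]
    fin_cases i <;> fin_cases j <;>
      simp [h1Mat, Oct.tau_smul, Oct.tau_one, Oct.tau_star, Oct.tau_toC, -Complex.coe_smul]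

/-- The element `h¹(ξ₁, ξ₂, ξ₃; x₁, x₂, x₃)` of `J¹`. -/
def h1 (ξ₁ ξ₂ ξ₃ : ℝ) (x₁ x₂ x₃ : Oct ℝ) : J1 := ⟨h1Mat ξ₁ ξ₂ ξ₃ x₁ x₂ x₃, h1Mat_mem _ _ _ _ _ _⟩

/-- `diag(a, b, c)`. -/
def diag (a b c : ℝ) : J1 := h1 a b c 0 0 0

/-- The identity element `E`. -/
def unitE : J1 := diag 1 1 1

def E₁ : J1 := diag 1 0 0

/-- `F₃¹(x)`. -/
def F₃ (x : Oct ℝ) : J1 := h1 0 0 0 0 0 x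

/-- `P⁺`. -/
def Pplus : J1 := h1 1 (-1) 0 0 0 1

/-- `P⁻`. -/
def Pminus : J1 := h1 (-1) 1 0 0 0 1

/-- `Q⁺(x)`. -/
def Qplus (x : Oct ℝ) : J1 := h1 0 0 0 x (star x) 0

/-- The trace; the diagonal entries of an element of `J¹` are real multiples of the unit of `𝐎`. -/
def tr (X : J1) : ℝ := ∑ i : Fin 3, (((X : Mat) i i).c 0).re

/-- The inner product `(X|Y) = tr(X ∘ Y)`. -/
def ip (X Y : J1) : ℝ := tr (jordan X Y)

/-- The cross product of Freudenthal. -/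
def cross (X Y : J1) : J1 :=
  (2⁻¹ : ℝ) • ((2 : ℝ) • jordan X Y - tr X • Y - tr Y • X + (tr X * tr Y - ip X Y) • unitE)

/-- The determinant `3⁻¹ (X|X × X)`. -/
def det (X : J1) : ℝ := 3⁻¹ * ip X (cross X X)

/-! ### Characteristic roots -/

/-- The characteristic polynomial, that is, the real polynomial with `Φ_X(t) = det(tE - X)`
(see `eval_charPoly`). -/
def charPoly (X : J1) : Polynomial ℝ :=
  Polynomial.X ^ 3 - Polynomial.C (tr X) * Polynomial.X ^ 2
    + Polynomial.C (tr (cross X X)) * Polynomial.X - Polynomial.C (det X)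

theorem tr_add (X Y : J1) : tr (X + Y) = tr X + tr Y := by
  simp [tr, Finset.sum_add_distrib]

theorem tr_smul (a : ℝ) (X : J1) : tr (a • X) = a * tr X := by
  simp [tr, Finset.mul_sum]

theorem tr_neg (X : J1) : tr (-X) = -tr X := by
  simp [tr]

theorem tr_unitE : tr unitE = 3 := by
  simp [tr, unitE, diag, h1, h1Mat, Fin.sum_univ_three]; norm_num

theorem smul_mul_mat (a : ℝ) (X Y : Mat) : (a • X) * Y = a • (X * Y) := by
  have h : ∀ x y : Oct ℂ, (a • x) * y = a • (x * y) := by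
    intro x y
    ext k; fin_cases k <;> simp <;> ring
  ext i j : 2
  simp [Matrix.mul_apply, h, Finset.smul_sum]

theorem jordan_comm (X Y : J1) : jordan X Y = jordan Y X := by
  apply Subtype.ext; simp [jordan, add_comm]

theorem jordan_add_left (X Y Z : J1) : jordan (X + Y) Z = jordan X Z + jordan Y Z := by
  apply Subtype.ext
  simp only [jordan, Submodule.coe_add, add_mul, mul_add, ← smul_add]
  congr 1; abel

theorem jordan_smul_left (a : ℝ) (X Z : J1) : jordan (a • X) Z = a • jordan X Z := by
  have h : ∀ X Y : Mat, X * (a • Y) = a • (X * Y) := by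
    have h : ∀ x y : Oct ℂ, x * (a • y) = a • (x * y) := by
      intro x y
      ext k; fin_cases k <;> simp <;> ring
    intro X Y
    ext i j : 2
    simp [Matrix.mul_apply, h, Finset.smul_sum]
  apply Subtype.ext
  simp only [jordan, Submodule.coe_smul, smul_mul_mat, h, ← smul_add]
  rw [smul_comm]

theorem coe_unitE : (unitE : Mat) = 1 := by
  ext i j k
  fin_cases i <;> fin_cases j <;>
    simp [unitE, diag, h1, h1Mat, Oct.toC, Oct.star_apply]

theorem jordan_unitE (X : J1) : jordan X unitE = X := by
  apply Subtype.ext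
  simp only [jordan, coe_unitE, mul_one, one_mul]
  rw [← two_smul ℝ, smul_smul]
  norm_num

theorem eval_charPoly (X : J1) (t : ℝ) : (charPoly X).eval t = det (t • unitE - X) := by
  have hadd : ∀ X Y Z : J1, jordan X (Y + Z) = jordan X Y + jordan X Z := fun X Y Z => by
    rw [jordan_comm, jordan_add_left, jordan_comm Y, jordan_comm Z]
  have hsmul : ∀ (a : ℝ) (X Y : J1), jordan X (a • Y) = a • jordan X Y := fun a X Y => by
    rw [jordan_comm, jordan_smul_left, jordan_comm Y]
  have hone : ∀ X : J1, jordan unitE X = X := fun X => by rw [jordan_comm, jordan_unitE]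
  have hsub : ∀ X Y : J1, X - Y = X + (-1 : ℝ) • Y := fun X Y => by module
  simp only [charPoly, det, cross, ip, hsub, jordan_add_left, jordan_smul_left, hadd, hsmul,
    jordan_unitE, hone, tr_add, tr_smul, tr_unitE, jordan_comm _ X, Polynomial.eval_add,
    Polynomial.eval_sub, Polynomial.eval_mul, Polynomial.eval_pow, Polynomial.eval_X,
    Polynomial.eval_C]
  ring

/-- The characteristic roots in `ℂ`, with multiplicities. -/
def charRoots (X : J1) : Multiset ℂ := (charPoly X).aroots ℂ

/-! ### The group `F₄₍₋₂₀₎` and its orbits -/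

/-- The group `F₄₍₋₂₀₎` of automorphisms of the Jordan algebra `J¹`. -/
def F4 : Subgroup (J1 ≃ₗ[ℝ] J1) where
  carrier := {g | ∀ X Y, g (jordan X Y) = jordan (g X) (g Y)}
  one_mem' := fun _ _ => rfl
  mul_mem' := by
    intro g g' hg hg' X Y
    change g (g' _) = jordan (g (g' X)) (g (g' Y))
    rw [hg', hg]
  inv_mem' := by
    intro g hg X Y
    apply g.injective
    rw [hg]
    change g (g.symm _) = jordan (g (g.symm X)) (g (g.symm Y))
    simp

/-- The orbit of `X` under `F₄₍₋₂₀₎`. -/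
def orb (X : J1) : Set J1 := MulAction.orbit F4 X

/-- The minimal subspace `V_X`. -/
def minSpace (X : J1) : Set J1 :=
  {Y | ∃ a b c : ℝ, Y = a • cross X X + b • X + c • unitE}

/-- The traceless component `p(X)`. -/
def tracelessPart (X : J1) : J1 := X - (3⁻¹ * tr X) • unitE

/-- The element `E_{X,l}`; it is used where `tr((lE - X)^{×2}) ≠ 0`. -/
def EX (X : J1) (l : ℝ) : J1 :=
  (tr (cross (l • unitE - X) (l • unitE - X)))⁻¹ • cross (l • unitE - X) (l • unitE - X)

/-- The element `W_{X,l}`. -/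
def WX (X : J1) (l : ℝ) : J1 :=
  X - (l • EX X l + (2⁻¹ * (tr X - l)) • (unitE - EX X l))

/-- The hyperbolic plane `H(𝐎)`. -/
def hypPlane : Set J1 := {X | cross X X = 0 ∧ tr X = 1 ∧ 1 ≤ ip X E₁}

/-- The hyperbolic plane `H'(𝐎)`. -/
def hypPlane' : Set J1 := {X | cross X X = 0 ∧ tr X = 1 ∧ ip X E₁ ≤ 0}

/-- The null cone `N₁⁺(𝐎)`. -/
def nullCone₁plus : Set J1 := {X | cross X X = 0 ∧ tr X = 0 ∧ 0 < ip X E₁}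

/-- The null cone `N₁⁻(𝐎)`. -/
def nullCone₁minus : Set J1 := {X | cross X X = 0 ∧ tr X = 0 ∧ ip X E₁ < 0}

/-- The null cone `N₂(𝐎)`. -/
def nullCone₂ : Set J1 :=
  {X | tr X = 0 ∧ tr (cross X X) = 0 ∧ det X = 0 ∧ cross X X ≠ 0}

/-- The twelve families of canonical forms, with their parameters. -/
inductive CanonicalForm : Type
  | c1 (l₁ l₂ l₃ : ℝ) (h₁₂ : l₁ > l₂) (h₂₃ : l₂ > l₃)
  | c2 (l₁ l₂ l₃ : ℝ) (h₁₂ : l₁ > l₂) (h₂₃ : l₂ > l₃)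
  | c3 (l₁ l₂ l₃ : ℝ) (h₁₂ : l₁ > l₂) (h₂₃ : l₂ > l₃)
  | c4 (l₁ p q : ℝ) (hq : q > 0)
  | c5 (l₁ l₂ : ℝ) (h : l₁ ≠ l₂)
  | c6 (l₁ l₂ : ℝ) (h : l₁ ≠ l₂)
  | c7 (l₁ l₂ : ℝ) (h : l₁ ≠ l₂)
  | c8 (l₁ l₂ : ℝ) (h : l₁ ≠ l₂)
  | c9 (r : ℝ)
  | c10 (r : ℝ)
  | c11 (r : ℝ)
  | c12 (r : ℝ)

/-- The element of `J¹` given by a canonical form. -/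
def CanonicalForm.elt : CanonicalForm → J1
  | c1 l₁ l₂ l₃ _ _ => diag l₁ l₂ l₃
  | c2 l₁ l₂ l₃ _ _ => diag l₂ l₃ l₁
  | c3 l₁ l₂ l₃ _ _ => diag l₃ l₁ l₂
  | c4 l₁ p q _ => diag p p l₁ + F₃ (q • 1)
  | c5 l₁ l₂ _ => diag l₁ l₂ l₂
  | c6 l₁ l₂ _ => diag l₂ l₂ l₁
  | c7 l₁ l₂ _ => diag l₂ l₂ l₁ + Pplus
  | c8 l₁ l₂ _ => diag l₂ l₂ l₁ + Pminus
  | c9 r => r • unitE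
  | c10 r => r • unitE + Pplus
  | c11 r => r • unitE + Pminus
  | c12 r => r • unitE + Qplus 1

end ExcJordan

end

open ExcJordan

/-!
# Orbits of `F₄₍₋₂₀₎` on the exceptional Jordan algebra `J¹`

An element `X` of `J¹` is put into canonical form by elementary automorphisms: the triality
triples that come from the Moufang identity (`isTriality_mul`), which make a single off-diagonal
octonion real, and the maps `X ↦ A X Aᵀ` with `A` in a copy of `O(1, 2)` inside `O(3, ℂ)`
(`orthAut`); the entries of `A` are central, so that these maps act on octonionic matrices as on
real ones.
Rotations of the last two coordinates fix `E₁` and remove `x₁`; hyperbolic rotations of the first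
two coordinates bring the block `h¹(p + d, p - d, l; 0, 0, t)` to one of the normal forms that are
distinguished by the sign of `t² - d²`.

Every automorphism preserves the trace, since the trace is the only associative linear form with
value `3` at `E` (`eq_tr_of_assoc`). Hence it also preserves `(X|Y)`, `X × Y`, `det`, the
characteristic roots, `E_{X,l}`, `W_{X,l}` and `V_X`. This equivariance also reduces the adjoint
identities `(X × X) × (X × X) = det(X) X` and `X ∘ (X × X) = det(X) E` to the case of
`x₁ = 0` and real `x₃`.

By these identities `E_{X,l}` is, for a simple root `l`, a primitive idempotent with
`X ∘ E_{X,l} = l E_{X,l}`. A primitive idempotent lies in `H(𝐎)` or in `H'(𝐎)`; it is conjugate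
to `E₁` in the first case and to `E₃` in the second. The two cases are not conjugate, because no
primitive idempotent `F` satisfies `0 < (F|E₁) < 1`, while `0 < (F|E₃) < 1` does occur
(`not_sameOrbit_idempotents`). So `H(𝐎)` and `H'(𝐎)` are invariant, and so are the cones `N₁⁺(𝐎)`
and `N₁⁻(𝐎)`, as `(X|F) ≥ 0` for `X ∈ N₁⁺(𝐎)` and `F ∈ H(𝐎)`. Moving `E_{X,l}` to `E₁` or `E₃`
makes `X` block diagonal, which settles all cases with a simple root. For a triple root,
`p(X) = Y` is nilpotent: either `Y × Y = 0`, and `Y` is zero or conjugate to `P⁺` or `P⁻`, or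
`Y × Y` is a null vector that annihilates `Y`; moving it to `P⁻` (it cannot be in the orbit of
`P⁺`) gives `Y = s P⁻ + Q⁺(x)` with a unit octonion `x`, and a triality triple and a null rotation
bring this to `Q⁺(1)`.
-/

noncomputable section

namespace ExcJordan

/-! ### Coordinates on `J¹` -/

namespace Oct

/-- The euclidean inner product of octonions. -/
def dot (x y : Oct ℝ) : ℝ := ∑ k, x.c k * y.c k

theorem dot_comm (x y : Oct ℝ) : dot x y = dot y x := by simp [dot, mul_comm]

@[simp] theorem dot_zero_left (y : Oct ℝ) : dot 0 y = 0 := by simp [dot]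

@[simp] theorem dot_zero_right (y : Oct ℝ) : dot y 0 = 0 := by simp [dot]

theorem dot_smul_left (a : ℝ) (x y : Oct ℝ) : dot (a • x) y = a * dot x y := by
  simp [dot, Finset.mul_sum, mul_assoc]

theorem dot_smul_right (a : ℝ) (x y : Oct ℝ) : dot x (a • y) = a * dot x y := by
  rw [dot_comm, dot_smul_left, dot_comm]

theorem dot_self_nonneg (x : Oct ℝ) : 0 ≤ dot x x :=
  Finset.sum_nonneg fun _ _ => mul_self_nonneg _

theorem dot_self_eq_zero {x : Oct ℝ} : dot x x = 0 ↔ x = 0 := by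
  rw [dot, Finset.sum_eq_zero_iff_of_nonneg fun _ _ => mul_self_nonneg _]
  constructor
  · intro h
    ext k : 2
    simpa using h k (Finset.mem_univ _)
  · rintro rfl
    simp

@[simp] theorem dot_one_one : dot 1 1 = 1 := by simp [dot]

theorem dot_star_star (x y : Oct ℝ) : dot (star x) (star y) = dot x y := by
  simp [dot, Fin.sum_univ_eight]

theorem sq_le_dot_self (x : Oct ℝ) : x.c 0 ^ 2 ≤ dot x x := by
  rw [sq]
  exact Finset.single_le_sum (f := fun k => x.c k * x.c k) (fun _ _ => mul_self_nonneg _)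
    (Finset.mem_univ 0)

end Oct

open Oct

/-- The diagonal coordinates `ξ₁, ξ₂, ξ₃` (with indices starting from `0`). -/
def dg (i : Fin 3) (X : J1) : ℝ := (((X : Mat) i i).c 0).re

/-- The octonionic coordinate `x₁`. -/
def off₁ (X : J1) : Oct ℝ := ⟨fun k => (((X : Mat) 1 2).c k).re⟩

/-- The octonionic coordinate `x₂`. -/
def off₂ (X : J1) : Oct ℝ := ⟨fun k => (((X : Mat) 2 0).c k).im⟩

/-- The octonionic coordinate `x₃`. -/
def off₃ (X : J1) : Oct ℝ := ⟨fun k => (((X : Mat) 0 1).c k).im⟩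

theorem h1_coords (X : J1) :
    h1 (dg 0 X) (dg 1 X) (dg 2 X) (off₁ X) (off₂ X) (off₃ X) = X := by
  obtain ⟨X, hX, hT⟩ := X
  have hs : ∀ i j k, (X i j).c k = (star (X j i)).c k := fun i j k => by
    conv_lhs => rw [← hX]
    rfl
  have ht : ∀ i j k, (X i j).c k =
      if (i = 0 ↔ j = 0) then (starRingEnd ℂ) ((X i j).c k)
        else -(starRingEnd ℂ) ((X i j).c k) := by
    intro i j k
    conv_lhs => rw [← hT]
    simp only [tauSigma, Matrix.of_apply]
    split_ifs <;> rfl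
  have hd : ∀ i k, k ≠ 0 → (X i i).c k = 0 := fun i k hk => by
    have := hs i i k
    rw [star_apply, if_neg hk] at this
    exact self_eq_neg.mp this
  have hre : ∀ i j k, (i = 0 ↔ j = 0) → ((X i j).c k).im = 0 := fun i j k h => by
    have := ht i j k
    rw [if_pos h] at this
    exact Complex.conj_eq_iff_im.mp this.symm
  have him : ∀ i j k, ¬ (i = 0 ↔ j = 0) → ((X i j).c k).re = 0 := fun i j k h => by
    have := ht i j k
    rw [if_neg h] at this
    have := congrArg Complex.re this
    simp at this
    linarith
  apply Subtype.ext
  ext i j k : 3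
  have e1 : ∀ i, (X i i).c k = (((X i i).c 0).re : ℂ) * if k = 0 then 1 else 0 := by
    intro i
    by_cases hk : k = 0
    · subst hk
      apply Complex.ext <;> simp [hre i i 0 Iff.rfl]
    · simp [hk, hd i k hk]
  have e2 : ∀ i j k, (i = 0 ↔ j = 0) → (X i j).c k = (((X i j).c k).re : ℂ) := by
    intro i j k h
    apply Complex.ext <;> simp [hre i j k h]
  have e3 : ∀ i j k, ¬ (i = 0 ↔ j = 0) → (X i j).c k = Complex.I * (((X i j).c k).im : ℂ) := by
    intro i j k h
    apply Complex.ext <;> simp [him i j k h]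
  fin_cases i <;> fin_cases j
  · simpa [h1, h1Mat, dg] using (e1 0).symm
  · simpa [h1, h1Mat, off₃, toC] using (e3 0 1 k (by simp)).symm
  · have := e3 2 0 k (by simp)
    have h2 := hs 0 2 k
    rw [star_apply, this] at h2
    simp only [h1, h1Mat, off₂, toC]
    simp [h2]
  · have := e3 0 1 k (by simp)
    have h2 := hs 1 0 k
    rw [star_apply, this] at h2
    simp only [h1, h1Mat, off₃, toC]
    simp [h2]
  · simpa [h1, h1Mat, dg] using (e1 1).symm
  · simpa [h1, h1Mat, off₁, toC] using (e2 1 2 k (by simp)).symm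
  · simpa [h1, h1Mat, off₂, toC] using (e3 2 0 k (by simp)).symm
  · have := e2 1 2 k (by simp)
    have h2 := hs 2 1 k
    rw [star_apply, this] at h2
    simp only [h1, h1Mat, off₁, toC]
    simp [h2]
  · simpa [h1, h1Mat, dg] using (e1 2).symm

section Apply

variable (a b c : ℝ) (x y z : Oct ℝ)

@[simp] theorem dg_h1_zero : dg 0 (h1 a b c x y z) = a := by simp [dg, h1, h1Mat]

@[simp] theorem dg_h1_one : dg 1 (h1 a b c x y z) = b := by simp [dg, h1, h1Mat]

@[simp] theorem dg_h1_two : dg 2 (h1 a b c x y z) = c := by simp [dg, h1, h1Mat]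

@[simp] theorem off₁_h1 : off₁ (h1 a b c x y z) = x := by
  ext k : 2; simp [off₁, h1, h1Mat, toC]

@[simp] theorem off₂_h1 : off₂ (h1 a b c x y z) = y := by
  ext k : 2; simp [off₂, h1, h1Mat, toC]

@[simp] theorem off₃_h1 : off₃ (h1 a b c x y z) = z := by
  ext k : 2; simp [off₃, h1, h1Mat, toC]

end Apply

theorem J1_ext {X Y : J1} (h0 : dg 0 X = dg 0 Y) (h1 : dg 1 X = dg 1 Y) (h2 : dg 2 X = dg 2 Y)
    (o1 : off₁ X = off₁ Y) (o2 : off₂ X = off₂ Y) (o3 : off₃ X = off₃ Y) : X = Y := by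
  rw [← h1_coords X, ← h1_coords Y, h0, h1, h2, o1, o2, o3]

@[simp] theorem dg_add (i : Fin 3) (X Y : J1) : dg i (X + Y) = dg i X + dg i Y := by simp [dg]

@[simp] theorem dg_smul (i : Fin 3) (a : ℝ) (X : J1) : dg i (a • X) = a * dg i X := by simp [dg]

@[simp] theorem off₁_add (X Y : J1) : off₁ (X + Y) = off₁ X + off₁ Y := by
  ext k : 2; simp [off₁]

@[simp] theorem off₁_smul (a : ℝ) (X : J1) : off₁ (a • X) = a • off₁ X := by
  ext k : 2; simp [off₁]

@[simp] theorem off₂_add (X Y : J1) : off₂ (X + Y) = off₂ X + off₂ Y := by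
  ext k : 2; simp [off₂]

@[simp] theorem off₂_smul (a : ℝ) (X : J1) : off₂ (a • X) = a • off₂ X := by
  ext k : 2; simp [off₂]

@[simp] theorem off₃_add (X Y : J1) : off₃ (X + Y) = off₃ X + off₃ Y := by
  ext k : 2; simp [off₃]

@[simp] theorem off₃_smul (a : ℝ) (X : J1) : off₃ (a • X) = a • off₃ X := by
  ext k : 2; simp [off₃]

theorem h1_add (a b c a' b' c' : ℝ) (x y z x' y' z' : Oct ℝ) :
    h1 a b c x y z + h1 a' b' c' x' y' z' =
      h1 (a + a') (b + b') (c + c') (x + x') (y + y') (z + z') := by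
  apply J1_ext <;> simp

theorem smul_h1 (r a b c : ℝ) (x y z : Oct ℝ) :
    r • h1 a b c x y z = h1 (r * a) (r * b) (r * c) (r • x) (r • y) (r • z) := by
  apply J1_ext <;> simp

theorem h1_inj {a b c a' b' c' : ℝ} {x y z x' y' z' : Oct ℝ} :
    h1 a b c x y z = h1 a' b' c' x' y' z' ↔
      a = a' ∧ b = b' ∧ c = c' ∧ x = x' ∧ y = y' ∧ z = z' := by
  constructor
  · intro h
    exact ⟨by simpa using congrArg (dg 0) h, by simpa using congrArg (dg 1) h,
      by simpa using congrArg (dg 2) h, by simpa using congrArg off₁ h,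
      by simpa using congrArg off₂ h, by simpa using congrArg off₃ h⟩
  · rintro ⟨rfl, rfl, rfl, rfl, rfl, rfl⟩
    rfl

theorem zero_eq_h1 : (0 : J1) = h1 0 0 0 0 0 0 := by
  rw [← zero_smul ℝ (h1 0 0 0 0 0 0), smul_h1]; simp

theorem unitE_eq_h1 : unitE = h1 1 1 1 0 0 0 := rfl

theorem toC_mul (x y : Oct ℝ) : (x * y).toC = x.toC * y.toC := by
  ext k : 2; fin_cases k <;> simp [toC]

theorem toC_star (x : Oct ℝ) : (star x).toC = star x.toC := by
  ext k : 2; by_cases h : k = 0 <;> simp [toC, h]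

theorem smul_mul_oct {R : Type*} [CommRing R] (a : R) (x y : Oct R) :
    (a • x) * y = a • (x * y) := by
  ext k : 2; fin_cases k <;> simp <;> ring

theorem mul_smul_oct {R : Type*} [CommRing R] (a : R) (x y : Oct R) :
    x * (a • y) = a • (x * y) := by
  ext k : 2; fin_cases k <;> simp <;> ring

theorem mul_star_c_zero (x y : Oct ℝ) : (x * star y).c 0 = dot x y := by
  simp [dot, Fin.sum_univ_eight]

theorem star_mul_c_zero (x y : Oct ℝ) : (star x * y).c 0 = dot x y := by
  simp [dot, Fin.sum_univ_eight]

theorem jordan_apply (X Y : J1) (i j : Fin 3) : (jordan X Y : Mat) i j =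
    (2⁻¹ : ℝ) • (((X : Mat) i 0 * (Y : Mat) 0 j + (X : Mat) i 1 * (Y : Mat) 1 j
        + (X : Mat) i 2 * (Y : Mat) 2 j)
      + ((Y : Mat) i 0 * (X : Mat) 0 j + (Y : Mat) i 1 * (X : Mat) 1 j
        + (Y : Mat) i 2 * (X : Mat) 2 j)) := by
  simp only [jordan, Matrix.smul_apply, Matrix.add_apply, Matrix.mul_apply, Fin.sum_univ_three]

theorem h1_apply (a b c : ℝ) (x y z : Oct ℝ) (i j : Fin 3) : (h1 a b c x y z : Mat) i j =
    ![![(a : ℂ) • 1, Complex.I • z.toC, Complex.I • (star y).toC],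
      ![Complex.I • (star z).toC, (b : ℂ) • 1, x.toC],
      ![Complex.I • y.toC, (star x).toC, (c : ℂ) • 1]] i j := by
  fin_cases i <;> fin_cases j <;> simp [h1, h1Mat, toC_star]

theorem toC_apply (x : Oct ℝ) (k : Fin 8) : x.toC.c k = (x.c k : ℂ) := rfl

theorem jordan_h1 (a b c a' b' c' : ℝ) (x y z x' y' z' : Oct ℝ) :
    jordan (h1 a b c x y z) (h1 a' b' c' x' y' z') =
      h1 (a * a' - dot y y' - dot z z') (b * b' + dot x x' - dot z z')
        (c * c' + dot x x' - dot y y')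
        ((2⁻¹ : ℝ) • ((b + c) • x' + (b' + c') • x - star (y * z' + y' * z)))
        ((2⁻¹ : ℝ) • ((c + a) • y' + (c' + a') • y + star (z * x' + z' * x)))
        ((2⁻¹ : ℝ) • ((a + b) • z' + (a' + b') • z + star (x * y' + x' * y))) := by
  apply J1_ext
  all_goals
    simp only [dg_h1_zero, dg_h1_one, dg_h1_two, off₁_h1, off₂_h1, off₃_h1]
  iterate 3
    simp only [dg, jordan_apply, h1_apply, Matrix.cons_val_zero, Matrix.cons_val_one,
      Matrix.cons_val, smul_mul_oct, mul_smul_oct, mul_one, smul_smul, ← toC_mul,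
      Oct.smul_apply, Oct.add_apply, toC_apply, mul_star_c_zero, star_mul_c_zero, Oct.one_apply,
      Complex.I_mul_I]
    simp [dot_comm]
    ring
  iterate 3
    ext k : 2
    simp only [off₁, off₂, off₃, jordan_apply, h1_apply, Matrix.cons_val_zero, Matrix.cons_val_one,
      Matrix.cons_val, smul_mul_oct, mul_smul_oct, one_mul, mul_one, smul_smul, ← toC_mul,
      Oct.smul_apply, Oct.add_apply, toC_apply, Complex.I_mul_I, star_add, star_mul]
    simp [-star_apply]
    ring

theorem tr_eq (X : J1) : tr X = dg 0 X + dg 1 X + dg 2 X := by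
  simp [tr, dg, Fin.sum_univ_three]

@[simp] theorem tr_h1 (a b c : ℝ) (x y z : Oct ℝ) : tr (h1 a b c x y z) = a + b + c := by
  simp [tr_eq]

theorem ip_h1 (a b c a' b' c' : ℝ) (x y z x' y' z' : Oct ℝ) :
    ip (h1 a b c x y z) (h1 a' b' c' x' y' z') =
      a * a' + b * b' + c * c' + 2 * dot x x' - 2 * dot y y' - 2 * dot z z' := by
  rw [ip, jordan_h1, tr_h1]; ring

@[simp] theorem ip_E₁ (X : J1) : ip X E₁ = dg 0 X := by
  conv_lhs => rw [← h1_coords X, E₁, diag, ip_h1]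
  simp

theorem cross_h1 (a b c : ℝ) (x y z : Oct ℝ) :
    cross (h1 a b c x y z) (h1 a b c x y z) =
      h1 (b * c - dot x x) (c * a + dot y y) (a * b + dot z z)
        (-star (y * z) - a • x) (star (z * x) - b • y) (star (x * y) - c • z) := by
  apply J1_ext
  · simp [cross, jordan_h1, ip_h1, unitE_eq_h1, sub_eq_add_neg, ← neg_smul]; ring
  · simp [cross, jordan_h1, ip_h1, unitE_eq_h1, sub_eq_add_neg, ← neg_smul]; ring
  · simp [cross, jordan_h1, ip_h1, unitE_eq_h1, sub_eq_add_neg, ← neg_smul]; ring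
  · simp [cross, jordan_h1, ip_h1, unitE_eq_h1, sub_eq_add_neg, ← neg_smul]; module
  · simp [cross, jordan_h1, ip_h1, unitE_eq_h1, sub_eq_add_neg, ← neg_smul]; module
  · simp [cross, jordan_h1, ip_h1, unitE_eq_h1, sub_eq_add_neg, ← neg_smul]; module

/-! ### The norm of the octonions and the Moufang identity -/

namespace Oct

theorem dot_add_left (x y z : Oct ℝ) : dot (x + y) z = dot x z + dot y z := by
  simp [dot, add_mul, Finset.sum_add_distrib]

theorem dot_add_right (x y z : Oct ℝ) : dot x (y + z) = dot x y + dot x z := by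
  simp [dot, mul_add, Finset.sum_add_distrib]

theorem dot_sub_left (x y z : Oct ℝ) : dot (x - y) z = dot x z - dot y z := by
  simp [dot, sub_mul, Finset.sum_sub_distrib]

theorem dot_sub_right (x y z : Oct ℝ) : dot x (y - z) = dot x y - dot x z := by
  simp [dot, mul_sub, Finset.sum_sub_distrib]

theorem eq_of_dot_eq {x y : Oct ℝ} (h : ∀ z, dot x z = dot y z) : x = y := by
  rw [← sub_eq_zero, ← dot_self_eq_zero, dot_sub_left, h, sub_self]

theorem dot_star_mul_rotate (x y z : Oct ℝ) : dot (star (x * y)) z = dot (star (y * z)) x := by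
  simp [dot, Fin.sum_univ_eight]; ring

theorem dot_mul_left (a x y : Oct ℝ) : dot (a * x) (a * y) = dot a a * dot x y := by
  simp [dot, Fin.sum_univ_eight]; ring

theorem dot_mul_right (a x y : Oct ℝ) : dot (x * a) (y * a) = dot a a * dot x y := by
  simp [dot, Fin.sum_univ_eight]; ring

theorem dot_mul_eq_left (a x y : Oct ℝ) : dot (a * x) y = dot x (star a * y) := by
  simp [dot, Fin.sum_univ_eight]; ring

theorem dot_mul_eq_right (a x y : Oct ℝ) : dot (x * a) y = dot x (y * star a) := by
  simp [dot, Fin.sum_univ_eight]; ring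

theorem dot_star_eq (x y : Oct ℝ) : dot (star x) y = dot x (star y) := by
  rw [← dot_star_star, star_star]

theorem star_mul_mul_cancel (a x : Oct ℝ) : star a * (a * x) = dot a a • x := by
  refine eq_of_dot_eq fun z => ?_
  rw [dot_smul_left, ← dot_mul_left a x z, dot_comm, ← dot_mul_eq_left, dot_comm]

theorem mul_mul_star_cancel (a x : Oct ℝ) : (x * a) * star a = dot a a • x := by
  refine eq_of_dot_eq fun z => ?_
  rw [dot_smul_left, ← dot_mul_right a x z, dot_comm, ← dot_mul_eq_right, dot_comm]

theorem mul_star_mul_cancel (a x : Oct ℝ) : a * (star a * x) = dot a a • x := by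
  simpa [dot_star_star] using star_mul_mul_cancel (star a) x

theorem mul_star_mul_cancel' (a x : Oct ℝ) : (x * star a) * a = dot a a • x := by
  simpa [dot_star_star] using mul_mul_star_cancel (star a) x

theorem mul_star_self (a : Oct ℝ) : a * star a = dot a a • 1 := by
  simpa using mul_mul_star_cancel a 1

theorem star_mul_self (a : Oct ℝ) : star a * a = dot a a • 1 := by
  simpa using star_mul_mul_cancel a 1

/-- Polarization of the multiplicativity of the norm. -/
theorem dot_mul_mul_add (a b x y : Oct ℝ) :
    dot (x * a) (y * b) + dot (x * b) (y * a) = 2 * dot x y * dot a b := by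
  have h := dot_mul_right (a + b) x y
  simp only [mul_add, dot_add_left, dot_add_right] at h
  linear_combination h - dot_mul_right a x y - dot_mul_right b x y + dot x y * dot_comm b a

/-- The Moufang identity `(ax)(ya) = (a(xy))a`. -/
theorem moufang (a x y : Oct ℝ) : (a * x) * (y * a) = (a * (x * y)) * a := by
  refine eq_of_dot_eq fun z => ?_
  have hl := dot_mul_mul_add a z y (star x * star a)
  have hr := dot_mul_mul_add (x * y) (star a) a z
  rw [mul_star_mul_cancel', dot_smul_right, dot_comm y, ← star_mul, dot_star_mul_rotate a x y] at hl
  rw [mul_star_self, dot_smul_left, dot_comm (x * y), dot_star_eq, dot_comm a (star _)] at hr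
  have h1 : dot (y * z) (star x) = dot 1 (z * (x * y)) := by
    rw [← dot_star_eq, ← dot_star_mul_rotate, dot_comm 1, dot_mul_eq_left, mul_one, ← dot_star_eq]
  rw [dot_mul_eq_left (a * x), dot_mul_eq_right a (a * (x * y))]
  linear_combination hl - hr - dot a a * h1

end Oct

/-- The form `(X|Y)` is associative. -/
theorem ip_jordan_assoc (X Y Z : J1) : ip (jordan X Y) Z = ip X (jordan Y Z) := by
  rw [← h1_coords X, ← h1_coords Y, ← h1_coords Z]
  generalize off₁ X = x₁, off₂ X = x₂, off₃ X = x₃, off₁ Y = y₁, off₂ Y = y₂, off₃ Y = y₃,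
    off₁ Z = z₁, off₂ Z = z₂, off₃ Z = z₃
  rw [jordan_h1, jordan_h1, ip_h1, ip_h1]
  simp only [dot_smul_left, dot_sub_left, dot_add_left, dot_smul_right, dot_sub_right,
    dot_add_right, star_add, dot_comm _ (star _)]
  linear_combination -dot_star_mul_rotate x₂ y₃ z₁ + dot_star_mul_rotate z₁ y₂ x₃ -
    dot_star_mul_rotate x₃ y₁ z₂ + dot_star_mul_rotate z₂ y₃ x₁ - dot_star_mul_rotate x₁ y₂ z₃ +
    dot_star_mul_rotate z₃ y₁ x₂

/-! ### Invariance of the trace -/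

theorem tr_jordan_assoc (X Y Z : J1) : tr (jordan (jordan X Y) Z) = tr (jordan X (jordan Y Z)) :=
  ip_jordan_assoc X Y Z

/-- An associative linear form on `J¹` (one that vanishes on all associators) is determined by its
value at the unit. -/
theorem eq_tr_of_assoc (f : J1 →ₗ[ℝ] ℝ)
    (hf : ∀ X Y Z, f (jordan (jordan X Y) Z) = f (jordan X (jordan Y Z))) (hE : f unitE = 3)
    (X : J1) : f X = tr X := by
  have key : ∀ Y Z, Y = Z → f Y = f Z := fun Y Z h => by rw [h]
  have z0 : ∀ Y, Y = 0 → f Y = 0 := fun Y h => by rw [h, map_zero]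
  -- off-diagonal elements are multiples of associators
  have f1 : ∀ x, f (h1 0 0 0 x 0 0) = 0 := fun x => by
    have h := hf (h1 0 1 0 0 0 0) (h1 0 0 1 0 0 0) (h1 0 0 0 x 0 0)
    rw [jordan_h1, jordan_h1, jordan_h1, jordan_h1] at h
    simp [smul_smul] at h
    rw [← zero_eq_h1, map_zero] at h
    have e : h1 0 0 0 x 0 0 = (4 : ℝ) • h1 0 0 0 ((2⁻¹ * 2⁻¹ : ℝ) • x) 0 0 := by
      rw [smul_h1, smul_smul]; norm_num
    rw [e, map_smul, ← h, smul_zero]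
  have f2 : ∀ x, f (h1 0 0 0 0 x 0) = 0 := fun x => by
    have h := hf (h1 1 0 0 0 0 0) (h1 0 0 1 0 0 0) (h1 0 0 0 0 x 0)
    rw [jordan_h1, jordan_h1, jordan_h1, jordan_h1] at h
    simp [smul_smul] at h
    rw [← zero_eq_h1, map_zero] at h
    have e : h1 0 0 0 0 x 0 = (4 : ℝ) • h1 0 0 0 0 ((2⁻¹ * 2⁻¹ : ℝ) • x) 0 := by
      rw [smul_h1, smul_smul]; norm_num
    rw [e, map_smul, ← h, smul_zero]
  have f3 : ∀ x, f (h1 0 0 0 0 0 x) = 0 := fun x => by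
    have h := hf (h1 1 0 0 0 0 0) (h1 0 1 0 0 0 0) (h1 0 0 0 0 0 x)
    rw [jordan_h1, jordan_h1, jordan_h1, jordan_h1] at h
    simp [smul_smul] at h
    rw [← zero_eq_h1, map_zero] at h
    have e : h1 0 0 0 0 0 x = (4 : ℝ) • h1 0 0 0 0 0 ((2⁻¹ * 2⁻¹ : ℝ) • x) := by
      rw [smul_h1, smul_smul]; norm_num
    rw [e, map_smul, ← h, smul_zero]
  -- so are the differences of the diagonal idempotents
  have g12 : f (h1 1 0 0 0 0 0) = f (h1 0 1 0 0 0 0) := by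
    have h := hf (h1 1 0 0 0 0 0) (h1 0 0 0 0 0 1) (h1 0 0 0 0 0 1)
    rw [jordan_h1, jordan_h1, jordan_h1, jordan_h1] at h
    simp [dot_smul_left] at h
    have e1 : h1 (-2⁻¹) (-2⁻¹) 0 0 0 0 =
        (-2⁻¹ : ℝ) • h1 1 0 0 0 0 0 + (-2⁻¹ : ℝ) • h1 0 1 0 0 0 0 := by
      simp [smul_h1, h1_add]
    have e2 : h1 (-1) 0 0 0 0 0 = (-1 : ℝ) • h1 1 0 0 0 0 0 := by simp [smul_h1]
    rw [e1, e2, map_add, map_smul, map_smul, map_smul, smul_eq_mul, smul_eq_mul, smul_eq_mul] at h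
    linarith
  have g23 : f (h1 0 1 0 0 0 0) = f (h1 0 0 1 0 0 0) := by
    have h := hf (h1 0 1 0 0 0 0) (h1 0 0 0 1 0 0) (h1 0 0 0 1 0 0)
    rw [jordan_h1, jordan_h1, jordan_h1, jordan_h1] at h
    simp [dot_smul_left] at h
    have e1 : h1 0 2⁻¹ 2⁻¹ 0 0 0 =
        (2⁻¹ : ℝ) • h1 0 1 0 0 0 0 + (2⁻¹ : ℝ) • h1 0 0 1 0 0 0 := by
      simp [smul_h1, h1_add]
    rw [e1, map_add, map_smul, map_smul, smul_eq_mul, smul_eq_mul] at h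
    linarith
  have hsum : ∀ (a b c : ℝ) (x y z : Oct ℝ), h1 a b c x y z = a • h1 1 0 0 0 0 0
      + b • h1 0 1 0 0 0 0 + c • h1 0 0 1 0 0 0 + h1 0 0 0 x 0 0 + h1 0 0 0 0 y 0
      + h1 0 0 0 0 0 z := by
    intro a b c x y z
    simp [smul_h1, h1_add]
  have hE' := hE
  rw [unitE_eq_h1, hsum] at hE'
  conv_lhs => rw [← h1_coords X, hsum]
  simp only [map_add, map_smul, f1, f2, f3, smul_eq_mul] at hE' ⊢
  have e3 : f (h1 0 0 1 0 0 0) = 1 := by linarith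
  rw [tr_eq, g12, g23, e3]
  ring

/-! ### Automorphisms and orbits -/

section Automorphisms

variable {g : J1 ≃ₗ[ℝ] J1}

theorem map_jordan (hg : g ∈ F4) (X Y : J1) : g (jordan X Y) = jordan (g X) (g Y) := hg X Y

theorem map_unitE (hg : g ∈ F4) : g unitE = unitE := by
  have h := map_jordan hg (g.symm unitE) unitE
  rwa [jordan_unitE, g.apply_symm_apply, jordan_comm, jordan_unitE, eq_comm] at h

/-- The automorphisms of the Jordan algebra preserve the trace. -/
theorem tr_map (hg : g ∈ F4) (X : J1) : tr (g X) = tr X := by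
  let f : J1 →ₗ[ℝ] ℝ :=
    { toFun := fun X => tr (g X)
      map_add' := fun X Y => by rw [map_add, tr_add]
      map_smul' := fun a X => by rw [map_smul, tr_smul]; rfl }
  refine eq_tr_of_assoc f (fun X Y Z => ?_) ?_ X
  · change tr (g _) = tr (g _)
    simp only [map_jordan hg, tr_jordan_assoc]
  · change tr (g _) = 3
    rw [map_unitE hg, tr_unitE]

theorem ip_map (hg : g ∈ F4) (X Y : J1) : ip (g X) (g Y) = ip X Y := by
  rw [ip, ← map_jordan hg, tr_map hg, ip]

theorem map_cross (hg : g ∈ F4) (X Y : J1) : g (cross X Y) = cross (g X) (g Y) := by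
  simp only [cross, map_smul, map_add, map_sub, map_jordan hg, tr_map hg, ip_map hg, map_unitE hg]

theorem det_map (hg : g ∈ F4) (X : J1) : det (g X) = det X := by
  rw [det, ← map_cross hg, ip_map hg, det]

theorem charPoly_map (hg : g ∈ F4) (X : J1) : charPoly (g X) = charPoly X := by
  rw [charPoly, ← map_cross hg, tr_map hg, tr_map hg, det_map hg, charPoly]

theorem charRoots_map (hg : g ∈ F4) (X : J1) : charRoots (g X) = charRoots X := by
  rw [charRoots, charPoly_map hg, charRoots]

theorem map_EX (hg : g ∈ F4) (X : J1) (l : ℝ) : g (EX X l) = EX (g X) l := by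
  have h : l • unitE - g X = g (l • unitE - X) := by rw [map_sub, map_smul, map_unitE hg]
  rw [EX, EX, h, ← map_cross hg, tr_map hg, map_smul]

theorem map_WX (hg : g ∈ F4) (X : J1) (l : ℝ) : g (WX X l) = WX (g X) l := by
  simp only [WX, map_sub, map_add, map_smul, map_EX hg, map_unitE hg, tr_map hg]

theorem map_tracelessPart (hg : g ∈ F4) (X : J1) :
    g (tracelessPart X) = tracelessPart (g X) := by
  rw [tracelessPart, tracelessPart, map_sub, map_smul, map_unitE hg, tr_map hg]

theorem map_mem_minSpace (hg : g ∈ F4) {X Y : J1} (h : Y ∈ minSpace X) :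
    g Y ∈ minSpace (g X) := by
  obtain ⟨a, b, c, rfl⟩ := h
  exact ⟨a, b, c, by simp only [map_add, map_smul, map_cross hg, map_unitE hg]⟩

end Automorphisms

/-- Two elements of `J¹` are conjugate if they lie in the same orbit of `F₄₍₋₂₀₎`. -/
def SameOrbit (X Y : J1) : Prop := ∃ g ∈ F4, g X = Y

namespace SameOrbit

theorem refl (X : J1) : SameOrbit X X := ⟨1, F4.one_mem, rfl⟩

theorem symm {X Y : J1} : SameOrbit X Y → SameOrbit Y X := by
  rintro ⟨g, hg, rfl⟩
  exact ⟨g⁻¹, F4.inv_mem hg, g.symm_apply_apply X⟩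

theorem trans {X Y Z : J1} : SameOrbit X Y → SameOrbit Y Z → SameOrbit X Z := by
  rintro ⟨g, hg, rfl⟩ ⟨g', hg', rfl⟩
  exact ⟨g' * g, F4.mul_mem hg' hg, rfl⟩

end SameOrbit

theorem mem_orb_iff {X Y : J1} : X ∈ orb Y ↔ SameOrbit X Y := by
  constructor
  · rintro ⟨g, rfl⟩
    exact SameOrbit.symm ⟨g, g.2, rfl⟩
  · intro h
    obtain ⟨g, hg, rfl⟩ := h.symm
    exact ⟨⟨g, hg⟩, rfl⟩

/-! ### Automorphisms from triality -/

/-- A triality triple: three isometries of `𝐎` that preserve the trilinear form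
`(x, y, z) ↦ Re ((xy)z)`. -/
structure IsTriality (T₁ T₂ T₃ : Oct ℝ ≃ₗ[ℝ] Oct ℝ) : Prop where
  dot₁ : ∀ x y, dot (T₁ x) (T₁ y) = dot x y
  dot₂ : ∀ x y, dot (T₂ x) (T₂ y) = dot x y
  dot₃ : ∀ x y, dot (T₃ x) (T₃ y) = dot x y
  trilinear : ∀ x y z, dot (star (T₁ x * T₂ y)) (T₃ z) = dot (star (x * y)) z

namespace IsTriality

variable {T₁ T₂ T₃ : Oct ℝ ≃ₗ[ℝ] Oct ℝ}

theorem rotate (h : IsTriality T₁ T₂ T₃) : IsTriality T₂ T₃ T₁ where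
  dot₁ := h.dot₂
  dot₂ := h.dot₃
  dot₃ := h.dot₁
  trilinear x y z := by
    rw [← dot_star_mul_rotate, h.trilinear, dot_star_mul_rotate]

theorem star_mul (h : IsTriality T₁ T₂ T₃) (x y : Oct ℝ) :
    star (T₁ x * T₂ y) = T₃ (star (x * y)) := by
  refine eq_of_dot_eq fun z => ?_
  obtain ⟨z, rfl⟩ := T₃.surjective z
  rw [h.trilinear, h.dot₃]

end IsTriality

/-- The linear map `h¹(ξ; x₁, x₂, x₃) ↦ h¹(ξ; T₁ x₁, T₂ x₂, T₃ x₃)`. -/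
def offMap (T₁ T₂ T₃ : Oct ℝ ≃ₗ[ℝ] Oct ℝ) : J1 ≃ₗ[ℝ] J1 where
  toFun X := h1 (dg 0 X) (dg 1 X) (dg 2 X) (T₁ (off₁ X)) (T₂ (off₂ X)) (T₃ (off₃ X))
  invFun X := h1 (dg 0 X) (dg 1 X) (dg 2 X) (T₁.symm (off₁ X)) (T₂.symm (off₂ X)) (T₃.symm (off₃ X))
  map_add' X Y := by simp [h1_add]
  map_smul' a X := by simp [smul_h1]
  left_inv X := by simp [h1_coords]
  right_inv X := by simp [h1_coords]

theorem offMap_h1 (T₁ T₂ T₃ : Oct ℝ ≃ₗ[ℝ] Oct ℝ) (a b c : ℝ) (x y z : Oct ℝ) :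
    offMap T₁ T₂ T₃ (h1 a b c x y z) = h1 a b c (T₁ x) (T₂ y) (T₃ z) := by
  simp [offMap]

theorem IsTriality.offMap_mem {T₁ T₂ T₃ : Oct ℝ ≃ₗ[ℝ] Oct ℝ} (h : IsTriality T₁ T₂ T₃) :
    offMap T₁ T₂ T₃ ∈ F4 := by
  intro X Y
  rw [← h1_coords X, ← h1_coords Y]
  simp only [jordan_h1, offMap_h1, map_smul, map_add, map_sub, star_add, ← h.star_mul,
    ← h.rotate.star_mul, ← h.rotate.rotate.star_mul, h.dot₁, h.dot₂, h.dot₃]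

namespace Oct

/-- Left multiplication by a unit octonion. -/
def lmul (a : Oct ℝ) (ha : dot a a = 1) : Oct ℝ ≃ₗ[ℝ] Oct ℝ where
  toFun x := a * x
  invFun x := star a * x
  map_add' := mul_add a
  map_smul' r x := mul_smul_oct r a x
  left_inv x := by simp [star_mul_mul_cancel, ha]
  right_inv x := by simp [mul_star_mul_cancel, ha]

/-- Right multiplication by a unit octonion. -/
def rmul (a : Oct ℝ) (ha : dot a a = 1) : Oct ℝ ≃ₗ[ℝ] Oct ℝ where
  toFun x := x * a
  invFun x := x * star a
  map_add' x y := add_mul x y a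
  map_smul' r x := smul_mul_oct r x a
  left_inv x := by simp [mul_mul_star_cancel, ha]
  right_inv x := by simp [mul_star_mul_cancel', ha]

theorem dot_star_unit {a : Oct ℝ} (ha : dot a a = 1) : dot (star a) (star a) = 1 := by
  rw [dot_star_star, ha]

/-- The map `x ↦ (ā x) ā` for a unit octonion `a`. -/
def bmul (a : Oct ℝ) (ha : dot a a = 1) : Oct ℝ ≃ₗ[ℝ] Oct ℝ :=
  (lmul (star a) (dot_star_unit ha)).trans (rmul (star a) (dot_star_unit ha))

theorem lmul_apply (a : Oct ℝ) (ha : dot a a = 1) (x : Oct ℝ) : lmul a ha x = a * x := rfl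

theorem rmul_apply (a : Oct ℝ) (ha : dot a a = 1) (x : Oct ℝ) : rmul a ha x = x * a := rfl

theorem bmul_apply (a : Oct ℝ) (ha : dot a a = 1) (x : Oct ℝ) :
    bmul a ha x = (star a * x) * star a := rfl

end Oct

/-- The triality triple given by the Moufang identity. -/
theorem isTriality_mul (a : Oct ℝ) (ha : dot a a = 1) :
    IsTriality (lmul a ha) (rmul a ha) (bmul a ha) where
  dot₁ x y := by rw [lmul_apply, lmul_apply, dot_mul_left, ha, one_mul]
  dot₂ x y := by rw [rmul_apply, rmul_apply, dot_mul_right, ha, one_mul]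
  dot₃ x y := by
    rw [bmul_apply, bmul_apply, dot_mul_right, dot_mul_left, dot_star_star, ha, one_mul, one_mul]
  trilinear x y z := by
    have flex : star a * (star (x * y) * star a) = (star a * star (x * y)) * star a := by
      simpa using moufang (star a) 1 (star (x * y))
    rw [lmul_apply, rmul_apply, bmul_apply, moufang, StarMul.star_mul, StarMul.star_mul a, flex,
      dot_mul_right, dot_mul_left, dot_star_star a, ha, one_mul, one_mul]

/-- Multiplication by a suitable unit octonion, on either side, makes `x` real and nonnegative. -/
theorem exists_unit_mul_eq (x : Oct ℝ) :
    ∃ a : Oct ℝ, dot a a = 1 ∧ ∃ t : ℝ, 0 ≤ t ∧ t ^ 2 = dot x x ∧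
      a * x = t • 1 ∧ x * a = t • 1 := by
  by_cases hx : x = 0
  · exact ⟨1, dot_one_one, 0, le_rfl, by simp [hx], by simp [hx], by simp [hx]⟩
  have hpos : 0 < dot x x :=
    lt_of_le_of_ne (dot_self_nonneg x) fun h => hx (dot_self_eq_zero.mp h.symm)
  have hs : 0 < √(dot x x) := Real.sqrt_pos.mpr hpos
  have hsq := Real.sq_sqrt hpos.le
  refine ⟨(√(dot x x))⁻¹ • star x, ?_, √(dot x x), hs.le, hsq, ?_, ?_⟩
  · rw [dot_smul_left, dot_smul_right, dot_star_star]
    field_simp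
    exact hsq.symm
  · rw [smul_mul_oct, star_mul_self, smul_smul]
    congr 1
    field_simp
    exact hsq.symm
  · rw [mul_smul_oct, mul_star_self, smul_smul]
    congr 1
    field_simp
    exact hsq.symm

/-! ### Automorphisms from `O(1, 2)` -/

/-- The action `X ↦ A X Aᵀ` of a complex matrix `A`. -/
def matAct (A : Matrix (Fin 3) (Fin 3) ℂ) (X : Mat) : Mat :=
  Matrix.of fun i j => ∑ p, ∑ q, (A i p * A j q) • X p q

theorem matAct_apply (A : Matrix (Fin 3) (Fin 3) ℂ) (X : Mat) (i j : Fin 3) :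
    matAct A X i j = ∑ p, ∑ q, (A i p * A j q) • X p q := rfl

theorem matAct_add (A : Matrix (Fin 3) (Fin 3) ℂ) (X Y : Mat) :
    matAct A (X + Y) = matAct A X + matAct A Y := by
  refine Matrix.ext fun i j => ?_
  simp only [matAct_apply, Matrix.add_apply, smul_add, Finset.sum_add_distrib]

theorem matAct_smul (A : Matrix (Fin 3) (Fin 3) ℂ) (r : ℝ) (X : Mat) :
    matAct A (r • X) = r • matAct A X := by
  refine Matrix.ext fun i j => ?_
  simp only [matAct_apply, Matrix.smul_apply, Finset.smul_sum]
  refine Finset.sum_congr rfl fun p _ => Finset.sum_congr rfl fun q _ => ?_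
  ext k
  simp
  ring

theorem matAct_matAct (A B : Matrix (Fin 3) (Fin 3) ℂ) (X : Mat) :
    matAct A (matAct B X) = matAct (A * B) X := by
  ext i j k
  simp only [matAct_apply, Matrix.mul_apply, Fin.sum_univ_three, Oct.add_apply, Oct.smul_apply,
    smul_eq_mul]
  ring

theorem matAct_one (X : Mat) : matAct 1 X = X := by
  refine Matrix.ext fun i j => ?_
  simp [matAct_apply, Matrix.one_apply]

theorem matAct_mul (A : Matrix (Fin 3) (Fin 3) ℂ) (hA : A.transpose * A = 1) (X Y : Mat) :
    matAct A X * matAct A Y = matAct A (X * Y) := by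
  have h : ∀ q r, ∑ k, A k q * A k r = if q = r then 1 else 0 := fun q r => by
    rw [← Matrix.one_apply, ← hA, Matrix.mul_apply]
    rfl
  refine Matrix.ext fun i j => ?_
  calc (matAct A X * matAct A Y) i j
      = ∑ p, ∑ s, ∑ q, ∑ r, (A i p * A j s * ∑ k, A k q * A k r) • (X p q * Y r s) := by
        simp only [Matrix.mul_apply, matAct_apply, Finset.sum_mul]
        simp only [Finset.mul_sum, smul_mul_oct, mul_smul_oct, smul_smul, Finset.sum_smul]
        rw [Finset.sum_comm]
        refine Finset.sum_congr rfl fun p _ => ?_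
        refine (Finset.sum_congr rfl fun k _ => (Finset.sum_congr rfl fun q _ =>
          Finset.sum_comm).trans Finset.sum_comm).trans ?_
        rw [Finset.sum_comm]
        refine Finset.sum_congr rfl fun s _ => ?_
        rw [Finset.sum_comm]
        refine Finset.sum_congr rfl fun q _ => ?_
        rw [Finset.sum_comm]
        refine Finset.sum_congr rfl fun r _ => Finset.sum_congr rfl fun k _ => ?_
        congr 1
        ring
    _ = matAct A (X * Y) i j := by
        simp only [h, matAct_apply, Matrix.mul_apply, mul_ite, mul_one, mul_zero, ite_smul,
          zero_smul, Finset.sum_ite_eq, Finset.mem_univ, if_true, Finset.smul_sum]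

theorem matAct_mem {A : Matrix (Fin 3) (Fin 3) ℂ}
    (hA : ∀ i j, (starRingEnd ℂ) (A i j) = if (i = 0 ↔ j = 0) then A i j else -A i j) {X : Mat}
    (hX : X ∈ J1) : matAct A X ∈ J1 := by
  constructor
  · ext i j : 2
    have h : ∀ p q, star (X p q) = X q p := fun p q => by
      conv_rhs => rw [← hX.1]
      rfl
    rw [Matrix.conjTranspose_apply, matAct_apply, matAct_apply, star_sum, Finset.sum_comm]
    simp only [star_sum, Oct.star_smul, h]
    simp only [mul_comm]
  · have h : ∀ p q k, (starRingEnd ℂ) ((X p q).c k) =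
        if (p = 0 ↔ q = 0) then (X p q).c k else -(X p q).c k := fun p q k => by
      conv_rhs => rw [← hX.2]
      simp only [tauSigma, Matrix.of_apply]
      split_ifs <;> simp [tau]
    refine Matrix.ext fun i j => ?_
    ext k : 2
    fin_cases i <;> fin_cases j <;>
      simp [tauSigma, tau, matAct_apply, Fin.sum_univ_three, hA, h] <;> ring

/-- The automorphism `X ↦ A X Aᵀ` for a matrix `A` in `O(3, ℂ)` whose entries are real or
imaginary in the same way as those of the elements of `J¹`; such matrices form a group
isomorphic to `O(1, 2)`. -/
def orthAut (A : Matrix (Fin 3) (Fin 3) ℂ)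
    (hA : ∀ i j, (starRingEnd ℂ) (A i j) = if (i = 0 ↔ j = 0) then A i j else -A i j)
    (h1 : A.transpose * A = 1) : J1 ≃ₗ[ℝ] J1 where
  toFun X := ⟨matAct A X, matAct_mem hA X.2⟩
  invFun X := ⟨matAct A.transpose X, matAct_mem (fun i j => by
    simpa only [Matrix.transpose_apply, iff_comm] using hA j i) X.2⟩
  map_add' X Y := Subtype.ext (matAct_add A X Y)
  map_smul' r X := Subtype.ext (matAct_smul A r X)
  left_inv X := Subtype.ext (by
    change matAct A.transpose (matAct A X) = X
    rw [matAct_matAct, h1, matAct_one])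
  right_inv X := Subtype.ext (by
    change matAct A (matAct A.transpose X) = X
    rw [matAct_matAct, mul_eq_one_comm.mp h1, matAct_one])

theorem coe_orthAut {A : Matrix (Fin 3) (Fin 3) ℂ}
    (hA : ∀ i j, (starRingEnd ℂ) (A i j) = if (i = 0 ↔ j = 0) then A i j else -A i j)
    (h1 : A.transpose * A = 1) (X : J1) : (orthAut A hA h1 X : Mat) = matAct A X := rfl

theorem orthAut_mem {A : Matrix (Fin 3) (Fin 3) ℂ}
    (hA : ∀ i j, (starRingEnd ℂ) (A i j) = if (i = 0 ↔ j = 0) then A i j else -A i j)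
    (h1 : A.transpose * A = 1) : orthAut A hA h1 ∈ F4 := by
  intro X Y
  apply Subtype.ext
  simp only [coe_orthAut, jordan, matAct_smul, matAct_add, matAct_mul A h1]

/-! ### Elementary moves inside an orbit -/

/-- Two elements of `J¹` are related by an automorphism that fixes `E₁`. -/
def SameOrbit₁ (X Y : J1) : Prop := ∃ g ∈ F4, g E₁ = E₁ ∧ g X = Y

namespace SameOrbit₁

theorem refl (X : J1) : SameOrbit₁ X X := ⟨1, F4.one_mem, rfl, rfl⟩

theorem trans {X Y Z : J1} : SameOrbit₁ X Y → SameOrbit₁ Y Z → SameOrbit₁ X Z := by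
  rintro ⟨g, hg, hE, rfl⟩ ⟨g', hg', hE', rfl⟩
  exact ⟨g' * g, F4.mul_mem hg' hg, (congrArg g' hE).trans hE', rfl⟩

theorem sameOrbit {X Y : J1} : SameOrbit₁ X Y → SameOrbit X Y := fun ⟨g, hg, _, h⟩ => ⟨g, hg, h⟩

end SameOrbit₁

theorem sameOrbit₁_of_isTriality {T₁ T₂ T₃ : Oct ℝ ≃ₗ[ℝ] Oct ℝ} (h : IsTriality T₁ T₂ T₃)
    (a b c : ℝ) (x y z : Oct ℝ) :
    SameOrbit₁ (h1 a b c x y z) (h1 a b c (T₁ x) (T₂ y) (T₃ z)) :=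
  ⟨_, h.offMap_mem, by simp [E₁, diag, offMap_h1], offMap_h1 ..⟩

theorem orthAut_h1 {A : Matrix (Fin 3) (Fin 3) ℂ}
    (hA : ∀ i j, (starRingEnd ℂ) (A i j) = if (i = 0 ↔ j = 0) then A i j else -A i j)
    (h : A.transpose * A = 1) (a b c : ℝ) (x y z : Oct ℝ) (i j : Fin 3) (k : Fin 8) :
    ((orthAut A hA h (h1 a b c x y z) : Mat) i j).c k =
      A i 0 * A j 0 * (a * (1 : Oct ℂ).c k) + A i 0 * A j 1 * (Complex.I * z.c k)
        + A i 0 * A j 2 * (Complex.I * (star y).c k)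
      + (A i 1 * A j 0 * (Complex.I * (star z).c k) + A i 1 * A j 1 * (b * (1 : Oct ℂ).c k)
        + A i 1 * A j 2 * x.c k)
      + (A i 2 * A j 0 * (Complex.I * y.c k) + A i 2 * A j 1 * (star x).c k
        + A i 2 * A j 2 * (c * (1 : Oct ℂ).c k)) := by
  rw [coe_orthAut, matAct_apply]
  simp only [Fin.sum_univ_three, h1_apply, Matrix.cons_val_zero, Matrix.cons_val_one,
    Matrix.cons_val, Oct.add_apply, Oct.smul_apply, toC_apply, smul_eq_mul]

/-- The rotation of the last two coordinates by an angle with cosine `p` and sine `q`. -/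
theorem sameOrbit₁_rotation {p q : ℝ} (h : p ^ 2 + q ^ 2 = 1) (a b c : ℝ) (x y z : Oct ℝ) :
    SameOrbit₁ (h1 a b c x y z)
      (h1 a (p ^ 2 * b + q ^ 2 * c + 2 * p * q * x.c 0) (q ^ 2 * b + p ^ 2 * c - 2 * p * q * x.c 0)
        ((p * q * (c - b)) • 1 + p ^ 2 • x - q ^ 2 • star x)
        (p • y - q • star z) (p • z + q • star y)) := by
  let A : Matrix (Fin 3) (Fin 3) ℂ := !![1, 0, 0; 0, p, q; 0, -q, p]
  have hA : ∀ i j, (starRingEnd ℂ) (A i j) = if (i = 0 ↔ j = 0) then A i j else -A i j := by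
    intro i j
    fin_cases i <;> fin_cases j <;> simp [A]
  have hC : (p : ℂ) ^ 2 + (q : ℂ) ^ 2 = 1 := by exact_mod_cast h
  have h1 : A.transpose * A = 1 := by
    ext i j
    fin_cases i <;> fin_cases j <;> simp [A, Matrix.mul_apply, Fin.sum_univ_three] <;>
      first | linear_combination hC | ring
  have key : ∀ a b c x y z, orthAut A hA h1 (ExcJordan.h1 a b c x y z) = ExcJordan.h1 a
      (p ^ 2 * b + q ^ 2 * c + 2 * p * q * x.c 0) (q ^ 2 * b + p ^ 2 * c - 2 * p * q * x.c 0)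
        ((p * q * (c - b)) • 1 + p ^ 2 • x - q ^ 2 • star x)
        (p • y - q • star z) (p • z + q • star y) := by
    intro a b c x y z
    apply J1_ext <;>
      simp only [dg_h1_zero, dg_h1_one, dg_h1_two, off₁_h1, off₂_h1, off₃_h1]
    · simp [dg, orthAut_h1, A]
    · simp [dg, orthAut_h1, A]; ring
    · simp [dg, orthAut_h1, A]; ring
    · ext k : 2
      by_cases hk : k = 0 <;> simp [off₁, orthAut_h1, A, hk] <;> ring
    · ext k : 2
      by_cases hk : k = 0 <;> simp [off₂, orthAut_h1, A, hk] <;> ring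
    · ext k : 2
      by_cases hk : k = 0 <;> simp [off₃, orthAut_h1, A, hk]
  exact ⟨_, orthAut_mem hA h1, by simp [E₁, diag, key], key ..⟩

/-- The hyperbolic rotation of the first two coordinates, here for elements whose off-diagonal part
is real and concentrated in these coordinates. -/
theorem sameOrbit_boost (θ p d t l : ℝ) :
    SameOrbit (h1 (p + d) (p - d) l 0 0 (t • 1))
      (h1 (p + (Real.cosh θ * d - Real.sinh θ * t)) (p - (Real.cosh θ * d - Real.sinh θ * t)) l
        0 0 ((Real.cosh θ * t - Real.sinh θ * d) • 1)) := by
  set C := Real.cosh (θ / 2) with hCdef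
  set S := Real.sinh (θ / 2) with hSdef
  have h : C ^ 2 - S ^ 2 = 1 := Real.cosh_sq_sub_sinh_sq _
  have hc : Real.cosh θ = C ^ 2 + S ^ 2 := by
    rw [hCdef, hSdef, ← Real.cosh_two_mul]; ring_nf
  have hs : Real.sinh θ = 2 * S * C := by
    rw [hCdef, hSdef, ← Real.sinh_two_mul]; ring_nf
  let A : Matrix (Fin 3) (Fin 3) ℂ := !![C, Complex.I * S, 0; -Complex.I * S, C, 0; 0, 0, 1]
  have hA : ∀ i j, (starRingEnd ℂ) (A i j) = if (i = 0 ↔ j = 0) then A i j else -A i j := by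
    intro i j
    fin_cases i <;> fin_cases j <;> simp [A, -Complex.ofReal_cosh, -Complex.ofReal_sinh]
  have hC : (C : ℂ) ^ 2 - (S : ℂ) ^ 2 = 1 := by exact_mod_cast h
  clear_value C S
  have h1 : A.transpose * A = 1 := by
    ext i j
    fin_cases i <;> fin_cases j <;> simp [A, Matrix.mul_apply, Fin.sum_univ_three] <;>
      first
      | linear_combination hC + (S : ℂ) ^ 2 * Complex.I_sq
      | linear_combination hC - (S : ℂ) ^ 2 * Complex.I_sq
      | ring
  refine ⟨_, orthAut_mem hA h1, ?_⟩
  rw [hc, hs]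
  apply J1_ext <;>
    simp only [dg_h1_zero, dg_h1_one, dg_h1_two, off₁_h1, off₂_h1, off₃_h1]
  · simp [dg, orthAut_h1, A]
    linear_combination p * h
  · simp [dg, orthAut_h1, A]
    linear_combination p * h
  · simp [dg, orthAut_h1, A]
  · ext k : 2
    by_cases hk : k = 0 <;> simp [off₁, orthAut_h1, A, hk]
  · ext k : 2
    by_cases hk : k = 0 <;> simp [off₂, orthAut_h1, A, hk]
  · ext k : 2
    by_cases hk : k = 0 <;> simp [off₃, orthAut_h1, A, hk]
    ring

/-- The null rotations act on `h¹(-s, s, 0; 1, 1, s)` by translations of the parameter `s`. -/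
theorem sameOrbit_nullRotation (s : ℝ) : SameOrbit (h1 (-s) s 0 1 1 (s • 1)) (Qplus 1) := by
  -- the null rotation with parameter `u` sends `s` to `s + 2u`
  obtain ⟨u, hsu⟩ : ∃ u : ℝ, s = -2 * u := ⟨-s / 2, by ring⟩
  obtain ⟨w, hw⟩ : ∃ w : ℝ, w = u ^ 2 / 2 := ⟨_, rfl⟩
  let A : Matrix (Fin 3) (Fin 3) ℂ := !![1 + w, -Complex.I * w, Complex.I * u;
    -Complex.I * w, 1 - w, u; -Complex.I * u, -u, 1]
  have hA : ∀ i j, (starRingEnd ℂ) (A i j) = if (i = 0 ↔ j = 0) then A i j else -A i j := by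
    intro i j
    fin_cases i <;> fin_cases j <;> simp [A]
  have hC : (w : ℂ) = (u : ℂ) ^ 2 / 2 := by rw [hw]; push_cast; ring
  have h1 : A.transpose * A = 1 := by
    ext i j
    fin_cases i <;> fin_cases j <;> simp [A, Matrix.mul_apply, Fin.sum_univ_three] <;>
      ring_nf <;> simp [hC] <;> ring
  refine ⟨_, orthAut_mem hA h1, ?_⟩
  subst hsu
  apply J1_ext <;>
    simp only [Qplus, dg_h1_zero, dg_h1_one, dg_h1_two, off₁_h1, off₂_h1, off₃_h1]
  · simp [dg, orthAut_h1, A]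
    ring
  · simp [dg, orthAut_h1, A]
    ring
  · simp [dg, orthAut_h1, A]
  · ext k : 2
    by_cases hk : k = 0 <;> simp [off₁, orthAut_h1, A, hk]
  · ext k : 2
    by_cases hk : k = 0 <;> simp [off₂, orthAut_h1, A, hk]
    ring
  · ext k : 2
    by_cases hk : k = 0 <;> simp [off₃, orthAut_h1, A, hk]
    ring

/-- The rotation through the cosine `p` and the sine `q` annihilates the real off-diagonal entry `t`
of a symmetric `2 × 2` matrix whose diagonal entries differ by `2δ`. -/
theorem exists_rotation_angle (t δ : ℝ) :
    ∃ p q : ℝ, p ^ 2 + q ^ 2 = 1 ∧ p * q * (2 * δ) + (p ^ 2 - q ^ 2) * t = 0 := by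
  obtain ⟨φ, hφ⟩ : ∃ φ : ℝ, δ * Real.sin φ + Real.cos φ * t = 0 := by
    let z : ℂ := ⟨δ, -t⟩
    refine ⟨z.arg, ?_⟩
    have h1 : ‖z‖ * Real.cos z.arg = δ := Complex.norm_mul_cos_arg z
    have h2 : ‖z‖ * Real.sin z.arg = -t := Complex.norm_mul_sin_arg z
    linear_combination (-Real.sin z.arg) * h1 + Real.cos z.arg * h2
  refine ⟨Real.cos (φ / 2), Real.sin (φ / 2), Real.cos_sq_add_sin_sq _, ?_⟩
  have h1 : Real.sin φ = 2 * Real.sin (φ / 2) * Real.cos (φ / 2) := by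
    rw [← Real.sin_two_mul]; ring_nf
  have h2 : Real.cos φ = Real.cos (φ / 2) ^ 2 - Real.sin (φ / 2) ^ 2 := by
    rw [← Real.cos_two_mul']; ring_nf
  rw [h1, h2] at hφ
  linear_combination hφ

/-- Every element can be moved, with `E₁` fixed, so that `x₁ = 0`. -/
theorem exists_sameOrbit₁_off₁_eq_zero (a b c : ℝ) (x y z : Oct ℝ) :
    ∃ b' c' y' z', SameOrbit₁ (h1 a b c x y z) (h1 a b' c' 0 y' z') ∧
      (y = 0 → z = 0 → y' = 0 ∧ z' = 0) := by
  obtain ⟨u, hu, t, -, -, htx, -⟩ := exists_unit_mul_eq x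
  have s1 := sameOrbit₁_of_isTriality (isTriality_mul u hu) a b c x y z
  rw [lmul_apply, htx] at s1
  obtain ⟨p, q, hpq, h⟩ := exists_rotation_angle t ((c - b) / 2)
  have s2 := s1.trans (sameOrbit₁_rotation hpq _ _ _ _ _ _)
  have h0 : (p * q * (c - b)) • 1 + p ^ 2 • t • (1 : Oct ℝ) -
      q ^ 2 • star (t • (1 : Oct ℝ)) = 0 := by
    have e : star (t • (1 : Oct ℝ)) = t • 1 := by
      ext k : 2; by_cases hk : k = 0 <;> simp [hk]
    rw [e, smul_smul, smul_smul, ← add_smul, ← sub_smul]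
    have : p * q * (c - b) + p ^ 2 * t - q ^ 2 * t = 0 := by linear_combination h
    rw [this, zero_smul]
  rw [h0] at s2
  refine ⟨_, _, _, _, s2, ?_⟩
  rintro rfl rfl
  simp

/-- The last two coordinates can be swapped with `E₁` fixed. -/
theorem sameOrbit₁_swap (a b c : ℝ) (y z : Oct ℝ) :
    SameOrbit₁ (h1 a b c 0 y z) (h1 a c b 0 (-star z) (star y)) := by
  simpa using sameOrbit₁_rotation (p := 0) (q := 1) (by norm_num) a b c 0 y z

theorem sameOrbit₁_diag_swap (a b c : ℝ) : SameOrbit₁ (diag a b c) (diag a c b) := by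
  simpa [diag] using sameOrbit₁_swap a b c 0 0

/-- If `x₁ = 0`, then `x₃` can be made real and nonnegative. -/
theorem exists_sameOrbit₁_off₃_real (a b c : ℝ) (y z : Oct ℝ) :
    ∃ t y', 0 ≤ t ∧ t ^ 2 = dot z z ∧ (y = 0 → y' = 0) ∧
      SameOrbit₁ (h1 a b c 0 y z) (h1 a b c 0 y' (t • 1)) := by
  obtain ⟨u, hu, t, ht, ht2, -, htz⟩ := exists_unit_mul_eq z
  have s1 := sameOrbit₁_of_isTriality (isTriality_mul u hu).rotate.rotate a b c 0 y z
  rw [rmul_apply, htz, map_zero] at s1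
  refine ⟨t, _, ht, ht2, ?_, s1⟩
  rintro rfl
  simp

/-- An element with `x₂ = x₃ = 0` is diagonalizable. -/
theorem exists_sameOrbit₁_diag (a b c : ℝ) (x : Oct ℝ) :
    ∃ b' c', SameOrbit₁ (h1 a b c x 0 0) (diag a b' c') := by
  obtain ⟨b', c', y', z', h, h0⟩ := exists_sameOrbit₁_off₁_eq_zero a b c x 0 0
  obtain ⟨rfl, rfl⟩ := h0 rfl rfl
  exact ⟨b', c', h⟩

/-! ### Normal forms of `h¹(p + d, p - d, l; 0, 0, t)`, by the sign of `t² - d²` -/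

/-- `sameOrbit_boost` in terms of the hyperbolic cosine `C` and the hyperbolic sine `S`. -/
theorem sameOrbit_of_boost {p d t l d' t' : ℝ} (C S : ℝ) (h : C ^ 2 - S ^ 2 = 1) (hC : 0 < C)
    (hd : C * d - S * t = d') (ht : C * t - S * d = t') :
    SameOrbit (h1 (p + d) (p - d) l 0 0 (t • 1)) (h1 (p + d') (p - d') l 0 0 (t' • 1)) := by
  have h1 := sameOrbit_boost (Real.arsinh S) p d t l
  have h2 : Real.cosh (Real.arsinh S) = C := by
    rw [Real.cosh_arsinh, show 1 + S ^ 2 = C ^ 2 by linarith, Real.sqrt_sq hC.le]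
  rwa [Real.sinh_arsinh, h2, hd, ht] at h1

/-- A block with `t² < d²` is diagonalizable; the sign of the difference of the first two diagonal
entries does not change. -/
theorem sameOrbit_diag_of_lt {p d t l : ℝ} (h : t ^ 2 < d ^ 2) :
    ∃ r : ℝ, r ^ 2 = d ^ 2 - t ^ 2 ∧ 0 < r * d ∧
      SameOrbit (h1 (p + d) (p - d) l 0 0 (t • 1)) (diag (p + r) (p - r) l) := by
  obtain ⟨r, hr, hrd⟩ : ∃ r : ℝ, r ^ 2 = d ^ 2 - t ^ 2 ∧ 0 < r * d := by
    have hs : 0 < √(d ^ 2 - t ^ 2) := Real.sqrt_pos.mpr (by linarith)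
    have hs2 := Real.sq_sqrt (show 0 ≤ d ^ 2 - t ^ 2 by linarith)
    rcases lt_trichotomy d 0 with hd | rfl | hd
    · exact ⟨-√(d ^ 2 - t ^ 2), by rw [neg_sq, hs2], by nlinarith⟩
    · nlinarith [sq_nonneg t]
    · exact ⟨√(d ^ 2 - t ^ 2), hs2, by positivity⟩
  refine ⟨r, hr, hrd, ?_⟩
  have hr0 : r ≠ 0 := by rintro rfl; simp at hrd
  have hC : 0 < d / r := by
    rw [show d / r = r * d / r ^ 2 by field_simp]
    positivity
  have := sameOrbit_of_boost (p := p) (d := d) (t := t) (l := l) (d' := r) (t' := 0) (d / r) (t / r)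
    (by field_simp; linarith) hC (by field_simp; linarith) (by field_simp; ring)
  simpa [diag] using this

/-- In a block with `d² < t²` the first two diagonal entries can be made equal. -/
theorem sameOrbit_complex_of_lt {p d t l : ℝ} (ht : 0 ≤ t) (h : d ^ 2 < t ^ 2) :
    ∃ q : ℝ, 0 < q ∧ SameOrbit (h1 (p + d) (p - d) l 0 0 (t • 1)) (h1 p p l 0 0 (q • 1)) := by
  have hs : 0 < √(t ^ 2 - d ^ 2) := Real.sqrt_pos.mpr (by linarith)
  have hs2 := Real.sq_sqrt (show 0 ≤ t ^ 2 - d ^ 2 by linarith)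
  set q := √(t ^ 2 - d ^ 2)
  have ht0 : 0 < t := lt_of_le_of_ne ht (by rintro rfl; nlinarith [sq_nonneg d])
  refine ⟨q, hs, ?_⟩
  have := sameOrbit_of_boost (p := p) (d := d) (t := t) (l := l) (d' := 0) (t' := q) (t / q) (d / q)
    (by field_simp; linarith) (by positivity) (by field_simp; ring) (by field_simp; linarith)
  simpa using this

theorem sameOrbit_null {d t : ℝ} (p l : ℝ) (ht : 0 < t) {ε : ℝ} (hε : ε ^ 2 = 1) (h : d = ε * t) :
    SameOrbit (h1 (p + d) (p - d) l 0 0 (t • 1)) (h1 (p + ε) (p - ε) l 0 0 1) := by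
  -- the hyperbolic rotation scales the null vector `(ε t, t)` by `1 / t`
  have := sameOrbit_of_boost (p := p) (d := d) (t := t) (l := l) (d' := ε) (t' := 1)
    ((1 / t + t) / 2) (ε * ((t - 1 / t) / 2))
    (by rw [mul_pow, hε]; field_simp; ring) (by positivity)
    (by rw [h]; field_simp; ring) (by rw [h]; field_simp; rw [hε]; ring)
  simpa using this

/-! ### The adjoint identities -/

theorem Oct.star_smul_real (a : ℝ) (x : Oct ℝ) : star (a • x) = a • star x := by
  ext k : 2; by_cases h : k = 0 <;> simp [h]

theorem Oct.dot_neg_right (x y : Oct ℝ) : dot x (-y) = -dot x y := by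
  simp [dot]

theorem det_h1 (a b c : ℝ) (x y z : Oct ℝ) : det (h1 a b c x y z) =
    a * b * c - a * dot x x + b * dot y y + c * dot z z - 2 * dot (star (x * y)) z := by
  rw [det, cross_h1, ip_h1]
  simp only [dot_sub_right, dot_smul_right, dot_neg_right, dot_comm _ (star _)]
  linear_combination (-2 / 3 : ℝ) * dot_star_mul_rotate z x y +
    (2 / 3 : ℝ) * dot_star_mul_rotate x y z

/-- Every element can be moved to one with `x₁ = 0` and real `x₃`; the adjoint identities are
verified for elements of this form. -/
theorem exists_sameOrbit_reduced (X : J1) :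
    ∃ (a b c : ℝ) (y : Oct ℝ) (t : ℝ), SameOrbit X (h1 a b c 0 y (t • 1)) := by
  obtain ⟨b, c, y, z, h, -⟩ := exists_sameOrbit₁_off₁_eq_zero (dg 0 X) (dg 1 X) (dg 2 X)
    (off₁ X) (off₂ X) (off₃ X)
  obtain ⟨t, y', -, -, -, h'⟩ := exists_sameOrbit₁_off₃_real (dg 0 X) b c y z
  rw [h1_coords] at h
  exact ⟨_, _, _, _, _, (h.trans h').sameOrbit⟩

theorem cross_cross_self (X : J1) :
    cross (cross X X) (cross X X) = det X • X := by
  obtain ⟨a, b, c, y, t, g, hg, h⟩ := exists_sameOrbit_reduced X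
  apply g.injective
  rw [map_cross hg, map_cross hg, map_smul, ← det_map hg, h, det_h1, cross_h1, cross_h1, smul_h1,
    h1_inj]
  simp only [smul_mul_oct, mul_smul_oct, mul_one, one_mul, zero_mul, mul_zero, star_zero,
    Oct.star_smul_real, star_one, smul_smul, smul_zero, sub_zero, zero_sub, mul_neg,
    neg_mul, ← neg_smul, star_mul_self, star_star, dot_smul_left, dot_smul_right, dot_star_star,
    dot_one_one, dot_zero_left, dot_zero_right]
  refine ⟨?_, ?_, ?_, ?_, ?_, ?_⟩
  · ring
  · ring
  · ring
  · module
  · module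
  · module

theorem jordan_cross_self (X : J1) : jordan X (cross X X) = det X • unitE := by
  obtain ⟨a, b, c, y, t, g, hg, h⟩ := exists_sameOrbit_reduced X
  apply g.injective
  rw [map_jordan hg, map_cross hg, map_smul, ← det_map hg, map_unitE hg, h, det_h1, cross_h1,
    unitE_eq_h1, jordan_h1, smul_h1, h1_inj]
  simp only [smul_mul_oct, mul_smul_oct, mul_one, one_mul, zero_mul, mul_zero, star_zero,
    Oct.star_smul_real, star_one, smul_smul, smul_zero, sub_zero, zero_sub, mul_neg,
    neg_mul, ← neg_smul, star_mul_self, star_star, dot_smul_left, dot_smul_right,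
    dot_one_one, dot_zero_left, dot_zero_right, star_add, add_zero, zero_add]
  refine ⟨?_, ?_, ?_, ?_, ?_, ?_⟩
  · ring
  · ring
  · ring
  · module
  · module
  · module

/-! ### Primitive idempotents and null elements -/

theorem cross_smul_smul (a : ℝ) (X : J1) : cross (a • X) (a • X) = a ^ 2 • cross X X := by
  rw [← h1_coords X, smul_h1, cross_h1, cross_h1, smul_h1, h1_inj]
  simp only [dot_smul_left, dot_smul_right, smul_mul_oct, mul_smul_oct, Oct.star_smul_real,
    smul_smul, smul_sub, smul_neg]
  refine ⟨by ring, by ring, by ring, by module, by module, by module⟩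

theorem SameOrbit₁.cross_eq_zero {X Y : J1} (h : SameOrbit₁ X Y) (hX : cross X X = 0) :
    cross Y Y = 0 := by
  obtain ⟨g, hg, -, rfl⟩ := h
  rw [← map_cross hg, hX, map_zero]

theorem SameOrbit₁.tr_eq {X Y : J1} (h : SameOrbit₁ X Y) : tr X = tr Y := by
  obtain ⟨g, hg, -, rfl⟩ := h
  rw [tr_map hg]

theorem cross_h1_eq_zero {a b c : ℝ} {x y z : Oct ℝ}
    (h : cross (h1 a b c x y z) (h1 a b c x y z) = 0) :
    b * c = dot x x ∧ c * a = -dot y y ∧ a * b = -dot z z := by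
  rw [cross_h1, zero_eq_h1, h1_inj] at h
  exact ⟨by linarith [h.1], by linarith [h.2.1], by linarith [h.2.2.1]⟩

/-- An element with `X × X = 0` can be moved, with `E₁` fixed, into the upper left `2 × 2` block. -/
theorem exists_sameOrbit₁_of_cross_eq_zero {X : J1} (h : cross X X = 0) :
    ∃ t : ℝ, 0 ≤ t ∧ dg 0 X * (tr X - dg 0 X) = -t ^ 2 ∧
      SameOrbit₁ X (h1 (dg 0 X) (tr X - dg 0 X) 0 0 0 (t • 1)) := by
  suffices H : ∃ (b t : ℝ), 0 ≤ t ∧ SameOrbit₁ X (h1 (dg 0 X) b 0 0 0 (t • 1)) by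
    obtain ⟨b, t, ht, h1⟩ := H
    have e := h1.tr_eq
    rw [tr_h1] at e
    obtain rfl : b = tr X - dg 0 X := by linarith
    refine ⟨t, ht, ?_, h1⟩
    have := (cross_h1_eq_zero (h1.cross_eq_zero h)).2.2
    rw [this, dot_smul_left, dot_smul_right, dot_one_one]
    ring
  -- an element with `x₁ = 0` and `ξ₃ = 0` is already of the required form up to a rotation of `x₃`
  have key : ∀ (b : ℝ) (y z : Oct ℝ), SameOrbit₁ X (h1 (dg 0 X) b 0 0 y z) →
      ∃ (b t : ℝ), 0 ≤ t ∧ SameOrbit₁ X (h1 (dg 0 X) b 0 0 0 (t • 1)) := by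
    intro b y z h1
    have := (cross_h1_eq_zero (h1.cross_eq_zero h)).2.1
    obtain rfl : y = 0 := dot_self_eq_zero.mp (by linarith)
    obtain ⟨t, y', ht, -, hy, h2⟩ := exists_sameOrbit₁_off₃_real (dg 0 X) b 0 0 z
    rw [hy rfl] at h2
    exact ⟨b, t, ht, h1.trans h2⟩
  obtain ⟨b, c, y, z, h1, -⟩ := exists_sameOrbit₁_off₁_eq_zero (dg 0 X) (dg 1 X) (dg 2 X)
    (off₁ X) (off₂ X) (off₃ X)
  rw [h1_coords] at h1
  have hbc := (cross_h1_eq_zero (h1.cross_eq_zero h)).1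
  rw [dot_zero_left, mul_eq_zero] at hbc
  rcases hbc with rfl | rfl
  · exact key _ _ _ (h1.trans (sameOrbit₁_swap _ _ _ _ _))
  · exact key _ _ _ h1

theorem mem_hypPlane_iff {X : J1} : X ∈ hypPlane ↔ cross X X = 0 ∧ tr X = 1 ∧ 1 ≤ dg 0 X := by
  rw [hypPlane, Set.mem_ofPred_eq, ip_E₁]

theorem mem_hypPlane'_iff {X : J1} : X ∈ hypPlane' ↔ cross X X = 0 ∧ tr X = 1 ∧ dg 0 X ≤ 0 := by
  rw [hypPlane', Set.mem_ofPred_eq, ip_E₁]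

/-- The primitive idempotents are the elements of `H(𝐎)` and `H'(𝐎)`. -/
theorem mem_hypPlane_or_mem_hypPlane' {X : J1} (h : cross X X = 0) (ht : tr X = 1) :
    X ∈ hypPlane ∨ X ∈ hypPlane' := by
  rw [mem_hypPlane_iff, mem_hypPlane'_iff]
  obtain ⟨t, -, h1, -⟩ := exists_sameOrbit₁_of_cross_eq_zero h
  rw [ht] at h1
  rcases le_or_gt (dg 0 X) 0 with h0 | h0
  · exact Or.inr ⟨h, ht, h0⟩
  · exact Or.inl ⟨h, ht, by nlinarith [sq_nonneg t]⟩

theorem disjoint_hypPlane : Disjoint hypPlane hypPlane' := by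
  rw [Set.disjoint_left]
  intro X h h'
  linarith [(mem_hypPlane_iff.mp h).2.2, (mem_hypPlane'_iff.mp h').2.2]

theorem sameOrbit_of_mem_hypPlane {X : J1} (h : X ∈ hypPlane) : SameOrbit X (diag 1 0 0) := by
  obtain ⟨hX, ht, h0⟩ := mem_hypPlane_iff.mp h
  obtain ⟨t, -, h1, h2⟩ := exists_sameOrbit₁_of_cross_eq_zero hX
  rw [ht] at h1 h2
  obtain ⟨r, hr, hrd, h3⟩ := sameOrbit_diag_of_lt (p := 1 / 2) (d := dg 0 X - 1 / 2) (t := t)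
    (l := 0) (by linarith)
  obtain rfl : r = 1 / 2 := by
    have h4 : 0 < r := pos_of_mul_pos_left hrd (by linarith)
    nlinarith
  have h5 := h2.sameOrbit
  rw [show dg 0 X = 1 / 2 + (dg 0 X - 1 / 2) by ring,
    show 1 - (1 / 2 + (dg 0 X - 1 / 2)) = 1 / 2 - (dg 0 X - 1 / 2) by ring] at h5
  have h6 := h5.trans h3
  norm_num at h6
  exact h6

theorem sameOrbit_of_mem_hypPlane' {X : J1} (h : X ∈ hypPlane') : SameOrbit X (diag 0 0 1) := by
  obtain ⟨hX, ht, h0⟩ := mem_hypPlane'_iff.mp h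
  obtain ⟨t, -, h1, h2⟩ := exists_sameOrbit₁_of_cross_eq_zero hX
  rw [ht] at h1 h2
  obtain ⟨r, hr, hrd, h3⟩ := sameOrbit_diag_of_lt (p := 1 / 2) (d := dg 0 X - 1 / 2) (t := t)
    (l := 0) (by linarith)
  obtain rfl : r = -1 / 2 := by
    have h4 : r < 0 := by nlinarith
    nlinarith
  have h5 := h2.sameOrbit
  rw [show dg 0 X = 1 / 2 + (dg 0 X - 1 / 2) by ring,
    show 1 - (1 / 2 + (dg 0 X - 1 / 2)) = 1 / 2 - (dg 0 X - 1 / 2) by ring] at h5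
  have h6 := h5.trans h3
  norm_num at h6
  exact h6.trans (sameOrbit₁_diag_swap 0 1 0).sameOrbit

/-- For primitive idempotents `F`, the value `(F|E₃)` may lie strictly between `0` and `1`, whereas
`(F|E₁)` never does. -/
theorem not_sameOrbit_idempotents : ¬ SameOrbit (diag 0 0 1) (diag 1 0 0) := by
  rintro ⟨g, hg, h⟩
  -- a primitive idempotent `F` with `(F|E₃)` strictly between `0` and `1`
  let F := h1 0 2⁻¹ 2⁻¹ ((2⁻¹ : ℝ) • 1) 0 0
  have hF : cross F F = 0 := by
    rw [cross_h1, zero_eq_h1, h1_inj]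
    simp [dot_smul_left, dot_smul_right]
  have h1 : cross (g F) (g F) = 0 := by rw [← map_cross hg, hF, map_zero]
  have h2 : tr (g F) = 1 := by rw [tr_map hg, tr_h1]; norm_num
  have h3 : dg 0 (g F) = 2⁻¹ := by
    have h4 : ip (g F) (g (diag 0 0 1)) = 2⁻¹ := by
      rw [ip_map hg, diag, ip_h1]; simp
    rwa [h, ← E₁, ip_E₁] at h4
  rcases mem_hypPlane_or_mem_hypPlane' h1 h2 with h5 | h5
  · have := (mem_hypPlane_iff.mp h5).2.2
    norm_num [h3] at this
  · have := (mem_hypPlane'_iff.mp h5).2.2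
    norm_num [h3] at this

section Automorphisms

variable {g : J1 ≃ₗ[ℝ] J1}

/-- `H(𝐎)` is invariant, since its elements are conjugate to `E₁`, those of `H'(𝐎)` to `E₃`. -/
theorem map_mem_hypPlane (hg : g ∈ F4) {X : J1} (h : X ∈ hypPlane) : g X ∈ hypPlane := by
  refine (mem_hypPlane_or_mem_hypPlane' (X := g X) ?_ ?_).resolve_right fun h' => ?_
  · rw [← map_cross hg, h.1, map_zero]
  · rw [tr_map hg, h.2.1]
  · exact not_sameOrbit_idempotents (((sameOrbit_of_mem_hypPlane' h').symm.trans
      (SameOrbit.symm ⟨g, hg, rfl⟩)).trans (sameOrbit_of_mem_hypPlane h))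

theorem map_mem_hypPlane' (hg : g ∈ F4) {X : J1} (h : X ∈ hypPlane') : g X ∈ hypPlane' := by
  refine (mem_hypPlane_or_mem_hypPlane' (X := g X) ?_ ?_).resolve_left fun h' => ?_
  · rw [← map_cross hg, h.1, map_zero]
  · rw [tr_map hg, h.2.1]
  · have h1 := map_mem_hypPlane (F4.inv_mem hg) h'
    rw [show g⁻¹ (g X) = X from g.symm_apply_apply X] at h1
    exact disjoint_hypPlane.le_bot ⟨h1, h⟩

end Automorphisms

theorem mem_nullCone₁plus_iff {X : J1} :
    X ∈ nullCone₁plus ↔ cross X X = 0 ∧ tr X = 0 ∧ 0 < dg 0 X := by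
  rw [nullCone₁plus, Set.mem_ofPred_eq, ip_E₁]

theorem mem_nullCone₁minus_iff {X : J1} :
    X ∈ nullCone₁minus ↔ cross X X = 0 ∧ tr X = 0 ∧ dg 0 X < 0 := by
  rw [nullCone₁minus, Set.mem_ofPred_eq, ip_E₁]

theorem neg_mem_nullCone₁plus_iff {X : J1} : -X ∈ nullCone₁plus ↔ X ∈ nullCone₁minus := by
  have h : cross (-X) (-X) = cross X X := by
    rw [← neg_one_smul ℝ, cross_smul_smul]; simp
  rw [mem_nullCone₁plus_iff, mem_nullCone₁minus_iff, h, tr_neg, ← neg_one_smul ℝ X, dg_smul]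
  constructor <;> rintro ⟨h1, h2, h3⟩ <;> exact ⟨h1, by linarith, by linarith⟩

/-- A null vector whose `E₁`-component vanishes is zero. -/
theorem eq_zero_of_null {X : J1} (h : cross X X = 0) (ht : tr X = 0) (h0 : dg 0 X = 0) :
    X = 0 := by
  obtain ⟨t, -, h1, g, hg, -, h2⟩ := exists_sameOrbit₁_of_cross_eq_zero h
  rw [h0] at h1
  obtain rfl : t = 0 := by
    have : t ^ 2 = 0 := by linarith
    simpa using this
  rw [h0, ht] at h2
  apply g.injective
  rw [h2, map_zero, zero_eq_h1]
  simp

theorem eq_zero_or_mem_nullCone₁ {X : J1} (h : cross X X = 0) (ht : tr X = 0) :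
    X = 0 ∨ X ∈ nullCone₁plus ∨ X ∈ nullCone₁minus := by
  rw [mem_nullCone₁plus_iff, mem_nullCone₁minus_iff]
  rcases lt_trichotomy (dg 0 X) 0 with h0 | h0 | h0
  · exact Or.inr (Or.inr ⟨h, ht, h0⟩)
  · exact Or.inl (eq_zero_of_null h ht h0)
  · exact Or.inr (Or.inl ⟨h, ht, h0⟩)

theorem sameOrbit_of_mem_nullCone₁plus {X : J1} (h : X ∈ nullCone₁plus) : SameOrbit X Pplus := by
  obtain ⟨hX, ht, h0⟩ := mem_nullCone₁plus_iff.mp h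
  obtain ⟨t, ht0, h1, h2⟩ := exists_sameOrbit₁_of_cross_eq_zero hX
  rw [ht] at h1 h2
  have h3 : dg 0 X = 1 * t := by nlinarith
  have h4 := sameOrbit_null 0 0 (by linarith) (ε := 1) (by norm_num) h3
  have h5 := h2.sameOrbit
  simp only [zero_add, zero_sub] at h4 h5
  exact h5.trans h4

theorem sameOrbit_of_mem_nullCone₁minus {X : J1} (h : X ∈ nullCone₁minus) :
    SameOrbit X Pminus := by
  obtain ⟨hX, ht, h0⟩ := mem_nullCone₁minus_iff.mp h
  obtain ⟨t, ht0, h1, h2⟩ := exists_sameOrbit₁_of_cross_eq_zero hX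
  rw [ht] at h1 h2
  have h3 : dg 0 X = -1 * t := by nlinarith
  have h4 := sameOrbit_null 0 0 (by linarith) (ε := -1) (by norm_num) h3
  have h5 := h2.sameOrbit
  simp only [zero_add, zero_sub, neg_neg] at h4 h5
  exact h5.trans h4

/-- A Cauchy–Schwarz inequality between the cone `N₁⁺(𝐎)` and `H(𝐎)`. It characterizes the sign of a
null vector without reference to `E₁`. -/
theorem ip_nonneg_of_mem {X F : J1} (h : X ∈ nullCone₁plus) (hF : F ∈ hypPlane) : 0 ≤ ip X F := by
  obtain ⟨hX, ht, h0⟩ := mem_nullCone₁plus_iff.mp h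
  obtain ⟨t, ht0, h1, g, hg, hE, h2⟩ := exists_sameOrbit₁_of_cross_eq_zero hX
  have h3 := map_mem_hypPlane hg hF
  rw [← ip_map hg, h2]
  rw [ht] at h1 ⊢
  generalize g F = F at h3
  obtain ⟨hF, -, hF0⟩ := mem_hypPlane_iff.mp h3
  rw [← h1_coords F] at hF ⊢
  have h4 := (cross_h1_eq_zero hF).2.2
  have h5 := sq_le_dot_self (off₃ F)
  rw [ip_h1]
  have h6 : dot (t • 1) (off₃ F) = t * (off₃ F).c 0 := by
    simp [dot]
  rw [h6, dot_zero_left, dot_zero_left]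
  have h7 : dg 0 X = t := by nlinarith
  have h8 : dg 1 F ≤ 0 := by nlinarith [dot_self_nonneg (off₃ F)]
  have h9 : 2 * (off₃ F).c 0 ≤ dg 0 F - dg 1 F :=
    abs_le_of_sq_le_sq' (by nlinarith [sq_nonneg (dg 0 F + dg 1 F)]) (by linarith) |>.2
  rw [h7]
  nlinarith

section Automorphisms

variable {g : J1 ≃ₗ[ℝ] J1}

theorem E₁_mem_hypPlane : E₁ ∈ hypPlane := by
  rw [mem_hypPlane_iff, E₁, diag]
  simp [cross_h1, zero_eq_h1]

theorem map_mem_nullCone₁plus (hg : g ∈ F4) {X : J1} (h : X ∈ nullCone₁plus) :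
    g X ∈ nullCone₁plus := by
  obtain ⟨hX, ht, h0⟩ := mem_nullCone₁plus_iff.mp h
  have hX' : cross (g X) (g X) = 0 := by rw [← map_cross hg, hX, map_zero]
  have ht' : tr (g X) = 0 := by rw [tr_map hg, ht]
  refine mem_nullCone₁plus_iff.mpr ⟨hX', ht', lt_of_le_of_ne ?_ fun h1 => ?_⟩
  · have h1 := ip_nonneg_of_mem h (map_mem_hypPlane (F4.inv_mem hg) E₁_mem_hypPlane)
    rwa [← ip_map hg, show g (g⁻¹ E₁) = E₁ from g.apply_symm_apply E₁, ip_E₁] at h1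
  · have h2 := eq_zero_of_null hX' ht' h1.symm
    rw [map_eq_zero_iff g g.injective] at h2
    rw [h2] at h0
    simp [dg] at h0

theorem map_mem_nullCone₁minus (hg : g ∈ F4) {X : J1} (h : X ∈ nullCone₁minus) :
    g X ∈ nullCone₁minus := by
  rw [← neg_mem_nullCone₁plus_iff] at h ⊢
  rw [← map_neg]
  exact map_mem_nullCone₁plus hg h

theorem map_mem_nullCone₂ (hg : g ∈ F4) {X : J1} (h : X ∈ nullCone₂) : g X ∈ nullCone₂ := by
  obtain ⟨h1, h2, h3, h4⟩ := h
  refine ⟨by rw [tr_map hg, h1], by rw [← map_cross hg, tr_map hg, h2], by rw [det_map hg, h3], ?_⟩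
  rwa [← map_cross hg, Ne, map_eq_zero_iff g g.injective]

end Automorphisms

/-! ### Characteristic roots -/

/-- The characteristic roots are determined by their elementary symmetric functions `tr X`,
`tr (X × X)` and `det X`. -/
theorem charRoots_eq_iff (X : J1) (a b c : ℂ) : charRoots X = {a, b, c} ↔
    a + b + c = tr X ∧ a * b + b * c + c * a = tr (cross X X) ∧ a * b * c = det X := by
  set P := (charPoly X).map (algebraMap ℝ ℂ) with hP
  have hP' : P = Polynomial.X ^ 3 - Polynomial.C (tr X : ℂ) * Polynomial.X ^ 2
      + Polynomial.C (tr (cross X X) : ℂ) * Polynomial.X - Polynomial.C (det X : ℂ) := by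
    simp [hP, charPoly]
  have hm : P.Monic := by
    rw [hP']
    monicity!
  have hroots : charRoots X = P.roots := rfl
  constructor
  · intro h
    have h1 : ∀ x, P.eval x = (x - a) * (x - b) * (x - c) := fun x => by
      rw [(IsAlgClosed.splits P).eval_eq_prod_roots_of_monic hm, ← hroots, h]
      simp [mul_assoc]
    have e0 := h1 0
    have e1 := h1 1
    have e2 := h1 (-1)
    simp [hP'] at e0 e1 e2
    refine ⟨?_, ?_, ?_⟩
    · linear_combination (e1 + e2) / 2 + e0
    · linear_combination (e2 - e1) / 2
    · linear_combination -e0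
  · rintro ⟨h1, h2, h3⟩
    have h : P = (({a, b, c} : Multiset ℂ).map fun r => Polynomial.X - Polynomial.C r).prod := by
      rw [hP', ← h1, ← h2, ← h3]
      simp
      ring
    rw [hroots, h, Polynomial.roots_multiset_prod_X_sub_C]

theorem charRoots_eq_real_iff (X : J1) (a b c : ℝ) : charRoots X = {(a : ℂ), (b : ℂ), (c : ℂ)} ↔
    a + b + c = tr X ∧ a * b + b * c + c * a = tr (cross X X) ∧ a * b * c = det X := by
  rw [charRoots_eq_iff]
  norm_cast

/-- The polynomial `Φ_X` has either three real roots, or a real root and two conjugate ones. -/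
theorem charRoots_cases (X : J1) :
    (∃ a b c : ℝ, charRoots X = {(a : ℂ), (b : ℂ), (c : ℂ)}) ∨
    (∃ l p q : ℝ, 0 < q ∧
      charRoots X = {(l : ℂ), (p : ℂ) + Complex.I * q, (p : ℂ) - Complex.I * q}) := by
  set S := tr X with hS
  set U := tr (cross X X) with hU
  set D := det X with hD
  obtain ⟨l, hl⟩ : ∃ l : ℝ, l ^ 3 - S * l ^ 2 + U * l - D = 0 := by
    have hc : Continuous fun l : ℝ => l ^ 3 - S * l ^ 2 + U * l - D := by fun_prop
    -- `Φ_X` changes sign on an interval that contains all the roots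
    set M := 1 + |S| + |U| + |D| with hM
    have hM1 : 1 ≤ M := by rw [hM]; linarith [abs_nonneg S, abs_nonneg U, abs_nonneg D]
    have hS1 : |S| * M ^ 2 + |U| * M ^ 2 + |D| * M ^ 2 = M ^ 3 - M ^ 2 := by
      rw [show |S| * M ^ 2 + |U| * M ^ 2 + |D| * M ^ 2 = (M - 1) * M ^ 2 by rw [hM]; ring]
      ring
    have hU1 : |U| * M ≤ |U| * M ^ 2 := mul_le_mul_of_nonneg_left (by nlinarith) (abs_nonneg U)
    have hD1 : |D| ≤ |D| * M ^ 2 := le_mul_of_one_le_right (abs_nonneg D) (by nlinarith)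
    have hS2 := abs_le.mp (le_refl |S * M ^ 2|)
    have hU2 := abs_le.mp (le_refl |U * M|)
    have hD2 := abs_le.mp (le_refl |D|)
    rw [abs_mul, abs_of_nonneg (sq_nonneg M)] at hS2
    rw [abs_mul, abs_of_nonneg (show 0 ≤ M by linarith)] at hU2
    exact mem_range_of_exists_le_of_exists_ge hc
      ⟨-M, by nlinarith [sq_nonneg M]⟩ ⟨M, by nlinarith [sq_nonneg M]⟩
  rcases lt_or_ge ((S - l) ^ 2 - 4 * (U - l * (S - l))) 0 with h | h
  · right
    have hs := Real.sq_sqrt (show 0 ≤ -((S - l) ^ 2 - 4 * (U - l * (S - l))) by linarith)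
    have hs0 := Real.sqrt_pos.mpr (show 0 < -((S - l) ^ 2 - 4 * (U - l * (S - l))) by linarith)
    set r := √(-((S - l) ^ 2 - 4 * (U - l * (S - l))))
    refine ⟨l, (S - l) / 2, r / 2, by positivity, ?_⟩
    have hs' : (r : ℂ) ^ 2 = -((S - l) ^ 2 - 4 * (U - l * (S - l))) := by exact_mod_cast hs
    have hl' : (l : ℂ) ^ 3 - S * l ^ 2 + U * l - D = 0 := by exact_mod_cast hl
    rw [charRoots_eq_iff]
    push_cast
    refine ⟨by ring, ?_, ?_⟩
    · linear_combination hs' / 4 - (r : ℂ) ^ 2 / 4 * Complex.I_sq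
    · linear_combination l * hs' / 4 - l * (r : ℂ) ^ 2 / 4 * Complex.I_sq + hl'
  · left
    have hs := Real.sq_sqrt h
    set r := √((S - l) ^ 2 - 4 * (U - l * (S - l)))
    refine ⟨l, (S - l + r) / 2, (S - l - r) / 2, ?_⟩
    rw [charRoots_eq_real_iff]
    refine ⟨by ring, ?_, ?_⟩
    · linear_combination -hs / 4
    · linear_combination -l * hs / 4 + hl

theorem SameOrbit.charRoots_eq {X Y : J1} (h : SameOrbit X Y) : charRoots X = charRoots Y := by
  obtain ⟨g, hg, rfl⟩ := h
  rw [charRoots_map hg]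

theorem tr_cross_h1 (a b c : ℝ) (x y z : Oct ℝ) :
    tr (cross (h1 a b c x y z) (h1 a b c x y z)) =
      a * b + b * c + c * a - dot x x + dot y y + dot z z := by
  rw [cross_h1, tr_h1]; ring

/-! ### The idempotent of a simple root -/

theorem smul_unitE_sub_h1 (l a b c : ℝ) (x y z : Oct ℝ) :
    l • unitE - h1 a b c x y z = h1 (l - a) (l - b) (l - c) (-x) (-y) (-z) := by
  rw [sub_eq_add_neg, ← neg_one_smul ℝ (h1 a b c x y z), unitE_eq_h1, smul_h1, smul_h1, h1_add]
  simp [sub_eq_add_neg]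

theorem tr_cross_smul_unitE_sub (l : ℝ) (X : J1) :
    tr (cross (l • unitE - X) (l • unitE - X)) = 3 * l ^ 2 - 2 * l * tr X + tr (cross X X) := by
  rw [← h1_coords X, smul_unitE_sub_h1, tr_cross_h1, tr_cross_h1, tr_h1]
  simp only [dot_neg_right, dot_comm (-_), neg_neg]
  ring

theorem det_smul_unitE_sub (l : ℝ) (X : J1) :
    det (l • unitE - X) = l ^ 3 - tr X * l ^ 2 + tr (cross X X) * l - det X := by
  rw [← eval_charPoly]
  simp [charPoly]

/-- The conditions under which `l` is a simple root of `Φ_X`. -/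
structure IsSimpleRoot (X : J1) (l : ℝ) : Prop where
  det_eq : det (l • unitE - X) = 0
  tr_ne : tr (cross (l • unitE - X) (l • unitE - X)) ≠ 0

theorem isSimpleRoot_of_charRoots {X : J1} {l : ℝ} {a b : ℂ} (h : charRoots X = {(l : ℂ), a, b})
    (ha : (l : ℂ) ≠ a) (hb : (l : ℂ) ≠ b) : IsSimpleRoot X l := by
  rw [charRoots_eq_iff] at h
  obtain ⟨h1, h2, h3⟩ := h
  constructor
  · rw [det_smul_unitE_sub, ← Complex.ofReal_inj]
    push_cast
    rw [← h1, ← h2, ← h3]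
    ring
  · rw [tr_cross_smul_unitE_sub, Ne, ← Complex.ofReal_inj]
    push_cast
    rw [← h1, ← h2, show 3 * (l : ℂ) ^ 2 - 2 * l * (l + a + b) + (l * a + a * b + b * l) =
      (l - a) * (l - b) by ring]
    exact mul_ne_zero (sub_ne_zero.mpr ha) (sub_ne_zero.mpr hb)

namespace IsSimpleRoot

variable {X : J1} {l : ℝ}

theorem cross_EX (h : IsSimpleRoot X l) : cross (EX X l) (EX X l) = 0 := by
  rw [EX, cross_smul_smul, cross_cross_self, h.det_eq, zero_smul, smul_zero]

theorem tr_EX (h : IsSimpleRoot X l) : tr (EX X l) = 1 := by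
  rw [EX, tr_smul, inv_mul_cancel₀ h.tr_ne]

theorem jordan_EX (h : IsSimpleRoot X l) : jordan X (EX X l) = l • EX X l := by
  have h1 : jordan (l • unitE - X) (EX X l) = 0 := by
    rw [EX, jordan_comm, jordan_smul_left, jordan_comm, jordan_cross_self, h.det_eq, zero_smul,
      smul_zero]
  rw [sub_eq_add_neg, ← neg_one_smul ℝ X, jordan_add_left, jordan_smul_left, jordan_smul_left,
    jordan_comm unitE, jordan_unitE, neg_one_smul ℝ (jordan _ _),
    add_neg_eq_zero] at h1
  exact h1.symm

theorem mem_or_mem (h : IsSimpleRoot X l) : EX X l ∈ hypPlane ∨ EX X l ∈ hypPlane' :=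
  mem_hypPlane_or_mem_hypPlane' h.cross_EX h.tr_EX

/-- If `E_{X,l}` is moved to `E₁`, then `X` becomes block diagonal with a definite `2 × 2` block,
which can be diagonalized. -/
theorem exists_diag (h : IsSimpleRoot X l) (hH : EX X l ∈ hypPlane) :
    ∃ b c, SameOrbit X (diag l b c) := by
  obtain ⟨g, hg, h1⟩ := sameOrbit_of_mem_hypPlane hH
  have h2 := congrArg g h.jordan_EX
  rw [map_jordan hg, map_smul, h1] at h2
  have h3 : SameOrbit X (g X) := ⟨g, hg, rfl⟩
  rw [← h1_coords (g X)] at h2 h3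
  rw [diag, jordan_h1, smul_h1, h1_inj] at h2
  simp at h2
  obtain ⟨h4, h5, h6⟩ := h2
  rw [h4, h5, h6] at h3
  obtain ⟨b, c, h7⟩ := exists_sameOrbit₁_diag l (dg 1 (g X)) (dg 2 (g X)) (off₁ (g X))
  exact ⟨b, c, h3.trans h7.sameOrbit⟩

/-- If `E_{X,l}` is moved to `E₃`, then `X` becomes block diagonal with an indefinite `2 × 2` block,
whose off-diagonal entry can be made real. -/
theorem exists_block (h : IsSimpleRoot X l) (hH : EX X l ∈ hypPlane') :
    ∃ p d t : ℝ, 0 ≤ t ∧ SameOrbit X (h1 (p + d) (p - d) l 0 0 (t • 1)) := by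
  obtain ⟨g, hg, h1⟩ := sameOrbit_of_mem_hypPlane' hH
  have h2 := congrArg g h.jordan_EX
  rw [map_jordan hg, map_smul, h1] at h2
  have h3 : SameOrbit X (g X) := ⟨g, hg, rfl⟩
  rw [← h1_coords (g X)] at h2 h3
  rw [diag, jordan_h1, smul_h1, h1_inj] at h2
  simp at h2
  obtain ⟨h4, h5, h6⟩ := h2
  rw [h4, h5, h6] at h3
  obtain ⟨t, y, ht, -, hy, h7⟩ :=
    exists_sameOrbit₁_off₃_real (dg 0 (g X)) (dg 1 (g X)) l 0 (off₃ (g X))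
  rw [hy rfl] at h7
  refine ⟨(dg 0 (g X) + dg 1 (g X)) / 2, (dg 0 (g X) - dg 1 (g X)) / 2, t, ht, ?_⟩
  have h8 := h3.trans h7.sameOrbit
  convert h8 using 2 <;> ring

end IsSimpleRoot

theorem EX_mem_minSpace (X : J1) (l : ℝ) : EX X l ∈ minSpace X := by
  have h : cross (l • unitE - X) (l • unitE - X) =
      cross X X + l • X + (l ^ 2 - l * tr X) • unitE := by
    rw [← h1_coords X, smul_unitE_sub_h1, cross_h1, cross_h1, smul_h1, unitE_eq_h1, smul_h1,
      h1_add, h1_add, h1_inj, tr_h1]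
    simp only [dot_neg_right, dot_comm (-_), neg_neg, smul_zero, add_zero, mul_one, neg_mul_neg]
    refine ⟨by ring, by ring, by ring, by module, by module, by module⟩
  rw [EX, h]
  generalize (tr _)⁻¹ = r
  exact ⟨r, r * l, r * (l ^ 2 - l * tr X), by module⟩

/-! ### The invariants of elements in block form -/

theorem EX_block_three {a b l : ℝ} {z : Oct ℝ} (h : (l - a) * (l - b) + dot z z ≠ 0) :
    EX (h1 a b l 0 0 z) l = diag 0 0 1 := by
  rw [EX, smul_unitE_sub_h1, cross_h1, diag, tr_h1, smul_h1, h1_inj]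
  simp [dot_neg_right, dot_comm (-z), h]

theorem EX_block_one {l b c : ℝ} {x : Oct ℝ} (h : (l - b) * (l - c) - dot x x ≠ 0) :
    EX (h1 l b c x 0 0) l = diag 1 0 0 := by
  rw [EX, smul_unitE_sub_h1, cross_h1, diag, tr_h1, smul_h1, h1_inj]
  simp [dot_neg_right, dot_comm (-x), h]

theorem EX_diag_two {a b c : ℝ} (ha : b ≠ a) (hc : b ≠ c) :
    EX (diag a b c) b = diag 0 1 0 := by
  have h : (b - c) * (b - a) ≠ 0 := mul_ne_zero (sub_ne_zero.mpr hc) (sub_ne_zero.mpr ha)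
  rw [EX, diag, smul_unitE_sub_h1, cross_h1, diag, tr_h1, smul_h1, h1_inj]
  simp
  field_simp [sub_ne_zero.mpr ha, sub_ne_zero.mpr hc]

theorem WX_block_three {a b l : ℝ} {z : Oct ℝ} (h : (l - a) * (l - b) + dot z z ≠ 0) :
    WX (h1 a b l 0 0 z) l = h1 ((a - b) / 2) ((b - a) / 2) 0 0 0 z := by
  have e : unitE - diag 0 0 1 = h1 1 1 0 0 0 0 := by
    have := smul_unitE_sub_h1 1 0 0 1 0 0 0
    simpa [diag] using this
  rw [WX, EX_block_three h, e, sub_eq_iff_eq_add, diag, smul_h1, smul_h1, h1_add, h1_add, h1_inj,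
    tr_h1]
  simp
  constructor <;> ring

theorem WX_block_one {l b c : ℝ} {x : Oct ℝ} (h : (l - b) * (l - c) - dot x x ≠ 0) :
    WX (h1 l b c x 0 0) l = h1 0 ((b - c) / 2) ((c - b) / 2) x 0 0 := by
  have e : unitE - diag 1 0 0 = h1 0 1 1 0 0 0 := by
    have := smul_unitE_sub_h1 1 1 0 0 0 0 0
    simpa [diag] using this
  rw [WX, EX_block_one h, e, sub_eq_iff_eq_add, diag, smul_h1, smul_h1, h1_add, h1_add, h1_inj,
    tr_h1]
  simp
  constructor <;> ring

theorem diag_one_mem_hypPlane : diag 1 0 0 ∈ hypPlane := E₁_mem_hypPlane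

theorem diag_two_mem_hypPlane' : diag 0 1 0 ∈ hypPlane' := by
  rw [mem_hypPlane'_iff, diag]
  simp [cross_h1, zero_eq_h1]

theorem diag_three_mem_hypPlane' : diag 0 0 1 ∈ hypPlane' := by
  rw [mem_hypPlane'_iff, diag]
  simp [cross_h1, zero_eq_h1]

theorem Pplus_mem : Pplus ∈ nullCone₁plus := by
  rw [mem_nullCone₁plus_iff, Pplus]
  simp [cross_h1, zero_eq_h1]

theorem Pminus_mem : Pminus ∈ nullCone₁minus := by
  rw [mem_nullCone₁minus_iff, Pminus]
  simp [cross_h1, zero_eq_h1]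

theorem cross_Qplus : cross (Qplus 1) (Qplus 1) = h1 (-1) 1 0 0 0 (1) := by
  rw [Qplus, cross_h1, h1_inj]
  simp

theorem Qplus_mem : Qplus 1 ∈ nullCone₂ := by
  refine ⟨?_, ?_, ?_, ?_⟩
  · simp [Qplus]
  · simp [cross_Qplus]
  · simp [Qplus, det_h1]
  · rw [cross_Qplus, zero_eq_h1, Ne, h1_inj]
    simp

/-! ### Transport along orbits -/

/-- Membership of an equivariantly defined element `f X` in an invariant set depends only on the
orbit of `X`. -/
theorem SameOrbit.iff_of_map {X Y : J1} (h : SameOrbit X Y) (f : J1 → J1) (s : Set J1)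
    (hf : ∀ g ∈ F4, ∀ X, g (f X) = f (g X)) (hs : ∀ g ∈ F4, ∀ X ∈ s, g X ∈ s) :
    f X ∈ s ↔ f Y ∈ s := by
  obtain ⟨g, hg, rfl⟩ := h
  rw [← hf g hg]
  refine ⟨hs g hg _, fun h => ?_⟩
  have := hs _ (F4.inv_mem hg) _ h
  rwa [show g⁻¹ (g (f X)) = f X from g.symm_apply_apply _] at this

namespace SameOrbit

variable {X Y : J1}

theorem EX_mem_hypPlane_iff (h : SameOrbit X Y) (l : ℝ) : EX X l ∈ hypPlane ↔ EX Y l ∈ hypPlane :=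
  h.iff_of_map (fun X => EX X l) _ (fun _ hg X => map_EX hg X l) fun _ hg _ => map_mem_hypPlane hg

theorem EX_mem_hypPlane'_iff (h : SameOrbit X Y) (l : ℝ) :
    EX X l ∈ hypPlane' ↔ EX Y l ∈ hypPlane' :=
  h.iff_of_map (fun X => EX X l) _ (fun _ hg X => map_EX hg X l) fun _ hg _ => map_mem_hypPlane' hg

theorem WX_mem_nullCone₁plus_iff (h : SameOrbit X Y) (l : ℝ) :
    WX X l ∈ nullCone₁plus ↔ WX Y l ∈ nullCone₁plus :=
  h.iff_of_map (fun X => WX X l) _ (fun _ hg X => map_WX hg X l)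
    fun _ hg _ => map_mem_nullCone₁plus hg

theorem WX_mem_nullCone₁minus_iff (h : SameOrbit X Y) (l : ℝ) :
    WX X l ∈ nullCone₁minus ↔ WX Y l ∈ nullCone₁minus :=
  h.iff_of_map (fun X => WX X l) _ (fun _ hg X => map_WX hg X l)
    fun _ hg _ => map_mem_nullCone₁minus hg

theorem WX_eq_zero_iff (h : SameOrbit X Y) (l : ℝ) : WX X l = 0 ↔ WX Y l = 0 :=
  h.iff_of_map (fun X => WX X l) {0} (fun _ hg X => map_WX hg X l) fun g _ X hX => by
    rw [Set.mem_singleton_iff.mp hX, map_zero, Set.mem_singleton_iff]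

theorem tr_eq (h : SameOrbit X Y) : tr X = tr Y := by
  obtain ⟨g, hg, rfl⟩ := h
  rw [tr_map hg]

theorem tr_cross_eq (h : SameOrbit X Y) : tr (cross X X) = tr (cross Y Y) := by
  obtain ⟨g, hg, rfl⟩ := h
  rw [← map_cross hg, tr_map hg]

theorem det_eq (h : SameOrbit X Y) : det X = det Y := by
  obtain ⟨g, hg, rfl⟩ := h
  rw [det_map hg]

end SameOrbit

/-! ### Three distinct real roots -/

/-- The space `V_X` of a diagonal element with distinct entries consists of the diagonal elements,
so its primitive idempotents are `E₁`, `E₂` and `E₃`. -/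
theorem inter_minSpace_diag {a b c : ℝ} (hab : a ≠ b) (hbc : b ≠ c) (hca : c ≠ a) {Y : J1}
    (h : Y ∈ minSpace (diag a b c)) :
    (Y ∈ hypPlane → Y = EX (diag a b c) a) ∧
      (Y ∈ hypPlane' → Y = EX (diag a b c) b ∨ Y = EX (diag a b c) c) := by
  obtain ⟨u, v, w, rfl⟩ : ∃ u v w, Y = diag u v w := by
    obtain ⟨p, q, r, rfl⟩ := h
    simp only [diag, unitE_eq_h1, cross_h1, smul_h1, h1_add]
    simp [h1_inj]
  have e1 : EX (diag a b c) a = diag 1 0 0 :=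
    EX_block_one (by simpa [sub_eq_zero] using ⟨hab, hca.symm⟩)
  have e2 : EX (diag a b c) b = diag 0 1 0 := EX_diag_two hab.symm hbc
  have e3 : EX (diag a b c) c = diag 0 0 1 :=
    EX_block_three (by simpa [sub_eq_zero] using ⟨hca, hbc.symm⟩)
  rw [e1, e2, e3, mem_hypPlane_iff, mem_hypPlane'_iff]
  simp only [diag, cross_h1, zero_eq_h1, h1_inj, tr_h1, dg_h1_zero]
  simp
  constructor
  · intro _ h2 h3 h4 h5
    have hu : u ≠ 0 := by linarith
    obtain rfl := h2.resolve_right hu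
    obtain rfl := h3.resolve_left hu
    exact ⟨by linarith, rfl, rfl⟩
  · intro h1 h2 h3 h4 h5
    have hu : u = 0 := by
      by_contra hu
      have := h2.resolve_right hu
      have := h3.resolve_left hu
      exact absurd h5 (by linarith)
    rcases h1 with h1 | h1
    · exact Or.inr ⟨hu, h1, by linarith⟩
    · exact Or.inl ⟨hu, by linarith, h1⟩

theorem inter_minSpace_of_sameOrbit {X : J1} {a b c : ℝ} (hab : a ≠ b) (hbc : b ≠ c) (hca : c ≠ a)
    (h : SameOrbit X (diag a b c)) : hypPlane ∩ minSpace X = {EX X a} ∧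
      hypPlane' ∩ minSpace X = {EX X b, EX X c} ∧ EX X b ≠ EX X c := by
  have e1 : EX (diag a b c) a = diag 1 0 0 :=
    EX_block_one (by simpa [sub_eq_zero] using ⟨hab, hca.symm⟩)
  have e2 : EX (diag a b c) b = diag 0 1 0 := EX_diag_two hab.symm hbc
  have e3 : EX (diag a b c) c = diag 0 0 1 :=
    EX_block_three (by simpa [sub_eq_zero] using ⟨hca, hbc.symm⟩)
  have m1 : EX X a ∈ hypPlane := by
    rw [h.EX_mem_hypPlane_iff, e1]; exact diag_one_mem_hypPlane
  have m2 : EX X b ∈ hypPlane' := by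
    rw [h.EX_mem_hypPlane'_iff, e2]; exact diag_two_mem_hypPlane'
  have m3 : EX X c ∈ hypPlane' := by
    rw [h.EX_mem_hypPlane'_iff, e3]; exact diag_three_mem_hypPlane'
  obtain ⟨g, hg, hgX⟩ := h
  have key : ∀ Y ∈ minSpace X, (Y ∈ hypPlane → Y = EX X a) ∧
      (Y ∈ hypPlane' → Y = EX X b ∨ Y = EX X c) := by
    intro Y hY
    have h1 := map_mem_minSpace hg hY
    rw [hgX] at h1
    have h2 := inter_minSpace_diag hab hbc hca h1
    rw [← hgX, ← map_EX hg, ← map_EX hg, ← map_EX hg, g.injective.eq_iff, g.injective.eq_iff,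
      g.injective.eq_iff] at h2
    exact ⟨fun h => h2.1 (map_mem_hypPlane hg h), fun h => h2.2 (map_mem_hypPlane' hg h)⟩
  refine ⟨?_, ?_, ?_⟩
  · ext Y
    refine ⟨fun h => (key Y h.2).1 h.1, ?_⟩
    rintro rfl
    exact ⟨m1, EX_mem_minSpace X a⟩
  · ext Y
    refine ⟨fun h => (key Y h.2).2 h.1, ?_⟩
    rintro (rfl | rfl)
    · exact ⟨m2, EX_mem_minSpace X b⟩
    · exact ⟨m3, EX_mem_minSpace X c⟩
  · intro h
    have := congrArg g h
    rw [map_EX hg, map_EX hg, hgX, e2, e3, diag, diag, h1_inj] at this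
    simp at this

theorem eq_or_eq_of_sum_of_prod {b c m n : ℝ} (h1 : b + c = m + n) (h2 : b * c = m * n) :
    (b = m ∧ c = n) ∨ (b = n ∧ c = m) := by
  have : (b - m) * (b - n) = 0 := by linear_combination b * h1 - h2
  rcases mul_eq_zero.mp this with h | h
  · exact Or.inl ⟨by linarith, by linarith⟩
  · exact Or.inr ⟨by linarith, by linarith⟩

/-- An element with three distinct real roots is diagonalizable. The order of the last two entries
does not matter, so only the first one has to be specified. -/
theorem exists_sameOrbit_diag {X : J1} {l m n : ℝ} (hlm : l ≠ m) (hln : l ≠ n) (hmn : m ≠ n)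
    (h : charRoots X = {(l : ℂ), (m : ℂ), (n : ℂ)}) :
    SameOrbit X (diag l m n) ∨ SameOrbit X (diag m n l) ∨ SameOrbit X (diag n l m) := by
  have hs := isSimpleRoot_of_charRoots h (by exact_mod_cast hlm) (by exact_mod_cast hln)
  obtain ⟨r1, r2, r3⟩ := (charRoots_eq_real_iff _ _ _ _).mp h
  rcases hs.mem_or_mem with hE | hE
  · obtain ⟨b, c, h1⟩ := hs.exists_diag hE
    rw [h1.tr_eq, diag, tr_h1] at r1
    rw [h1.tr_cross_eq, diag, tr_cross_h1] at r2
    simp at r2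
    have h2 : b + c = m + n := by linarith
    rcases eq_or_eq_of_sum_of_prod h2 (by linear_combination -r2 - l * h2) with
      ⟨rfl, rfl⟩ | ⟨rfl, rfl⟩
    · exact Or.inl h1
    · exact Or.inl (h1.trans (sameOrbit₁_diag_swap _ _ _).sameOrbit)
  · obtain ⟨p, d, t, ht, h1⟩ := hs.exists_block hE
    rw [h1.tr_eq, tr_h1] at r1
    rw [h1.tr_cross_eq, tr_cross_h1] at r2
    simp [dot_smul_left, dot_smul_right] at r2
    have hp : p = (m + n) / 2 := by linarith
    have hdt : d ^ 2 - t ^ 2 = ((m - n) / 2) ^ 2 := by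
      rw [hp] at r2
      linear_combination r2
    have hpos : 0 < ((m - n) / 2) ^ 2 := by
      have := sub_ne_zero.mpr hmn
      positivity
    obtain ⟨r, hr, -, h2⟩ := sameOrbit_diag_of_lt (p := p) (l := l) (show t ^ 2 < d ^ 2 by linarith)
    have h3 := h1.trans h2
    rw [hdt] at hr
    rcases sq_eq_sq_iff_eq_or_eq_neg.mp hr with rfl | rfl
    · rw [hp, show (m + n) / 2 + (m - n) / 2 = m by ring,
        show (m + n) / 2 - (m - n) / 2 = n by ring] at h3
      exact Or.inr (Or.inl h3)
    · rw [hp, show (m + n) / 2 + -((m - n) / 2) = n by ring,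
        show (m + n) / 2 - -((m - n) / 2) = m by ring] at h3
      exact Or.inr (Or.inr (h3.trans (sameOrbit₁_diag_swap _ _ _).sameOrbit))

theorem eq_of_mem_hypPlane_of_sameOrbit {X : J1} {l : Fin 3 → ℝ} (hl : Function.Injective l)
    {i j : Fin 3} (h : SameOrbit X (diag (l i) (l (i + 1)) (l (i + 2))))
    (hj : EX X (l j) ∈ hypPlane) : j = i := by
  have h3 : ∀ i : Fin 3, i ≠ i + 1 ∧ i + 1 ≠ i + 2 ∧ i + 2 ≠ i := by decide
  have h4 : ∀ i j : Fin 3, j = i ∨ j = i + 1 ∨ j = i + 2 := by decide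
  obtain ⟨-, h2, -⟩ := inter_minSpace_of_sameOrbit (hl.ne (h3 i).1) (hl.ne (h3 i).2.1)
    (hl.ne (h3 i).2.2) h
  rcases h4 i j with h5 | rfl | rfl
  · exact h5
  · have : EX X (l (i + 1)) ∈ hypPlane' ∩ minSpace X := by rw [h2]; exact Or.inl rfl
    exact (disjoint_hypPlane.le_bot ⟨hj, this.1⟩).elim
  · have : EX X (l (i + 2)) ∈ hypPlane' ∩ minSpace X := by rw [h2]; exact Or.inr rfl
    exact (disjoint_hypPlane.le_bot ⟨hj, this.1⟩).elim

theorem EX_mem_of_sameOrbit_diag {X : J1} {l : Fin 3 → ℝ} (hl : Function.Injective l)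
    {i : Fin 3} (h : SameOrbit X (diag (l i) (l (i + 1)) (l (i + 2)))) :
    EX X (l i) ∈ hypPlane := by
  have h3 : ∀ i : Fin 3, i ≠ i + 1 ∧ i + 1 ≠ i + 2 ∧ i + 2 ≠ i := by decide
  obtain ⟨h1, -, -⟩ := inter_minSpace_of_sameOrbit (hl.ne (h3 i).1) (hl.ne (h3 i).2.1)
    (hl.ne (h3 i).2.2) h
  have : EX X (l i) ∈ hypPlane ∩ minSpace X := by rw [h1]; rfl
  exact this.1

theorem injective_of_gt {l : Fin 3 → ℝ} (h01 : l 0 > l 1) (h12 : l 1 > l 2) :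
    Function.Injective l := by
  have : StrictAnti l := by
    rw [Fin.strictAnti_iff_succ_lt]
    intro i
    fin_cases i
    · exact h01
    · exact h12
  exact this.injective

theorem classification_three_real (X : J1) (l : Fin 3 → ℝ) (h01 : l 0 > l 1) (h12 : l 1 > l 2)
    (h : charRoots X = {(l 0 : ℂ), (l 1 : ℂ), (l 2 : ℂ)}) :
    (∃! i : Fin 3, hypPlane ∩ minSpace X = {EX X (l i)} ∧
      hypPlane' ∩ minSpace X = {EX X (l (i + 1)), EX X (l (i + 2))} ∧
      EX X (l (i + 1)) ≠ EX X (l (i + 2))) ∧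
    ∀ i : Fin 3, EX X (l i) ∈ hypPlane ↔ X ∈ orb (diag (l i) (l (i + 1)) (l (i + 2))) := by
  have hl := injective_of_gt h01 h12
  have h3 : ∀ i : Fin 3, i ≠ i + 1 ∧ i + 1 ≠ i + 2 ∧ i + 2 ≠ i := by decide
  obtain ⟨i, hi⟩ : ∃ i : Fin 3, SameOrbit X (diag (l i) (l (i + 1)) (l (i + 2))) := by
    rcases exists_sameOrbit_diag h01.ne' (h12.trans h01).ne' h12.ne' h with h | h | h
    · exact ⟨0, h⟩
    · exact ⟨1, h⟩
    · exact ⟨2, h⟩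
  refine ⟨⟨i, inter_minSpace_of_sameOrbit (hl.ne (h3 i).1) (hl.ne (h3 i).2.1)
    (hl.ne (h3 i).2.2) hi, ?_⟩, fun j => ?_⟩
  · rintro j ⟨hj, -, -⟩
    have : EX X (l j) ∈ hypPlane ∩ minSpace X := by rw [hj]; rfl
    exact eq_of_mem_hypPlane_of_sameOrbit hl hi this.1
  · rw [mem_orb_iff]
    refine ⟨fun hj => ?_, EX_mem_of_sameOrbit_diag hl⟩
    rwa [eq_of_mem_hypPlane_of_sameOrbit hl hi hj]

/-! ### A pair of complex conjugate roots -/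

theorem dot_smul_one (t : ℝ) : dot (t • 1) (t • 1) = t ^ 2 := by
  rw [dot_smul_left, dot_smul_right, dot_one_one]; ring

theorem charRoots_eq_complex_iff (X : J1) (l p q : ℝ) :
    charRoots X = {(l : ℂ), (p : ℂ) + Complex.I * q, (p : ℂ) - Complex.I * q} ↔
      l + 2 * p = tr X ∧ 2 * (l * p) + (p ^ 2 + q ^ 2) = tr (cross X X) ∧
        l * (p ^ 2 + q ^ 2) = det X := by
  have e : ((p : ℂ) + Complex.I * q) * (p - Complex.I * q) = p ^ 2 + q ^ 2 := by
    linear_combination -(q : ℂ) ^ 2 * Complex.I_sq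
  have e1 : (l : ℂ) + (p + Complex.I * q) + (p - Complex.I * q) = ((l + 2 * p : ℝ) : ℂ) := by
    push_cast; ring
  have e2 : (l : ℂ) * (p + Complex.I * q) + (p + Complex.I * q) * (p - Complex.I * q) +
      (p - Complex.I * q) * l = ((2 * (l * p) + (p ^ 2 + q ^ 2) : ℝ) : ℂ) := by
    push_cast; linear_combination e
  have e3 : (l : ℂ) * (p + Complex.I * q) * (p - Complex.I * q) =
      ((l * (p ^ 2 + q ^ 2) : ℝ) : ℂ) := by
    push_cast; linear_combination l * e
  rw [charRoots_eq_iff, e1, e2, e3]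
  norm_cast

theorem diag_add_F₃ (l p q : ℝ) : diag p p l + F₃ (q • 1) = h1 p p l 0 0 (q • 1) := by
  simp [diag, F₃, h1_add]

theorem sameOrbit_of_complex_root {X : J1} {l p q : ℝ} (hq : 0 < q)
    (h : charRoots X = {(l : ℂ), (p : ℂ) + Complex.I * q, (p : ℂ) - Complex.I * q}) :
    SameOrbit X (diag p p l + F₃ (q • 1)) := by
  have hs : IsSimpleRoot X l := by
    refine isSimpleRoot_of_charRoots h (fun e => ?_) fun e => ?_
    · have := congrArg Complex.im e
      simp at this
      exact hq.ne this
    · have := congrArg Complex.im e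
      simp at this
      exact hq.ne' this
  obtain ⟨r1, r2, r3⟩ := (charRoots_eq_complex_iff _ _ _ _).mp h
  rcases hs.mem_or_mem with hE | hE
  · -- a diagonal element has real roots
    obtain ⟨b, c, h1⟩ := hs.exists_diag hE
    rw [h1.tr_eq, diag, tr_h1] at r1
    rw [h1.tr_cross_eq, diag, tr_cross_h1] at r2
    simp at r2
    have hp : p = (b + c) / 2 := by linarith
    rw [hp] at r2
    nlinarith [sq_nonneg (b - c), sq_pos_of_pos hq]
  · obtain ⟨p', d, t, ht, h1⟩ := hs.exists_block hE
    rw [h1.tr_eq, tr_h1] at r1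
    rw [h1.tr_cross_eq, tr_cross_h1, dot_smul_one, dot_zero_left] at r2
    obtain rfl : p' = p := by linarith
    have hdt : t ^ 2 - d ^ 2 = q ^ 2 := by linear_combination -r2
    have hq2 := sq_pos_of_pos hq
    obtain ⟨q', hq', h2⟩ := sameOrbit_complex_of_lt (p := p') (l := l) ht
      (show d ^ 2 < t ^ 2 by linarith)
    have r4 := h2.tr_cross_eq
    rw [tr_cross_h1, tr_cross_h1, dot_smul_one, dot_smul_one] at r4
    obtain rfl : q = q' := by
      have : q ^ 2 = q' ^ 2 := by linear_combination r4 - hdt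
      exact (pow_left_inj₀ hq.le hq'.le two_ne_zero).mp this
    rw [diag_add_F₃]
    exact h1.trans h2

/-! ### A simple and a double root -/

theorem diag_add_Pplus (m l : ℝ) : diag m m l + Pplus = h1 (m + 1) (m - 1) l 0 0 1 := by
  simp [diag, Pplus, h1_add, sub_eq_add_neg]

theorem diag_add_Pminus (m l : ℝ) : diag m m l + Pminus = h1 (m + -1) (m - -1) l 0 0 1 := by
  simp [diag, Pminus, h1_add]

theorem sameOrbit_of_double_root {X : J1} {l m : ℝ} (hlm : l ≠ m)
    (h : charRoots X = {(l : ℂ), (m : ℂ), (m : ℂ)}) :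
    SameOrbit X (diag l m m) ∨ SameOrbit X (diag m m l) ∨ SameOrbit X (diag m m l + Pplus) ∨
      SameOrbit X (diag m m l + Pminus) := by
  have hs := isSimpleRoot_of_charRoots h (by exact_mod_cast hlm) (by exact_mod_cast hlm)
  obtain ⟨r1, r2, r3⟩ := (charRoots_eq_real_iff _ _ _ _).mp h
  rcases hs.mem_or_mem with hE | hE
  · obtain ⟨b, c, h1⟩ := hs.exists_diag hE
    rw [h1.tr_eq, diag, tr_h1] at r1
    rw [h1.tr_cross_eq, diag, tr_cross_h1] at r2
    simp at r2
    have h2 : b + c = m + m := by linarith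
    rcases eq_or_eq_of_sum_of_prod h2 (by linear_combination -r2 - l * h2) with
      ⟨rfl, rfl⟩ | ⟨rfl, rfl⟩
    · exact Or.inl h1
    · exact Or.inl h1
  · right
    obtain ⟨p, d, t, ht, h1⟩ := hs.exists_block hE
    rw [h1.tr_eq, tr_h1] at r1
    rw [h1.tr_cross_eq, tr_cross_h1, dot_smul_one, dot_zero_left] at r2
    obtain rfl : p = m := by linarith
    have hdt : d ^ 2 = t ^ 2 := by linear_combination r2
    rcases ht.eq_or_lt with rfl | ht
    · obtain rfl : d = 0 := by simpa using hdt
      left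
      simpa [diag] using h1
    · right
      rw [diag_add_Pplus, diag_add_Pminus]
      rcases sq_eq_sq_iff_eq_or_eq_neg.mp hdt with hd | hd
      · exact Or.inl (h1.trans (sameOrbit_null p l ht (ε := 1) (by norm_num) (by linarith)))
      · exact Or.inr (h1.trans (sameOrbit_null p l ht (ε := -1) (by norm_num) (by linarith)))

theorem not_mem_nullCone₁_zero : (0 : J1) ∉ nullCone₁plus ∧ (0 : J1) ∉ nullCone₁minus := by
  rw [mem_nullCone₁plus_iff, mem_nullCone₁minus_iff]
  simp [dg]

theorem disjoint_nullCone₁ : Disjoint nullCone₁plus nullCone₁minus := by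
  rw [Set.disjoint_left]
  intro X h h'
  linarith [(mem_nullCone₁plus_iff.mp h).2.2, (mem_nullCone₁minus_iff.mp h').2.2]

theorem invariants_diag_one {X : J1} {l m : ℝ} (hlm : l ≠ m) (h : SameOrbit X (diag l m m)) :
    EX X l ∈ hypPlane ∧ WX X l = 0 := by
  have h0 : (l - m) * (l - m) - dot 0 0 ≠ 0 := by simpa [sub_eq_zero] using hlm
  rw [h.EX_mem_hypPlane_iff, h.WX_eq_zero_iff, diag, EX_block_one h0, WX_block_one h0]
  exact ⟨diag_one_mem_hypPlane, by simp [zero_eq_h1]⟩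

theorem invariants_diag_three {X : J1} {l m : ℝ} (hlm : l ≠ m) (h : SameOrbit X (diag m m l)) :
    EX X l ∈ hypPlane' ∧ WX X l = 0 := by
  have h0 : (l - m) * (l - m) + dot 0 0 ≠ 0 := by simpa [sub_eq_zero] using hlm
  rw [h.EX_mem_hypPlane'_iff, h.WX_eq_zero_iff, diag, EX_block_three h0, WX_block_three h0]
  exact ⟨diag_three_mem_hypPlane', by simp [zero_eq_h1]⟩

theorem invariants_diag_add_Pplus {X : J1} {l m : ℝ} (hlm : l ≠ m)
    (h : SameOrbit X (diag m m l + Pplus)) :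
    EX X l ∈ hypPlane' ∧ WX X l ∈ nullCone₁plus := by
  have h0 : (l - (m + 1)) * (l - (m - 1)) + dot 1 1 ≠ 0 := by
    rw [dot_one_one, show (l - (m + 1)) * (l - (m - 1)) + 1 = (l - m) ^ 2 by ring]
    exact pow_ne_zero 2 (sub_ne_zero.mpr hlm)
  rw [h.EX_mem_hypPlane'_iff, h.WX_mem_nullCone₁plus_iff, diag_add_Pplus, EX_block_three h0,
    WX_block_three h0]
  refine ⟨diag_three_mem_hypPlane', ?_⟩
  convert Pplus_mem using 1
  rw [Pplus, h1_inj]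
  refine ⟨by ring, by ring, rfl, rfl, rfl, rfl⟩

theorem invariants_diag_add_Pminus {X : J1} {l m : ℝ} (hlm : l ≠ m)
    (h : SameOrbit X (diag m m l + Pminus)) :
    EX X l ∈ hypPlane' ∧ WX X l ∈ nullCone₁minus := by
  have h0 : (l - (m + -1)) * (l - (m - -1)) + dot 1 1 ≠ 0 := by
    rw [dot_one_one, show (l - (m + -1)) * (l - (m - -1)) + 1 = (l - m) ^ 2 by ring]
    exact pow_ne_zero 2 (sub_ne_zero.mpr hlm)
  rw [h.EX_mem_hypPlane'_iff, h.WX_mem_nullCone₁minus_iff, diag_add_Pminus, EX_block_three h0,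
    WX_block_three h0]
  refine ⟨diag_three_mem_hypPlane', ?_⟩
  convert Pminus_mem using 1
  rw [Pminus, h1_inj]
  refine ⟨by ring, by ring, rfl, rfl, rfl, rfl⟩

theorem classification_double_root (X : J1) (l m : ℝ) (hlm : l ≠ m)
    (h : charRoots X = {(l : ℂ), (m : ℂ), (m : ℂ)}) :
    EX X l ∈ hypPlane ∪ hypPlane' ∧
    WX X l ∈ {0} ∪ nullCone₁plus ∪ nullCone₁minus ∧
    (EX X l ∈ hypPlane → WX X l = 0) ∧
    (WX X l ≠ 0 → EX X l ∈ hypPlane') ∧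
    (EX X l ∈ hypPlane ↔ X ∈ orb (diag l m m)) ∧
    (EX X l ∈ hypPlane' ∧ WX X l = 0 ↔ X ∈ orb (diag m m l)) ∧
    (WX X l ∈ nullCone₁plus ↔ X ∈ orb (diag m m l + Pplus)) ∧
    (WX X l ∈ nullCone₁minus ↔ X ∈ orb (diag m m l + Pminus)) := by
  simp only [mem_orb_iff]
  have i1 := invariants_diag_one (X := X) hlm
  have i2 := invariants_diag_three (X := X) hlm
  have i3 := invariants_diag_add_Pplus (X := X) hlm
  have i4 := invariants_diag_add_Pminus (X := X) hlm
  have d1 : ¬ (EX X l ∈ hypPlane ∧ EX X l ∈ hypPlane') := fun h => disjoint_hypPlane.le_bot h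
  have d2 : WX X l = 0 → WX X l ∉ nullCone₁plus ∧ WX X l ∉ nullCone₁minus := fun h => by
    rw [h]; exact not_mem_nullCone₁_zero
  have d3 : ¬ (WX X l ∈ nullCone₁plus ∧ WX X l ∈ nullCone₁minus) :=
    fun h => disjoint_nullCone₁.le_bot h
  have c := sameOrbit_of_double_root hlm h
  simp only [Set.mem_union, Set.mem_singleton_iff, ne_eq]
  generalize (EX X l ∈ hypPlane) = p₁, (EX X l ∈ hypPlane') = p₂, (WX X l = 0) = p₃,
    (WX X l ∈ nullCone₁plus) = p₄, (WX X l ∈ nullCone₁minus) = p₅ at *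
  grind

/-! ### A triple root -/

/-- Every octonion is orthogonal to an imaginary unit, even to one in the span of `e₁` and `e₂`. -/
theorem exists_imaginary_unit (x : Oct ℝ) :
    ∃ a : Oct ℝ, dot a a = 1 ∧ a.c 0 = 0 ∧ dot a x = 0 := by
  by_cases h : x.c 1 ^ 2 + x.c 2 ^ 2 = 0
  · have h1 : x.c 1 = 0 := by nlinarith [sq_nonneg (x.c 1), sq_nonneg (x.c 2)]
    refine ⟨e ℝ 1, ?_, ?_, ?_⟩ <;> simp [dot, h1]
  · have h0 : 0 < x.c 1 ^ 2 + x.c 2 ^ 2 := lt_of_le_of_ne (by positivity) (Ne.symm h)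
    have hs := Real.sq_sqrt h0.le
    have hs0 := Real.sqrt_pos.mpr h0
    set r := √(x.c 1 ^ 2 + x.c 2 ^ 2)
    refine ⟨r⁻¹ • (x.c 2 • e ℝ 1 - x.c 1 • e ℝ 2), ?_, ?_, ?_⟩
    · simp [dot, Fin.sum_univ_eight]
      field_simp
      linarith
    · simp
    · simp [dot, Fin.sum_univ_eight]
      ring

theorem star_eq_neg_of_imaginary {a : Oct ℝ} (h : a.c 0 = 0) : star a = -a := by
  ext k : 2
  by_cases hk : k = 0
  · subst hk; simp [h]
  · simp [hk]

/-- The stabilizer of a real `x₃` moves a unit octonion `x₁` to `1`: for imaginary units `u` and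
`v = -ux`, the triality triples of `u` and `v` combine to one that fixes `1` in the third place and
maps `x` to `v(ux) = 1` in the first. -/
theorem sameOrbit₁_stabilizer (a b c t : ℝ) {x : Oct ℝ} (hx : dot x x = 1) :
    SameOrbit₁ (h1 a b c x (star x) (t • 1)) (h1 a b c 1 1 (t • 1)) := by
  obtain ⟨u, hu, hu0, hux⟩ := exists_imaginary_unit (star x)
  set v := -(u * x) with hv
  have hv1 : dot v v = 1 := by
    rw [hv, dot_neg_right, dot_comm (-_), dot_neg_right, neg_neg, dot_mul_left, hu, hx, one_mul]
  have hv0 : v.c 0 = 0 := by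
    have := mul_star_c_zero u (star x)
    rw [star_star] at this
    rw [hv, Oct.neg_apply, this, hux, neg_zero]
  have sq : ∀ w : Oct ℝ, dot w w = 1 → w.c 0 = 0 → star w * star w = -1 := fun w h h0 => by
    have h1 := star_mul_self w
    rw [h, one_smul] at h1
    nth_rewrite 2 [star_eq_neg_of_imaginary h0]
    rw [mul_neg, h1]
  have s1 := sameOrbit₁_of_isTriality (isTriality_mul u hu) a b c x (star x) (t • 1)
  have s2 := s1.trans (sameOrbit₁_of_isTriality (isTriality_mul v hv1) a b c _ _ _)
  simp only [lmul_apply, rmul_apply, bmul_apply, mul_smul_oct, smul_mul_oct, mul_one] at s2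
  have hx1 : v * (u * x) = 1 := by
    have h1 := star_mul_self v
    rw [hv1, one_smul, star_eq_neg_of_imaginary hv0, hv, neg_neg] at h1
    rw [hv]
    simpa using h1
  have hy1 : (star x * u) * v = 1 := by
    have h1 := congrArg star hx1
    rw [star_mul, star_mul, star_eq_neg_of_imaginary hu0, star_eq_neg_of_imaginary hv0] at h1
    simpa using h1
  rw [hx1, hy1, sq u hu hu0, mul_neg, mul_one, neg_mul, sq v hv1 hv0, neg_neg] at s2
  exact s2

/-- If `X ∈ N₂(𝐎)`, then `Z = X × X` is a nonzero null vector with `X ∘ Z = 0`, and once `Z` has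
been moved to `P⁺` or `P⁻`, this equation and `Z = X × X` determine `X` up to a unit octonion and
a real parameter. -/
theorem sameOrbit_Qplus {X : J1} (h : X ∈ nullCone₂) : SameOrbit X (Qplus 1) := by
  obtain ⟨h1, h2, h3, h4⟩ := h
  have hZ : cross (cross X X) (cross X X) = 0 := by rw [cross_cross_self, h3, zero_smul]
  have hJ : jordan X (cross X X) = 0 := by rw [jordan_cross_self, h3, zero_smul]
  obtain ⟨ε, hε, g, hg, hgX⟩ : ∃ ε : ℝ, (ε = 1 ∨ ε = -1) ∧
      SameOrbit (cross X X) (ExcJordan.h1 ε (-ε) 0 0 0 1) := by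
    rcases eq_zero_or_mem_nullCone₁ hZ h2 with h | h | h
    · exact absurd h h4
    · exact ⟨1, Or.inl rfl, sameOrbit_of_mem_nullCone₁plus h⟩
    · refine ⟨-1, Or.inr rfl, ?_⟩
      rw [neg_neg]
      exact sameOrbit_of_mem_nullCone₁minus h
  have hX : SameOrbit X (g X) := ⟨g, hg, rfl⟩
  have hJ' := congrArg g hJ
  rw [map_jordan hg, hgX, map_zero] at hJ'
  rw [map_cross hg] at hgX
  have ht := hX.tr_eq
  rw [h1] at ht
  rw [← h1_coords (g X)] at hJ' hgX hX ht
  generalize dg 0 (g X) = a, dg 1 (g X) = b, dg 2 (g X) = c, off₁ (g X) = x, off₂ (g X) = y,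
    off₃ (g X) = z at hJ' hgX hX ht
  rw [jordan_h1, zero_eq_h1, h1_inj] at hJ'
  rw [cross_h1, h1_inj] at hgX
  rw [tr_h1] at ht
  have hdz : dot z 1 = z.c 0 := by simp [dot]
  obtain ⟨j1, j2, -, j3, -, j4⟩ := hJ'
  obtain ⟨k1, k2, k3, -, -, -⟩ := hgX
  simp [hdz] at j1 j2 j3 j4
  have hab : a + b = 0 := by
    refine j4.resolve_right fun h => ?_
    simpa using congrArg (fun x : Oct ℝ => x.c 0) h
  obtain rfl : c = 0 := by linarith
  -- the first diagonal entry of `X × X` is `-(x|x)`, so that `P⁺` is impossible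
  obtain rfl : ε = -1 := hε.resolve_left (by linarith [dot_self_nonneg x])
  obtain rfl : y = star x := by
    rw [neg_one_smul ℝ x, neg_neg, sub_eq_zero] at j3
    rw [j3, star_star]
  obtain rfl : z = b • 1 := by
    have e : dot (z - b • 1) (z - b • 1) = 0 := by
      rw [dot_sub_left, dot_sub_right, dot_sub_right, dot_smul_one, dot_smul_right, dot_smul_left,
        dot_comm 1, hdz]
      linear_combination k3 - b * hab + 2 * b * j2
    exact sub_eq_zero.mp (dot_self_eq_zero.mp e)
  obtain rfl : a = -b := by linarith
  exact (hX.trans (sameOrbit₁_stabilizer (-b) b 0 b (by linarith)).sameOrbit).trans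
    (sameOrbit_nullRotation b)

theorem SameOrbit.iff_tracelessPart_mem {X Y : J1} (h : SameOrbit X Y) (s : Set J1)
    (hs : ∀ g ∈ F4, ∀ X ∈ s, g X ∈ s) : tracelessPart X ∈ s ↔ tracelessPart Y ∈ s :=
  h.iff_of_map tracelessPart s (fun _ hg X => map_tracelessPart hg X) hs

theorem tracelessPart_smul_add {P : J1} (r : ℝ) (hP : tr P = 0) :
    tracelessPart (r • unitE + P) = P := by
  rw [tracelessPart, tr_add, tr_smul, tr_unitE, hP]
  module

theorem sameOrbit_smul_add {X P : J1} (h : SameOrbit (tracelessPart X) P) :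
    SameOrbit X ((3⁻¹ * tr X) • unitE + P) := by
  obtain ⟨g, hg, rfl⟩ := h
  refine ⟨g, hg, ?_⟩
  conv_lhs => rw [show X = (3⁻¹ * tr X) • unitE + tracelessPart X by rw [tracelessPart]; module]
  rw [map_add, map_smul, map_unitE hg]

theorem tracelessPart_mem_of_triple_root {X : J1} {l : ℝ}
    (h : charRoots X = {(l : ℂ), (l : ℂ), (l : ℂ)}) :
    tracelessPart X = 0 ∨ tracelessPart X ∈ nullCone₁plus ∨ tracelessPart X ∈ nullCone₁minus ∨
      tracelessPart X ∈ nullCone₂ := by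
  obtain ⟨r1, r2, r3⟩ := (charRoots_eq_real_iff _ _ _ _).mp h
  have hl : 3⁻¹ * tr X = l := by linarith
  have e : tracelessPart X = (-1 : ℝ) • (l • unitE - X) := by
    rw [tracelessPart, hl]; module
  have t1 : tr (tracelessPart X) = 0 := by
    rw [tracelessPart, sub_eq_add_neg, tr_add, tr_neg, tr_smul, tr_unitE]; ring
  have c1 : cross (tracelessPart X) (tracelessPart X) =
      cross (l • unitE - X) (l • unitE - X) := by
    rw [e, cross_smul_smul]; simp
  have t2 : tr (cross (tracelessPart X) (tracelessPart X)) = 0 := by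
    rw [c1, tr_cross_smul_unitE_sub, ← r1, ← r2]; ring
  have t3 : det (tracelessPart X) = 0 := by
    have h0 : det (l • unitE - X) = 0 := by
      rw [det_smul_unitE_sub, ← r1, ← r2, ← r3]; ring
    rw [det, ip, c1, e, jordan_smul_left, jordan_cross_self, h0, zero_smul, smul_zero]
    simp [tr]
  by_cases h0 : cross (tracelessPart X) (tracelessPart X) = 0
  · have := eq_zero_or_mem_nullCone₁ h0 t1
    tauto
  · exact Or.inr (Or.inr (Or.inr ⟨t1, t2, t3, h0⟩))

theorem not_mem_nullCone₂_of_cross {X : J1} (h : cross X X = 0) : X ∉ nullCone₂ :=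
  fun h' => h'.2.2.2 h

theorem classification_triple_root {X : J1} {l : ℝ}
    (h : charRoots X = {(l : ℂ), (l : ℂ), (l : ℂ)}) :
    tracelessPart X ∈ {0} ∪ nullCone₁plus ∪ nullCone₁minus ∪ nullCone₂ ∧
    (tracelessPart X = 0 ↔ X ∈ orb ((3⁻¹ * tr X) • unitE)) ∧
    (tracelessPart X ∈ nullCone₁plus ↔ X ∈ orb ((3⁻¹ * tr X) • unitE + Pplus)) ∧
    (tracelessPart X ∈ nullCone₁minus ↔ X ∈ orb ((3⁻¹ * tr X) • unitE + Pminus)) ∧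
    (tracelessPart X ∈ nullCone₂ ↔ X ∈ orb ((3⁻¹ * tr X) • unitE + Qplus 1)) := by
  simp only [mem_orb_iff]
  refine ⟨?_, ⟨fun h0 => ?_, fun h0 => ?_⟩, ⟨fun h0 => ?_, fun h0 => ?_⟩,
    ⟨fun h0 => ?_, fun h0 => ?_⟩, ⟨fun h0 => ?_, fun h0 => ?_⟩⟩
  · have := tracelessPart_mem_of_triple_root h
    simp only [Set.mem_union, Set.mem_singleton_iff]
    tauto
  · have := sameOrbit_smul_add (X := X) (P := 0) (by rw [h0]; exact SameOrbit.refl 0)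
    rwa [add_zero] at this
  · have := tracelessPart_smul_add (P := 0) (3⁻¹ * tr X) (by simp [tr])
    rw [← Set.mem_singleton_iff, h0.iff_tracelessPart_mem {0} fun g _ X hX => by
      rw [Set.mem_singleton_iff.mp hX, map_zero, Set.mem_singleton_iff]]
    rw [add_zero] at this
    rw [this, Set.mem_singleton_iff]
  · exact sameOrbit_smul_add (sameOrbit_of_mem_nullCone₁plus h0)
  · rw [h0.iff_tracelessPart_mem _ fun _ hg _ => map_mem_nullCone₁plus hg,
      tracelessPart_smul_add _ Pplus_mem.2.1]
    exact Pplus_mem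
  · exact sameOrbit_smul_add (sameOrbit_of_mem_nullCone₁minus h0)
  · rw [h0.iff_tracelessPart_mem _ fun _ hg _ => map_mem_nullCone₁minus hg,
      tracelessPart_smul_add _ Pminus_mem.2.1]
    exact Pminus_mem
  · exact sameOrbit_smul_add (sameOrbit_Qplus h0)
  · rw [h0.iff_tracelessPart_mem _ fun _ hg _ => map_mem_nullCone₂ hg,
      tracelessPart_smul_add _ Qplus_mem.1]
    exact Qplus_mem

/-! ### Every element has a canonical form -/

theorem exists_sorted (a b c : ℝ) : ∃ x y z : ℝ, x ≥ y ∧ y ≥ z ∧ x + y + z = a + b + c ∧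
    x * y + y * z + z * x = a * b + b * c + c * a ∧ x * y * z = a * b * c := by
  have : a ≥ b ∧ b ≥ c ∨ a ≥ c ∧ c ≥ b ∨ b ≥ a ∧ a ≥ c ∨ b ≥ c ∧ c ≥ a ∨ c ≥ a ∧ a ≥ b ∨
      c ≥ b ∧ b ≥ a := by
    grind
  rcases this with h | h | h | h | h | h
  · exact ⟨_, _, _, h.1, h.2, by ring, by ring, by ring⟩
  · exact ⟨_, _, _, h.1, h.2, by ring, by ring, by ring⟩
  · exact ⟨_, _, _, h.1, h.2, by ring, by ring, by ring⟩
  · exact ⟨_, _, _, h.1, h.2, by ring, by ring, by ring⟩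
  · exact ⟨_, _, _, h.1, h.2, by ring, by ring, by ring⟩
  · exact ⟨_, _, _, h.1, h.2, by ring, by ring, by ring⟩

theorem exists_canonicalForm_of_double_root {X : J1} {l m : ℝ} (hlm : l ≠ m)
    (h : charRoots X = {(l : ℂ), (m : ℂ), (m : ℂ)}) : ∃ c : CanonicalForm, X ∈ orb c.elt := by
  simp only [mem_orb_iff]
  rcases sameOrbit_of_double_root hlm h with h | h | h | h
  · exact ⟨.c5 l m hlm, h⟩
  · exact ⟨.c6 l m hlm, h⟩
  · exact ⟨.c7 l m hlm, h⟩
  · exact ⟨.c8 l m hlm, h⟩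

theorem exists_canonicalForm (X : J1) : ∃ c : CanonicalForm, X ∈ orb c.elt := by
  rcases charRoots_cases X with ⟨a, b, c, h⟩ | ⟨l, p, q, hq, h⟩
  · rw [charRoots_eq_real_iff] at h
    obtain ⟨x, y, z, hxy, hyz, e1, e2, e3⟩ := exists_sorted a b c
    rw [← e1, ← e2, ← e3] at h
    rcases hxy.eq_or_lt with rfl | hxy
    · rcases hyz.eq_or_lt with rfl | hyz
      · have h' := (charRoots_eq_real_iff X _ _ _).mpr h
        obtain ⟨h0, h1, h2, h3, h4⟩ := classification_triple_root h'
        rcases tracelessPart_mem_of_triple_root h' with h | h | h | h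
        · exact ⟨.c9 _, h1.mp h⟩
        · exact ⟨.c10 _, h2.mp h⟩
        · exact ⟨.c11 _, h3.mp h⟩
        · exact ⟨.c12 _, h4.mp h⟩
      · refine exists_canonicalForm_of_double_root (X := X) hyz.ne
          ((charRoots_eq_real_iff X _ _ _).mpr ⟨?_, ?_, ?_⟩)
        · linear_combination h.1
        · linear_combination h.2.1
        · linear_combination h.2.2
    · rcases hyz.eq_or_lt with rfl | hyz
      · exact exists_canonicalForm_of_double_root hxy.ne' ((charRoots_eq_real_iff X _ _ _).mpr h)
      · simp only [mem_orb_iff]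
        rcases exists_sameOrbit_diag hxy.ne' (hyz.trans hxy).ne' hyz.ne'
          ((charRoots_eq_real_iff X _ _ _).mpr h) with h | h | h
        · exact ⟨.c1 x y z hxy hyz, h⟩
        · exact ⟨.c2 x y z hxy hyz, h⟩
        · exact ⟨.c3 x y z hxy hyz, h⟩
  · exact ⟨.c4 l p q hq, mem_orb_iff.mpr (sameOrbit_of_complex_root hq h)⟩

/-! ### Canonical forms are pairwise not conjugate -/

/-- The characteristic roots of a canonical form. -/
def CanonicalForm.roots : CanonicalForm → Multiset ℂ
  | c1 l₁ l₂ l₃ _ _ | c2 l₁ l₂ l₃ _ _ | c3 l₁ l₂ l₃ _ _ => {(l₁ : ℂ), (l₂ : ℂ), (l₃ : ℂ)}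
  | c4 l₁ p q _ => {(l₁ : ℂ), (p : ℂ) + Complex.I * q, (p : ℂ) - Complex.I * q}
  | c5 l₁ l₂ _ | c6 l₁ l₂ _ | c7 l₁ l₂ _ | c8 l₁ l₂ _ => {(l₁ : ℂ), (l₂ : ℂ), (l₂ : ℂ)}
  | c9 r | c10 r | c11 r | c12 r => {(r : ℂ), (r : ℂ), (r : ℂ)}

theorem CanonicalForm.charRoots_elt (c : CanonicalForm) : charRoots c.elt = c.roots := by
  cases c
  case c4 l p q hq =>
    simp only [elt, roots]
    rw [charRoots_eq_complex_iff, diag_add_F₃, tr_h1, tr_cross_h1, det_h1, dot_smul_one]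
    simp
    refine ⟨?_, ?_, ?_⟩ <;> ring
  all_goals
    simp only [elt, roots]
    rw [charRoots_eq_real_iff]
    simp only [diag, unitE_eq_h1, Pplus, Pminus, Qplus, smul_h1, h1_add, tr_h1, tr_cross_h1, det_h1]
    simp
    try (refine ⟨?_, ?_, ?_⟩ <;> ring)

theorem CanonicalForm.roots_eq {c c' : CanonicalForm} (h : SameOrbit c.elt c'.elt) :
    c.roots = c'.roots := by
  rw [← charRoots_elt, ← charRoots_elt, h.charRoots_eq]

namespace CanonicalForm

/-- The canonical forms with three distinct real roots. -/
def ofThree (i : Fin 3) (l₁ l₂ l₃ : ℝ) (h : l₁ > l₂) (h' : l₂ > l₃) : CanonicalForm :=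
  ![c1 l₁ l₂ l₃ h h', c2 l₁ l₂ l₃ h h', c3 l₁ l₂ l₃ h h'] i

/-- The canonical forms with a simple and a double root. -/
def ofTwo (i : Fin 4) (l m : ℝ) (h : l ≠ m) : CanonicalForm :=
  ![c5 l m h, c6 l m h, c7 l m h, c8 l m h] i

/-- The canonical forms with a triple root. -/
def ofOne (i : Fin 4) (r : ℝ) : CanonicalForm := ![c9 r, c10 r, c11 r, c12 r] i

theorem eq_of (c : CanonicalForm) :
    (∃ i l₁ l₂ l₃ h h', c = ofThree i l₁ l₂ l₃ h h') ∨ (∃ l p q hq, c = c4 l p q hq) ∨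
      (∃ i l m h, c = ofTwo i l m h) ∨ ∃ i r, c = ofOne i r := by
  cases c with
  | c1 l₁ l₂ l₃ h h' => exact Or.inl ⟨0, l₁, l₂, l₃, h, h', rfl⟩
  | c2 l₁ l₂ l₃ h h' => exact Or.inl ⟨1, l₁, l₂, l₃, h, h', rfl⟩
  | c3 l₁ l₂ l₃ h h' => exact Or.inl ⟨2, l₁, l₂, l₃, h, h', rfl⟩
  | c4 l p q hq => exact Or.inr (Or.inl ⟨l, p, q, hq, rfl⟩)
  | c5 l m h => exact Or.inr (Or.inr (Or.inl ⟨0, l, m, h, rfl⟩))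
  | c6 l m h => exact Or.inr (Or.inr (Or.inl ⟨1, l, m, h, rfl⟩))
  | c7 l m h => exact Or.inr (Or.inr (Or.inl ⟨2, l, m, h, rfl⟩))
  | c8 l m h => exact Or.inr (Or.inr (Or.inl ⟨3, l, m, h, rfl⟩))
  | c9 r => exact Or.inr (Or.inr (Or.inr ⟨0, r, rfl⟩))
  | c10 r => exact Or.inr (Or.inr (Or.inr ⟨1, r, rfl⟩))
  | c11 r => exact Or.inr (Or.inr (Or.inr ⟨2, r, rfl⟩))
  | c12 r => exact Or.inr (Or.inr (Or.inr ⟨3, r, rfl⟩))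

theorem roots_ofThree (i : Fin 3) (l₁ l₂ l₃ : ℝ) (h : l₁ > l₂) (h' : l₂ > l₃) :
    (ofThree i l₁ l₂ l₃ h h').roots = {(l₁ : ℂ), (l₂ : ℂ), (l₃ : ℂ)} := by
  fin_cases i <;> rfl

theorem roots_ofTwo (i : Fin 4) (l m : ℝ) (h : l ≠ m) :
    (ofTwo i l m h).roots = {(l : ℂ), (m : ℂ), (m : ℂ)} := by
  fin_cases i <;> rfl

theorem roots_ofOne (i : Fin 4) (r : ℝ) :
    (ofOne i r).roots = {(r : ℂ), (r : ℂ), (r : ℂ)} := by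
  fin_cases i <;> rfl

end CanonicalForm

theorem complex_roots_ne (a b c l p : ℝ) {q : ℝ} (hq : q > 0) :
    ({(a : ℂ), (b : ℂ), (c : ℂ)} : Multiset ℂ) ≠
    {(l : ℂ), (p : ℂ) + Complex.I * q, (p : ℂ) - Complex.I * q} := by
  intro h
  have h1 : (p : ℂ) + Complex.I * q ∈ ({(a : ℂ), (b : ℂ), (c : ℂ)} : Multiset ℂ) := by
    rw [h]; simp
  simp only [Multiset.insert_eq_cons, Multiset.mem_cons,
    Multiset.mem_singleton] at h1
  rcases h1 with h1 | h1 | h1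
  all_goals
    have := congrArg Complex.im h1
    simp at this
    exact hq.ne' this

theorem mem_of_roots_eq {a b c x y z : ℝ}
    (h : ({(a : ℂ), (b : ℂ), (c : ℂ)} : Multiset ℂ) = {(x : ℂ), (y : ℂ), (z : ℂ)}) :
    (a = x ∨ a = y ∨ a = z) ∧ (b = x ∨ b = y ∨ b = z) ∧ (c = x ∨ c = y ∨ c = z) := by
  have h1 : ∀ r : ℝ, (r : ℂ) ∈ ({(a : ℂ), (b : ℂ), (c : ℂ)} : Multiset ℂ) →
      r = x ∨ r = y ∨ r = z := by
    intro r hr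
    rw [h] at hr
    simpa using hr
  exact ⟨h1 a (by simp), h1 b (by simp), h1 c (by simp)⟩

theorem double_roots_eq {l m l' m' : ℝ} (h : l ≠ m)
    (hr : ({(l : ℂ), (m : ℂ), (m : ℂ)} : Multiset ℂ) = {(l' : ℂ), (m' : ℂ), (m' : ℂ)}) :
    l = l' ∧ m = m' := by
  have h1 := mem_of_roots_eq hr
  have h2 := mem_of_roots_eq hr.symm
  have h3 := congrArg Multiset.sum hr
  simp at h3
  norm_cast at h3
  grind

theorem CanonicalForm.ofTwo_inj {i j : Fin 4} {l m l' m' : ℝ} {h : l ≠ m} {h' : l' ≠ m'}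
    (hc : SameOrbit (ofTwo i l m h).elt (ofTwo j l' m' h').elt) :
    ofTwo i l m h = ofTwo j l' m' h' := by
  have hr := roots_eq hc
  rw [roots_ofTwo, roots_ofTwo] at hr
  obtain ⟨rfl, rfl⟩ := double_roots_eq h hr
  suffices i = j by rw [this]
  have i1 := fun X => invariants_diag_one (X := X) h
  have i2 := fun X => invariants_diag_three (X := X) h
  have i3 := fun X => invariants_diag_add_Pplus (X := X) h
  have i4 := fun X => invariants_diag_add_Pminus (X := X) h
  -- the index of a form is determined by the position of `E_{X,l}` and `W_{X,l}`
  have key : ∀ X (i : Fin 4), SameOrbit X (ofTwo i l m h).elt →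
      (EX X l ∈ hypPlane ↔ i = 0) ∧ (WX X l ∈ nullCone₁plus ↔ i = 2) ∧
        (WX X l ∈ nullCone₁minus ↔ i = 3) := by
    intro X i hX
    have d1 : ¬ (EX X l ∈ hypPlane ∧ EX X l ∈ hypPlane') := fun h => disjoint_hypPlane.le_bot h
    have d2 : WX X l = 0 → WX X l ∉ nullCone₁plus ∧ WX X l ∉ nullCone₁minus := fun h => by
      rw [h]; exact not_mem_nullCone₁_zero
    have d3 : ¬ (WX X l ∈ nullCone₁plus ∧ WX X l ∈ nullCone₁minus) :=
      fun h => disjoint_nullCone₁.le_bot h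
    fin_cases i
    · have := i1 X hX; simp; tauto
    · have := i2 X hX; simp; tauto
    · have := i3 X hX; simp; tauto
    · have := i4 X hX; simp; tauto
  have k1 := key _ i (SameOrbit.refl _)
  have k2 := key _ j hc
  rw [k1.1, k1.2.1, k1.2.2] at k2
  clear k1 hc
  revert i j
  decide

theorem CanonicalForm.ofOne_inj {i j : Fin 4} {r r' : ℝ}
    (hc : SameOrbit (ofOne i r).elt (ofOne j r').elt) : ofOne i r = ofOne j r' := by
  have hr := roots_eq hc
  rw [roots_ofOne, roots_ofOne] at hr
  obtain rfl : r = r' := by simpa using (mem_of_roots_eq hr).1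
  suffices i = j by rw [this]
  have key : ∀ X (i : Fin 4), SameOrbit X (ofOne i r).elt →
      (tracelessPart X ∈ nullCone₁plus ↔ i = 1) ∧ (tracelessPart X ∈ nullCone₁minus ↔ i = 2) ∧
        (tracelessPart X ∈ nullCone₂ ↔ i = 3) := by
    intro X i hX
    have e0 : tracelessPart (r • unitE) = 0 := by
      simpa using tracelessPart_smul_add (P := 0) r (by simp [tr])
    rw [hX.iff_tracelessPart_mem _ fun _ hg _ => map_mem_nullCone₁plus hg,
      hX.iff_tracelessPart_mem _ fun _ hg _ => map_mem_nullCone₁minus hg,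
      hX.iff_tracelessPart_mem _ fun _ hg _ => map_mem_nullCone₂ hg]
    have z2 : (0 : J1) ∉ nullCone₂ :=
      not_mem_nullCone₂_of_cross (by simpa using cross_smul_smul 0 (0 : J1))
    fin_cases i <;> simp only [ofOne, elt]
    · change (tracelessPart (r • unitE) ∈ _ ↔ _) ∧ (tracelessPart (r • unitE) ∈ _ ↔ _) ∧
        (tracelessPart (r • unitE) ∈ _ ↔ _)
      rw [e0]
      simp [not_mem_nullCone₁_zero, z2]
    · change (tracelessPart (r • unitE + Pplus) ∈ _ ↔ _) ∧
        (tracelessPart (r • unitE + Pplus) ∈ _ ↔ _) ∧ (tracelessPart (r • unitE + Pplus) ∈ _ ↔ _)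
      rw [tracelessPart_smul_add _ Pplus_mem.2.1]
      have h1 : Pplus ∉ nullCone₁minus := fun h => disjoint_nullCone₁.le_bot ⟨Pplus_mem, h⟩
      simp [Pplus_mem, h1, not_mem_nullCone₂_of_cross Pplus_mem.1]
    · change (tracelessPart (r • unitE + Pminus) ∈ _ ↔ _) ∧
        (tracelessPart (r • unitE + Pminus) ∈ _ ↔ _) ∧ (tracelessPart (r • unitE + Pminus) ∈ _ ↔ _)
      rw [tracelessPart_smul_add _ Pminus_mem.2.1]
      have h1 : Pminus ∉ nullCone₁plus := fun h => disjoint_nullCone₁.le_bot ⟨h, Pminus_mem⟩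
      simp [Pminus_mem, h1, not_mem_nullCone₂_of_cross Pminus_mem.1]
    · change (tracelessPart (r • unitE + Qplus 1) ∈ _ ↔ _) ∧
        (tracelessPart (r • unitE + Qplus 1) ∈ _ ↔ _) ∧
          (tracelessPart (r • unitE + Qplus 1) ∈ _ ↔ _)
      rw [tracelessPart_smul_add _ Qplus_mem.1]
      have h1 : Qplus 1 ∉ nullCone₁plus := fun h => not_mem_nullCone₂_of_cross h.1 Qplus_mem
      have h2 : Qplus 1 ∉ nullCone₁minus := fun h => not_mem_nullCone₂_of_cross h.1 Qplus_mem
      simp [Qplus_mem, h1, h2]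
  have k1 := key _ i (SameOrbit.refl _)
  have k2 := key _ j hc
  rw [k1.1, k1.2.1, k1.2.2] at k2
  clear k1 hc
  revert i j
  decide

theorem CanonicalForm.ofThree_inj {i j : Fin 3} {l₁ l₂ l₃ m₁ m₂ m₃ : ℝ} {h : l₁ > l₂} {h' : l₂ > l₃}
    {hm : m₁ > m₂} {hm' : m₂ > m₃}
    (hc : SameOrbit (ofThree i l₁ l₂ l₃ h h').elt (ofThree j m₁ m₂ m₃ hm hm').elt) :
    ofThree i l₁ l₂ l₃ h h' = ofThree j m₁ m₂ m₃ hm hm' := by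
  have hr := roots_eq hc
  rw [roots_ofThree, roots_ofThree] at hr
  have h1 := mem_of_roots_eq hr
  have h2 := mem_of_roots_eq hr.symm
  obtain rfl : l₁ = m₁ := by grind
  obtain rfl : l₃ = m₃ := by grind
  obtain rfl : l₂ = m₂ := by grind
  suffices i = j by rw [this]
  have helt : ∀ i, (ofThree i l₁ l₂ l₃ h h').elt =
      diag (![l₁, l₂, l₃] i) (![l₁, l₂, l₃] (i + 1)) (![l₁, l₂, l₃] (i + 2)) := by
    intro i
    fin_cases i <;> rfl
  have hl : Function.Injective ![l₁, l₂, l₃] := injective_of_gt h h'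
  rw [helt, helt] at hc
  exact eq_of_mem_hypPlane_of_sameOrbit hl hc (EX_mem_of_sameOrbit_diag hl (SameOrbit.refl _))

theorem CanonicalForm.eq_of_sameOrbit {c c' : CanonicalForm} (h : SameOrbit c.elt c'.elt) :
    c = c' := by
  have hr := roots_eq h
  rcases c.eq_of with ⟨i, l₁, l₂, l₃, h₁₂, h₂₃, rfl⟩ | ⟨l, p, q, hq, rfl⟩ | ⟨i, l, m, hlm, rfl⟩ |
      ⟨i, r, rfl⟩ <;>
    rcases c'.eq_of with ⟨j, m₁, m₂, m₃, k₁₂, k₂₃, rfl⟩ | ⟨l', p', q', hq', rfl⟩ |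
      ⟨j, l', m', hlm', rfl⟩ | ⟨j, r', rfl⟩
  · exact ofThree_inj h
  · rw [roots_ofThree] at hr
    exact (complex_roots_ne _ _ _ _ _ hq' hr).elim
  · rw [roots_ofThree, roots_ofTwo] at hr
    grind [mem_of_roots_eq hr]
  · rw [roots_ofThree, roots_ofOne] at hr
    grind [mem_of_roots_eq hr]
  · rw [roots_ofThree] at hr
    exact (complex_roots_ne _ _ _ _ _ hq hr.symm).elim
  · have hl : (l : ℂ) ∈ (c4 l' p' q' hq').roots := by rw [← hr]; simp [roots]
    simp only [roots, Multiset.insert_eq_cons, Multiset.mem_cons, Multiset.mem_singleton] at hl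
    obtain rfl : l = l' := by
      rcases hl with hl | hl | hl
      · exact_mod_cast hl
      · have := congrArg Complex.im hl
        simp at this
        exact absurd this hq'.ne
      · have := congrArg Complex.im hl
        simp at this
        exact absurd this hq'.ne'
    obtain ⟨a1, a2, -⟩ := (charRoots_eq_complex_iff _ _ _ _).mp (charRoots_elt (c4 l p q hq))
    obtain ⟨b1, b2, -⟩ := (charRoots_eq_complex_iff _ _ _ _).mp (charRoots_elt (c4 l p' q' hq'))
    rw [h.tr_eq, ← b1] at a1
    rw [h.tr_cross_eq, ← b2] at a2
    obtain rfl : p = p' := by linarith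
    obtain rfl : q = q' := (pow_left_inj₀ hq.le hq'.le two_ne_zero).mp (by linarith)
    rfl
  · rw [roots_ofTwo] at hr
    exact (complex_roots_ne _ _ _ _ _ hq hr.symm).elim
  · rw [roots_ofOne] at hr
    exact (complex_roots_ne _ _ _ _ _ hq hr.symm).elim
  · rw [roots_ofTwo, roots_ofThree] at hr
    grind [mem_of_roots_eq hr.symm]
  · rw [roots_ofTwo] at hr
    exact (complex_roots_ne _ _ _ _ _ hq' hr).elim
  · exact ofTwo_inj h
  · rw [roots_ofTwo, roots_ofOne] at hr
    grind [mem_of_roots_eq hr]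
  · rw [roots_ofOne, roots_ofThree] at hr
    grind [mem_of_roots_eq hr.symm]
  · rw [roots_ofOne] at hr
    exact (complex_roots_ne _ _ _ _ _ hq' hr).elim
  · rw [roots_ofOne, roots_ofTwo] at hr
    grind [mem_of_roots_eq hr.symm]
  · exact ofOne_inj h

theorem pairwise_disjoint_cones :
    [({0} : Set J1), nullCone₁plus, nullCone₁minus, nullCone₂].Pairwise Disjoint := by
  have z2 : (0 : J1) ∉ nullCone₂ :=
    not_mem_nullCone₂_of_cross (by simpa using cross_smul_smul 0 (0 : J1))
  have d1 : Disjoint nullCone₁plus nullCone₂ :=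
    Set.disjoint_left.mpr fun _ h => not_mem_nullCone₂_of_cross h.1
  have d2 : Disjoint nullCone₁minus nullCone₂ :=
    Set.disjoint_left.mpr fun _ h => not_mem_nullCone₂_of_cross h.1
  simp [not_mem_nullCone₁_zero, z2, d1, d2, disjoint_nullCone₁]

end ExcJordan

end

theorem mainTheorem1 :
    -- the unions below are disjoint
    (Disjoint hypPlane hypPlane' ∧
      [({0} : Set J1), nullCone₁plus, nullCone₁minus, nullCone₂].Pairwise Disjoint) ∧
    -- (1) three distinct real characteristic roots
    (∀ (X : J1) (l : Fin 3 → ℝ), l 0 > l 1 → l 1 > l 2 →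
      charRoots X = {(l 0 : ℂ), (l 1 : ℂ), (l 2 : ℂ)} →
        (∃! i : Fin 3, hypPlane ∩ minSpace X = {EX X (l i)} ∧
          hypPlane' ∩ minSpace X = {EX X (l (i + 1)), EX X (l (i + 2))} ∧
          EX X (l (i + 1)) ≠ EX X (l (i + 2))) ∧
        (EX X (l 0) ∈ hypPlane ↔ X ∈ orb (diag (l 0) (l 1) (l 2))) ∧
        (EX X (l 1) ∈ hypPlane ↔ X ∈ orb (diag (l 1) (l 2) (l 0))) ∧
        (EX X (l 2) ∈ hypPlane ↔ X ∈ orb (diag (l 2) (l 0) (l 1)))) ∧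
    -- (2) a real root and two complex conjugate roots
    (∀ (X : J1) (l₁ p q : ℝ), q > 0 →
      charRoots X = {(l₁ : ℂ), (p : ℂ) + Complex.I * q, (p : ℂ) - Complex.I * q} →
        X ∈ orb (diag p p l₁ + F₃ (q • 1))) ∧
    -- (3) a simple root and a double root
    (∀ (X : J1) (l₁ l₂ : ℝ), l₁ ≠ l₂ → charRoots X = {(l₁ : ℂ), (l₂ : ℂ), (l₂ : ℂ)} →
        EX X l₁ ∈ hypPlane ∪ hypPlane' ∧
        WX X l₁ ∈ {0} ∪ nullCone₁plus ∪ nullCone₁minus ∧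
        (EX X l₁ ∈ hypPlane → WX X l₁ = 0) ∧
        (WX X l₁ ≠ 0 → EX X l₁ ∈ hypPlane') ∧
        (EX X l₁ ∈ hypPlane ↔ X ∈ orb (diag l₁ l₂ l₂)) ∧
        (EX X l₁ ∈ hypPlane' ∧ WX X l₁ = 0 ↔ X ∈ orb (diag l₂ l₂ l₁)) ∧
        (WX X l₁ ∈ nullCone₁plus ↔ X ∈ orb (diag l₂ l₂ l₁ + Pplus)) ∧
        (WX X l₁ ∈ nullCone₁minus ↔ X ∈ orb (diag l₂ l₂ l₁ + Pminus))) ∧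
    -- (4) a triple root
    (∀ (X : J1) (l : ℝ), charRoots X = {(l : ℂ), (l : ℂ), (l : ℂ)} →
        tracelessPart X ∈ {0} ∪ nullCone₁plus ∪ nullCone₁minus ∪ nullCone₂ ∧
        (tracelessPart X = 0 ↔ X ∈ orb ((3⁻¹ * tr X) • unitE)) ∧
        (tracelessPart X ∈ nullCone₁plus ↔ X ∈ orb ((3⁻¹ * tr X) • unitE + Pplus)) ∧
        (tracelessPart X ∈ nullCone₁minus ↔ X ∈ orb ((3⁻¹ * tr X) • unitE + Pminus)) ∧
        (tracelessPart X ∈ nullCone₂ ↔ X ∈ orb ((3⁻¹ * tr X) • unitE + Qplus 1))) ∧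
    -- every element is conjugate to a canonical form
    (∀ X : J1, ∃ c : CanonicalForm, X ∈ orb c.elt) ∧
    -- (5) canonical forms of different type or with different parameters are not conjugate
    (∀ c c' : CanonicalForm, c.elt ∈ orb c'.elt → c = c') := by
  refine ⟨⟨disjoint_hypPlane, pairwise_disjoint_cones⟩, fun X l h01 h12 h => ?_,
    fun X l₁ p q hq h => mem_orb_iff.mpr (sameOrbit_of_complex_root hq h),
    classification_double_root, fun X l h => classification_triple_root h, exists_canonicalForm,
    fun c c' h => CanonicalForm.eq_of_sameOrbit (mem_orb_iff.mp h)⟩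
  obtain ⟨hi, hj⟩ := classification_three_real X l h01 h12 h
  exact ⟨hi, hj 0, hj 1, hj 2⟩
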